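/- Let $d\ge 2$ and $k\ge 1$ be integers. Let $\mathbb T^d=\mathbb R^d/\mathbb Z^d$ be the flat torus with its quotient Euclidean distance, let $B_r(x)$ be the closed ball of radius $r$ around $x$ (with $B_\infty(x)=\mathbb T^d$), and let $\mathrm dx$ be Lebesgue measure on $\mathbb T^d$. Let $\mathbf K$ be a probability measure on $\mathbb T^d$ with a density $\lambda$ satisfying $0<\lambda_-\le\lambda(x)\le\lambda_+<\infty$ for all $x\in\mathbb T^d$. For a finite counting measure $\omega$ on $\mathbb T^d$, $x\in\mathbb T^d$ and $n\in\mathbb N$, put $$R_k(x,\omega)=\inf\{r>0:\ \omega(B_r(x)\setminus\{x\})\ge k\}\quad(\inf\emptyset=\infty),\qquad \mathbf K_k(x,\omega)=\mathbf K\big(B_{R_k(x,\omega)}(x)\big),$$ $$a_n=\log n+(k-1)\log\log n-\log (k-1)!,\qquad \xi_n[\omega]=\sum_{x\in\omega}\delta_{(x,\;n\mathbf K_k(x,\omega)-a_n)},$$ where the sum counts points with multiplicity. Let $\eta_n$ be a Poisson process on $\mathbb T^d$ with intensity measure $n\mathbf K$, and let $\zeta$ be a Poisson process on $\mathbb T^d\times\mathbb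 R$ with intensity measure $\lambda(x)\,\mathrm dx\,e^{-t}\,\mathrm dt$. For almost surely finite point processes $\xi,\xi'$ on a space $\mathbb Y$, let $\mathbf{d_{KR}}(\xi,\xi')=\sup_h|\mathbb E h(\xi)-\mathbb E h(\xi')|$, where $h$ runs through the measurable real functionals on finite counting measures on $\mathbb Y$ with $|h(\omega_1)-h(\omega_2)|\le\sup_A|\omega_1(A)-\omega_2(A)|$ for all $\omega_1,\omega_2$ (the supremum over measurable $A\subset\mathbb Y$). Then, for every $b_0\in\mathbb R$, there is a constant $C\in(0,\infty)$ depending only on $b_0,k,d,\lambda_+$ and $\lambda_-$ such that for all $n\ge 3$ $$\mathbf{d_{KR}}\Big(\xi_n[\eta_n]\cap\big(\mathbb T^d\times(b_0,\infty)\big),\ \zeta\cap\big(\mathbb T^d\times(b_0,\infty)\big)\Big)\le C\,\frac{\log\log n}{\log n},$$ where $\cap$ denotes restriction; in particular all the expectations involved exist. Moreover, $\xi_n[\eta_n]$ converges in distribution to $\zeta$ as $n\to\infty$, as point processes on $\mathbb T^d\times\mathbb R$: $\mathbb E F(\xi_n[\eta_n])\to\mathbb E F(\zeta)$ for every bounded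 functional $F$ of locally finite counting measures on $\mathbb T^d\times\mathbb R$ that is continuous in the vague topology. -/

import Mathlib

open MeasureTheory ProbabilityTheory Filter Topology
open scoped ENNReal CompactlySupported

noncomputable section

/-! ### Counting measures and Poisson processes -/

/-- `ω` is a `σ`-finite counting measure: every measurable set has mass in `{0, 1, 2, …, ∞}`.
Spaces of measures carry Mathlib's `σ`-algebra, which is generated by the evaluations
`ω ↦ ω B`, `B` measurable. -/
def IsCountingMeasure {X : Type*} [MeasurableSpace X] (ω : Measure X) : Prop :=
  SigmaFinite ω ∧ ∀ B, MeasurableSet B → ∃ m : ℕ∞, ω B = (m : ℝ≥0∞)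

/-- The Poisson law on `{0, 1, 2, …, ∞}` with mean `r`; the Poisson law with mean `∞` is the
point mass at `∞`. -/
def poissonLaw (r : ℝ≥0∞) : Measure ℝ≥0∞ :=
  if r = ∞ then Measure.dirac ∞
  else (poissonMeasure r.toNNReal).map (fun j : ℕ => (j : ℝ≥0∞))

/-- `η` is a Poisson process with intensity measure `μ`, on the probability space `(Ω, P)`. -/
structure IsPoissonProcess {Ω X : Type*} [MeasurableSpace Ω] [MeasurableSpace X]
    (η : Ω → Measure X) (μ : Measure X) (P : Measure Ω) : Prop where
  measurable : Measurable η
  counting : ∀ᵐ ω ∂P, IsCountingMeasure (η ω)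
  law : ∀ B, MeasurableSet B → P.map (fun ω => η ω B) = poissonLaw (μ B)
  indep : ∀ (m : ℕ) (B : Fin m → Set X), (∀ i, MeasurableSet (B i)) →
    Pairwise (fun i j => Disjoint (B i) (B j)) → iIndepFun (fun i ω => η ω (B i)) P

/-! ### The Kantorovich-Rubinstein distance -/

/-- The total variation distance `sup_A |μ A - ν A|`, over the measurable sets `A` that have finite
mass under both measures. -/
def tvDist {Y : Type*} [MeasurableSpace Y] (μ ν : Measure Y) : ℝ≥0∞ :=
  ⨆ (A : Set Y) (_ : MeasurableSet A) (_ : μ A ≠ ∞) (_ : ν A ≠ ∞),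
    ENNReal.ofReal |(μ A).toReal - (ν A).toReal|

/-- The space of finite counting measures. -/
abbrev FiniteConfig (Y : Type*) [MeasurableSpace Y] : Type _ :=
  {ω : Measure Y // IsCountingMeasure ω ∧ IsFiniteMeasure ω}

/-- The class `Lip(Y)` of measurable functionals on finite counting measures that are `1`-Lipschitz
in total variation. Only the restriction of `h` to `FiniteConfig Y` is constrained, and its values
elsewhere are irrelevant for point processes that are almost surely finite. -/
def IsLipFunctional {Y : Type*} [MeasurableSpace Y] (h : Measure Y → ℝ) : Prop :=
  Measurable (fun ω : FiniteConfig Y => h ω.1) ∧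
    ∀ ω₁ ω₂ : FiniteConfig Y, ENNReal.ofReal |h ω₁.1 - h ω₂.1| ≤ tvDist ω₁.1 ω₂.1

open Classical in
/-- The Kantorovich-Rubinstein distance `sup_h |E h(ξ) - E h(ζ)|` over `h` in `Lip(Y)`, between
almost surely finite point processes `ξ` and `ζ`; it is `∞` when one of the expectations does not
exist. -/
def krDist {Ω Ω' Y : Type*} [MeasurableSpace Ω] [MeasurableSpace Ω'] [MeasurableSpace Y]
    (P : Measure Ω) (ξ : Ω → Measure Y) (P' : Measure Ω') (ζ : Ω' → Measure Y) : ℝ≥0∞ :=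
  ⨆ (h : Measure Y → ℝ) (_ : IsLipFunctional h),
    if Integrable (fun ω => h (ξ ω)) P ∧ Integrable (fun ω => h (ζ ω)) P' then
      ENNReal.ofReal |(∫ ω, h (ξ ω) ∂P) - ∫ ω, h (ζ ω) ∂P'|
    else ∞

/-! ### Convergence in distribution of point processes -/

/-- The space of locally finite counting measures. -/
def LocallyFiniteConfig (Y : Type*) [TopologicalSpace Y] [MeasurableSpace Y] : Type _ :=
  {ω : Measure Y // IsCountingMeasure ω ∧ IsLocallyFiniteMeasure ω}

/-- The vague topology: the coarsest one for which `ω ↦ ∫ f dω` is continuous for every continuous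
function `f` with compact support. -/
instance {Y : Type*} [TopologicalSpace Y] [MeasurableSpace Y] :
    TopologicalSpace (LocallyFiniteConfig Y) :=
  TopologicalSpace.induced
    (fun (ω : LocallyFiniteConfig Y) (f : C_c(Y, ℝ)) => ∫ y, f y ∂ω.1) Pi.topologicalSpace

/-- Convergence in distribution of point processes on `Y`: the `ξ n` and `ζ` are (almost surely)
random locally finite counting measures, and `E F(ξ n) → E F(ζ)` for every bounded functional `F`
of locally finite counting measures that is continuous in the vague topology. The values of `F` at
other measures are irrelevant. -/
structure ConvergesInDistribution {Ω : ℕ → Type*} {Ω' Y : Type*} [∀ n, MeasurableSpace (Ω n)]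
    [MeasurableSpace Ω'] [TopologicalSpace Y] [MeasurableSpace Y]
    (P : ∀ n, Measure (Ω n)) (ξ : ∀ n, Ω n → Measure Y)
    (P' : Measure Ω') (ζ : Ω' → Measure Y) : Prop where
  aemeasurable : ∀ n, AEMeasurable (ξ n) (P n)
  aemeasurable_limit : AEMeasurable ζ P'
  config : ∀ n, ∀ᵐ ω ∂(P n), IsCountingMeasure (ξ n ω) ∧ IsLocallyFiniteMeasure (ξ n ω)
  config_limit : ∀ᵐ ω ∂P', IsCountingMeasure (ζ ω) ∧ IsLocallyFiniteMeasure (ζ ω)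
  tendsto : ∀ F : Measure Y → ℝ,
    Continuous (fun ω : LocallyFiniteConfig Y => F ω.1) →
    (∃ c : ℝ, ∀ ω : LocallyFiniteConfig Y, |F ω.1| ≤ c) →
    Tendsto (fun n => ∫ ω, F (ξ n ω) ∂(P n)) atTop (𝓝 (∫ ω, F (ζ ω) ∂P'))

/-! ### The flat torus and the process of large `k`-nearest neighbour balls -/

/-- The flat torus `ℝ^d / ℤ^d`: the distance is the `ℓ²` combination of the distances on the
`d` circles `ℝ / ℤ`, that is, the quotient of the Euclidean distance. -/
abbrev FlatTorus (d : ℕ) : Type := PiLp 2 (fun _ : Fin d => UnitAddCircle)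

/-- Lebesgue measure on the flat torus, of total mass one. -/
def torusVolume (d : ℕ) : Measure (FlatTorus d) :=
  (volume : Measure (Fin d → UnitAddCircle)).map (WithLp.toLp 2)

/-- The measure `K` on the torus with density `lam` with respect to Lebesgue measure. -/
def torusMeasure {d : ℕ} (lam : FlatTorus d → ℝ) : Measure (FlatTorus d) :=
  (torusVolume d).withDensity (fun x => ENNReal.ofReal (lam x))

/-- The intensity measure `lam x dx e^{-t} dt` on `𝕋^d × ℝ`. -/
def limitIntensity {d : ℕ} (lam : FlatTorus d → ℝ) : Measure (FlatTorus d × ℝ) :=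
  ((torusVolume d).prod volume).withDensity
    (fun p => ENNReal.ofReal (lam p.1 * Real.exp (-p.2)))

/-- The `k`-nearest neighbour distance `inf {r > 0 : ω(B_r(x) ∖ {x}) ≥ k}`, which is `∞` when there
is no such `r`. -/
def knnRadius {d : ℕ} (k : ℕ) (x : FlatTorus d) (ω : Measure (FlatTorus d)) : ℝ≥0∞ :=
  ⨅ (r : ℝ) (_ : 0 < r) (_ : (k : ℝ≥0∞) ≤ ω (Metric.closedBall x r \ {x})), ENNReal.ofReal r

/-- The `K`-mass of the closed ball around `x` whose radius is the `k`-nearest neighbour distance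
(the whole torus when that distance is `∞`). -/
def knnMass {d : ℕ} (K : Measure (FlatTorus d)) (k : ℕ) (x : FlatTorus d)
    (ω : Measure (FlatTorus d)) : ℝ≥0∞ :=
  K {y | edist y x ≤ knnRadius k x ω}

/-- The centring `a_n = log n + (k - 1) log log n - log (k - 1)!`. -/
def knnCentring (n k : ℕ) : ℝ :=
  Real.log n + ((k : ℝ) - 1) * Real.log (Real.log n) - Real.log ((k - 1).factorial : ℝ)

/-- The point process `∑_{x ∈ ω} δ_{(x, n K(k-nearest neighbour ball of x) - a_n)}` for a finite
counting measure `ω`, with multiplicities, written as the image of `ω`. -/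
def knnProcess {d : ℕ} (K : Measure (FlatTorus d)) (n k : ℕ) (ω : Measure (FlatTorus d)) :
    Measure (FlatTorus d × ℝ) :=
  ω.map (fun x => (x, (n : ℝ) * (knnMass K k x ω).toReal - knnCentring n k))

end

/-! Write L = log n and call a point x of η_n with n K_k(x, η_n) - a_n > b an exceedance. The Mecke
formula reduces first moments of ξ_n to the law of n K_k at a fixed point x. The ball of mass v/n
around x holds a Poisson number of points with mean v, so n K_k has the Erlang law of shape k,
truncated at n (`map_knnMass`). The centring a_n is such that n times the Erlang density at a_n + t
equals e^{-t} ((a_n + t)/L)^{k-1}. The last factor is 1 + O(log L / L), and this is where the rate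
comes from; for large n every other error below is O(1/L).

Closeness of intensities becomes Poisson approximation by a block argument. With high probability
only balls of radius at most r, of order (L/n)^{1/d}, matter. The torus is cut into about L parallel
slabs separated by corridors. Up to rare points with a sparse neighbourhood, the exceedances in a
slab are determined by η_n in the slab enlarged by r; the enlarged slabs are disjoint, so the slabs
contribute independently. In one slab a functional that is Lipschitz in total variation is replaced
by its first order expansion at the empty configuration: this is exact for at most one point, so the
error is governed by the expected number of pairs, and the linear terms are compared through the
intensities (`TVLip.abs_expect_sub_le`). The slabs are then exchanged for those of the limit one at
a time (`TVLip.abs_expect_sum_sub_le`). The corridors have volume O(1/L), and each slab has mass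
O(1/L).

Pairs are rare for the following reason. If x and y are both exceedances, with balls B_x and B_y of
mass (a_n + b)/n, then the disjoint sets B_x and B_y \ B_x both have few points, and these events
are independent. For distant x, y this gives a product of two small probabilities. For close x, y
the mass of B_y \ B_x is at least proportional to the distance: about 2r/|x - y| translations by y -
x move a ball of radius at most r off itself, each gaining at most the same volume
(`torusVolume_closedBall_le_mul_diff`). Integrating the resulting exponential gives a bound of order
n (r/L)^d, that is L^{1-d}, which is O(1/L) because d ≥ 2. The remaining finitely many n are covered
by the total expected number of points.

For convergence in distribution, distinct configurations have total variation distance at least 1,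
so the distance bound controls all bounded measurable functionals of the points above a level -j. A
bounded vaguely continuous F lies below an envelope that only sees the points above -j and that
tends to F as j grows (`tendsto_upperEnvelope`). Letting n and then j tend to infinity, for F and
for -F, gives the claim. -/

noncomputable section

/-! ### Finite counting measures -/

namespace FiniteConfig

variable {X Y : Type*} [MeasurableSpace X] [MeasurableSpace Y]

instance instIsFiniteMeasure (ω : FiniteConfig X) : IsFiniteMeasure ω.1 := ω.2.2

/-- Build a finite counting measure. -/
def of (ω : Measure X) [IsFiniteMeasure ω]
    (h : ∀ B, MeasurableSet B → ∃ m : ℕ∞, ω B = (m : ℝ≥0∞)) : FiniteConfig X :=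
  ⟨ω, ⟨inferInstance, h⟩, inferInstance⟩

lemma exists_nat (ω : FiniteConfig X) {B : Set X} (hB : MeasurableSet B) :
    ∃ m : ℕ, ω.1 B = m := by
  obtain ⟨m, hm⟩ := ω.2.1.2 B hB
  have : m ≠ ⊤ := by
    rintro rfl
    exact measure_ne_top ω.1 B (by simp at hm)
  lift m to ℕ using this
  exact ⟨m, by simpa using hm⟩

instance : Zero (FiniteConfig X) := ⟨of 0 fun _ _ => ⟨0, by simp⟩⟩

instance : Add (FiniteConfig X) := ⟨fun ω₁ ω₂ => of (ω₁.1 + ω₂.1) fun B hB => by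
  obtain ⟨m₁, h₁⟩ := ω₁.2.1.2 B hB
  obtain ⟨m₂, h₂⟩ := ω₂.2.1.2 B hB
  exact ⟨m₁ + m₂, by simp [h₁, h₂]⟩⟩

@[simp] lemma coe_zero : (0 : FiniteConfig X).1 = 0 := rfl

@[simp] lemma coe_add (ω₁ ω₂ : FiniteConfig X) : (ω₁ + ω₂).1 = ω₁.1 + ω₂.1 := rfl

instance : SMul ℕ (FiniteConfig X) := ⟨fun m ω => of (m • ω.1) fun B hB => by
  obtain ⟨m₁, h₁⟩ := ω.2.1.2 B hB
  exact ⟨m * m₁, by simp [h₁]⟩⟩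

instance : AddCommMonoid (FiniteConfig X) :=
  Function.Injective.addCommMonoid (fun ω : FiniteConfig X => ω.1) Subtype.val_injective
    rfl (fun _ _ => rfl) (fun _ _ => rfl)

/-- The inclusion of finite counting measures into measures, as an additive map. -/
def coeHom : FiniteConfig X →+ Measure X where
  toFun ω := ω.1
  map_zero' := rfl
  map_add' _ _ := rfl

lemma coe_sum {ι : Type*} (s : Finset ι) (f : ι → FiniteConfig X) :
    (∑ i ∈ s, f i).1 = ∑ i ∈ s, (f i).1 := map_sum (coeHom (X := X)) f s

instance : MeasurableAdd₂ (FiniteConfig X) := by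
  refine ⟨Measurable.subtype_mk ?_⟩
  exact (measurable_subtype_coe.comp measurable_fst).add (measurable_subtype_coe.comp measurable_snd)

/-- A single point. -/
def dirac (x : X) : FiniteConfig X := of (Measure.dirac x) fun B hB => by
  classical
  rw [Measure.dirac_apply' x hB]
  by_cases h : x ∈ B
  · exact ⟨1, by simp [h]⟩
  · exact ⟨0, by simp [h]⟩

@[simp] lemma coe_dirac (x : X) : (dirac x).1 = Measure.dirac x := rfl

lemma measurable_dirac : Measurable (dirac : X → FiniteConfig X) :=
  Measurable.subtype_mk Measure.measurable_dirac

/-- The restriction of a finite counting measure to a measurable set. -/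
def restrict (ω : FiniteConfig X) {S : Set X} (hS : MeasurableSet S) : FiniteConfig X :=
  of (ω.1.restrict S) fun B hB => by
    rw [Measure.restrict_apply hB]
    exact ω.2.1.2 _ (hB.inter hS)

@[simp] lemma coe_restrict (ω : FiniteConfig X) {S : Set X} (hS : MeasurableSet S) :
    (ω.restrict hS).1 = ω.1.restrict S := rfl

lemma measurable_coe {B : Set X} (hB : MeasurableSet B) :
    Measurable fun ω : FiniteConfig X => ω.1 B :=
  (Measure.measurable_coe hB).comp measurable_subtype_coe

lemma measurable_of_measurable_coe {α : Type*} [MeasurableSpace α] {f : α → FiniteConfig X}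
    (h : ∀ B, MeasurableSet B → Measurable fun a => (f a).1 B) : Measurable f :=
  (Measure.measurable_of_measurable_coe (fun a => (f a).1) h).subtype_mk

lemma measurable_restrict {S : Set X} (hS : MeasurableSet S) :
    Measurable fun ω : FiniteConfig X => ω.restrict hS :=
  measurable_of_measurable_coe fun B hB => by
    simp only [coe_restrict, Measure.restrict_apply hB]
    exact measurable_coe (hB.inter hS)

lemma ext_of_apply {ω₁ ω₂ : FiniteConfig X} (h : ∀ B, MeasurableSet B → ω₁.1 B = ω₂.1 B) :
    ω₁ = ω₂ := Subtype.ext (Measure.ext h)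

/-- The image of a finite counting measure. -/
def map (ω : FiniteConfig X) {f : X → Y} (hf : Measurable f) : FiniteConfig Y :=
  of (ω.1.map f) fun B hB => by
    rw [Measure.map_apply hf hB]
    exact ω.2.1.2 _ (hf hB)

/-- Finite counting measures, as a kernel. -/
def kernel (X : Type*) [MeasurableSpace X] : Kernel (FiniteConfig X) X where
  toFun ω := ω.1
  measurable' := measurable_subtype_coe

/-- The total mass is unbounded over configurations, so the kernel is not finite. It is cut into the
slices of total mass m, each bounded by m. S-finiteness is what makes integrals against random
configurations jointly measurable. -/
instance : IsSFiniteKernel (kernel X) := by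
  classical
  have hS : ∀ m : ℕ, MeasurableSet {ω : FiniteConfig X | ω.1 Set.univ = m} := fun m =>
    measurable_coe MeasurableSet.univ (measurableSet_singleton _)
  refine ⟨⟨fun m => Kernel.piecewise (hS m) (kernel X) 0, fun m => ⟨⟨m, by simp, ?_⟩⟩, ?_⟩⟩
  · intro ω
    by_cases h : ω ∈ {ω : FiniteConfig X | ω.1 Set.univ = m}
    · simp only [Kernel.piecewise_apply, h, if_true]
      exact le_of_eq h
    · simp [Kernel.piecewise_apply, h]
  · ext ω B hB
    obtain ⟨m, hm⟩ := ω.exists_nat MeasurableSet.univ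
    rw [Kernel.sum_apply' _ _ hB, tsum_eq_single m]
    · simp [Kernel.piecewise_apply, hm]
    · intro b hb
      simp [Kernel.piecewise_apply, hm, hb.symm]

/-- Integrals against finite counting measures are jointly measurable. -/
lemma measurable_lintegral {α : Type*} [MeasurableSpace α] {g : α → FiniteConfig X}
    (hg : Measurable g) {f : α × X → ℝ≥0∞} (hf : Measurable f) :
    Measurable fun a => ∫⁻ x, f (a, x) ∂(g a).1 :=
  Measurable.lintegral_kernel_prod_right' (κ := (kernel X).comap g hg) hf

lemma measurable_measure {α : Type*} [MeasurableSpace α] {g : α → FiniteConfig X}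
    (hg : Measurable g) {S : Set (α × X)} (hS : MeasurableSet S) :
    Measurable fun a => (g a).1 {x | (a, x) ∈ S} :=
  Kernel.measurable_kernel_prodMk_left (κ := (kernel X).comap g hg) hS

lemma measurable_map {α : Type*} [MeasurableSpace α] {g : α → FiniteConfig X}
    (hg : Measurable g) {f : α → X → Y} (hf : Measurable fun p : α × X => f p.1 p.2) :
    Measurable fun a => (g a).map (f := f a) (hf.comp measurable_prodMk_left) :=
  measurable_of_measurable_coe fun B hB => by
    have : ∀ a, ((g a).map (f := f a) (hf.comp measurable_prodMk_left)).1 B =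
        (g a).1 {x | (a, x) ∈ (fun p : α × X => f p.1 p.2) ⁻¹' B} := fun a =>
      Measure.map_apply (hf.comp measurable_prodMk_left) hB
    simp only [this]
    exact measurable_measure hg (hf hB)

lemma eq_zero_of_apply_univ {ω : FiniteConfig X} (h : ω.1 Set.univ = 0) : ω = 0 :=
  Subtype.ext (Measure.measure_univ_eq_zero.1 h)

/-- Integer values and total mass one force every set to have mass 0 or 1, and on a standard Borel
space such a measure is a point mass. -/
lemma exists_eq_dirac [StandardBorelSpace X] {ω : FiniteConfig X} (h : ω.1 Set.univ = 1) :
    ∃ x, ω = dirac x := by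
  have h01 : IsZeroOneMeasure ω.1 := ⟨fun B hB => by
    obtain ⟨m, hm⟩ := ω.exists_nat hB
    have : ω.1 B ≤ 1 := h ▸ measure_mono (Set.subset_univ B)
    rw [hm] at this ⊢
    have : m ≤ 1 := by exact_mod_cast this
    interval_cases m <;> simp⟩
  have : NeZero ω.1 := ⟨fun h0 => by simp [h0] at h⟩
  obtain ⟨x, hx⟩ := IsZeroOneMeasure.exists_eq_dirac (μ := ω.1)
  exact ⟨x, Subtype.ext hx⟩

end FiniteConfig

/-! ### Functionals that are Lipschitz in total variation -/

/-- Measurable functionals of finite counting measures that are `1`-Lipschitz in total variation. -/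
structure TVLip {Y : Type*} [MeasurableSpace Y] (g : FiniteConfig Y → ℝ) : Prop where
  measurable : Measurable g
  le : ∀ (ω₁ ω₂ : FiniteConfig Y) (c : ℝ≥0∞), (∀ A, MeasurableSet A → ω₁.1 A ≤ ω₂.1 A + c) →
    (∀ A, MeasurableSet A → ω₂.1 A ≤ ω₁.1 A + c) → ENNReal.ofReal |g ω₁ - g ω₂| ≤ c

/-- The two one-sided bounds avoid subtraction in `ℝ≥0∞` and survive the addition of a common
configuration; this is why `TVLip` is phrased with them. -/
lemma tvDist_le {Y : Type*} [MeasurableSpace Y] {μ ν : Measure Y} {c : ℝ≥0∞}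
    (h₁ : ∀ A, MeasurableSet A → μ A ≤ ν A + c) (h₂ : ∀ A, MeasurableSet A → ν A ≤ μ A + c) :
    tvDist μ ν ≤ c := by
  rcases eq_or_ne c ∞ with rfl | hc
  · exact le_top
  refine iSup_le fun A => iSup_le fun hA => iSup_le fun hμ => iSup_le fun hν => ?_
  rw [ENNReal.ofReal_le_iff_le_toReal hc, abs_sub_le_iff]
  have h₁' := ENNReal.toReal_mono (by finiteness) (h₁ A hA)
  have h₂' := ENNReal.toReal_mono (by finiteness) (h₂ A hA)
  rw [ENNReal.toReal_add hν hc] at h₁'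
  rw [ENNReal.toReal_add hμ hc] at h₂'
  constructor <;> linarith

lemma IsLipFunctional.tvLip {Y : Type*} [MeasurableSpace Y] {h : Measure Y → ℝ}
    (hh : IsLipFunctional h) : TVLip fun ω : FiniteConfig Y => h ω.1 :=
  ⟨hh.1, fun ω₁ ω₂ _ h₁ h₂ => (hh.2 ω₁ ω₂).trans (tvDist_le h₁ h₂)⟩

namespace TVLip

variable {Y : Type*} [MeasurableSpace Y] {g : FiniteConfig Y → ℝ}

lemma comp_add_left (hg : TVLip g) (ω : FiniteConfig Y) : TVLip fun ω' => g (ω + ω') where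
  measurable := hg.measurable.comp (measurable_const.add measurable_id)
  le ω₁ ω₂ c h₁ h₂ := hg.le _ _ c
    (fun A hA => by simpa [add_assoc] using add_le_add_right (h₁ A hA) (ω.1 A))
    (fun A hA => by simpa [add_assoc] using add_le_add_right (h₂ A hA) (ω.1 A))

lemma ofReal_abs_sub_le (hg : TVLip g) (ω ω' : FiniteConfig Y) :
    ENNReal.ofReal |g (ω + ω') - g ω| ≤ ω'.1 Set.univ :=
  hg.le _ _ _ (fun A _ => add_le_add_right (measure_mono (Set.subset_univ A)) (ω.1 A))
    (fun A _ => by simp [add_assoc])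

lemma abs_sub_le (hg : TVLip g) (ω ω' : FiniteConfig Y) :
    |g (ω + ω') - g ω| ≤ ω'.1.real Set.univ := by
  have := ENNReal.toReal_mono (measure_ne_top _ _) (hg.ofReal_abs_sub_le ω ω')
  rwa [ENNReal.toReal_ofReal (abs_nonneg _)] at this

lemma abs_sub_zero_le (hg : TVLip g) (ω : FiniteConfig Y) :
    |g ω - g 0| ≤ ω.1.real Set.univ := by simpa using hg.abs_sub_le 0 ω

lemma abs_dirac_le (hg : TVLip g) (y : Y) : |g (.dirac y) - g 0| ≤ 1 := by
  simpa using hg.abs_sub_zero_le (.dirac y)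

lemma integrable (hg : TVLip g) {Ω : Type*} [MeasurableSpace Ω] {P : Measure Ω}
    [IsFiniteMeasure P] {ξ : Ω → FiniteConfig Y} (hξ : Measurable ξ)
    (h : ∫⁻ ω, (ξ ω).1 Set.univ ∂P ≠ ∞) : Integrable (fun ω => g (ξ ω)) P := by
  have hm : Measurable fun ω => (ξ ω).1 Set.univ :=
    (FiniteConfig.measurable_coe MeasurableSet.univ).comp hξ
  have h1 : Integrable (fun ω => (ξ ω).1.real Set.univ) P :=
    integrable_toReal_of_lintegral_ne_top hm.aemeasurable h
  have h2 : Integrable (fun ω => g (ξ ω) - g 0) P :=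
    h1.mono' ((hg.measurable.comp hξ).sub_const _).aestronglyMeasurable
      (.of_forall fun ω => hg.abs_sub_zero_le _)
  exact (h2.add (integrable_const (g 0))).congr (.of_forall fun ω => sub_add_cancel _ _)

/-- Closeness of expectations under a pointwise total variation bound. -/
lemma abs_integral_sub_le (hg : TVLip g) {Ω : Type*} [MeasurableSpace Ω] {P : Measure Ω}
    [IsFiniteMeasure P] {ξ ξ' : Ω → FiniteConfig Y} (hξ : Measurable ξ) (hξ' : Measurable ξ')
    (h : ∫⁻ ω, (ξ ω).1 Set.univ ∂P ≠ ∞) (h' : ∫⁻ ω, (ξ' ω).1 Set.univ ∂P ≠ ∞)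
    {D : Ω → ℝ≥0∞}
    (h₁ : ∀ ω A, MeasurableSet A → (ξ ω).1 A ≤ (ξ' ω).1 A + D ω)
    (h₂ : ∀ ω A, MeasurableSet A → (ξ' ω).1 A ≤ (ξ ω).1 A + D ω) :
    ENNReal.ofReal |(∫ ω, g (ξ ω) ∂P) - ∫ ω, g (ξ' ω) ∂P| ≤ ∫⁻ ω, D ω ∂P := by
  rw [← integral_sub (hg.integrable hξ h) (hg.integrable hξ' h')]
  calc _ ≤ ∫⁻ ω, ENNReal.ofReal |g (ξ ω) - g (ξ' ω)| ∂P := by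
        rw [← Real.norm_eq_abs, ofReal_norm]
        refine (enorm_integral_le_lintegral_enorm _).trans (lintegral_mono fun ω => ?_)
        rw [← ofReal_norm, Real.norm_eq_abs]
    _ ≤ _ := lintegral_mono fun ω => hg.le _ _ _ (h₁ ω) (h₂ ω)

end TVLip

/-! ### The Poisson law -/

lemma lintegral_poissonLaw {r : ℝ≥0∞} (hr : r ≠ ∞) {f : ℝ≥0∞ → ℝ≥0∞} (hf : Measurable f) :
    ∫⁻ t, f t ∂(poissonLaw r) =
      ∑' j : ℕ, ENNReal.ofReal (Real.exp (-r.toReal) * r.toReal ^ j / j.factorial) * f j := by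
  rw [poissonLaw, if_neg hr, lintegral_map hf (by fun_prop), poissonMeasure,
    lintegral_sum_measure]
  simp [lintegral_smul_measure, ENNReal.toReal]

lemma poisson_weight_succ (r : ℝ) (j : ℕ) :
    Real.exp (-r) * r ^ (j + 1) / ((j + 1).factorial : ℝ) * ((j + 1 : ℕ) : ℝ) =
      r * (Real.exp (-r) * r ^ j / (j.factorial : ℝ)) := by
  have : (j.factorial : ℝ) ≠ 0 := by positivity
  have : ((j : ℝ) + 1) ≠ 0 := by positivity
  rw [Nat.factorial_succ]
  push_cast
  field_simp
  ring

/-- The Chen-Stein identity characterizing the Poisson law. -/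
lemma lintegral_mul_poissonLaw {r : ℝ≥0∞} (hr : r ≠ ∞) {f : ℝ≥0∞ → ℝ≥0∞} (hf : Measurable f) :
    ∫⁻ t, t * f t ∂(poissonLaw r) = r * ∫⁻ t, f (t + 1) ∂(poissonLaw r) := by
  -- The factor t kills the term j = 0; for the others the Poisson weights satisfy (j + 1) p_{j+1} =
  -- r p_j.
  rw [lintegral_poissonLaw hr (by fun_prop), lintegral_poissonLaw hr (by fun_prop),
    tsum_eq_zero_add' ENNReal.summable, ← ENNReal.tsum_mul_left]
  simp only [Nat.cast_zero, zero_mul, mul_zero, zero_add]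
  congr 1 with j
  rw [← mul_assoc, ← mul_assoc]
  push_cast
  congr 1
  have h1 : ((j : ℝ≥0∞) + 1) = ENNReal.ofReal ((j + 1 : ℕ) : ℝ) := by
    rw [ENNReal.ofReal_natCast]; push_cast; rfl
  rw [h1, ← ENNReal.ofReal_mul (by positivity), poisson_weight_succ,
    ENNReal.ofReal_mul (by positivity), ENNReal.ofReal_toReal hr]

instance isProbabilityMeasure_poissonLaw (r : ℝ≥0∞) : IsProbabilityMeasure (poissonLaw r) := by
  unfold poissonLaw
  split_ifs
  · infer_instance
  · exact Measure.isProbabilityMeasure_map (by fun_prop)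

lemma lintegral_id_poissonLaw (r : ℝ≥0∞) : ∫⁻ t, t ∂(poissonLaw r) = r := by
  rcases eq_or_ne r ∞ with rfl | hr
  · simp [poissonLaw]
  · simpa using lintegral_mul_poissonLaw hr (f := fun _ => 1) measurable_const

/-- The probability that a Poisson random variable with mean `v` is less than `k`. -/
def poissonTail (k : ℕ) (v : ℝ) : ℝ :=
  Real.exp (-v) * ∑ j ∈ Finset.range k, v ^ j / (j.factorial : ℝ)

lemma poissonLaw_Iio {r : ℝ≥0∞} (hr : r ≠ ∞) (k : ℕ) :
    poissonLaw r (Set.Iio (k : ℝ≥0∞)) = ENNReal.ofReal (poissonTail k r.toReal) := by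
  have h1 := lintegral_poissonLaw hr (f := (Set.Iio (k : ℝ≥0∞)).indicator 1)
    (measurable_one.indicator measurableSet_Iio)
  rw [lintegral_indicator_one measurableSet_Iio] at h1
  rw [h1, tsum_eq_sum (s := Finset.range k), poissonTail, Finset.mul_sum,
    ENNReal.ofReal_sum_of_nonneg fun _ _ => by positivity]
  · refine Finset.sum_congr rfl fun j hj => ?_
    rw [Finset.mem_range] at hj
    simp [hj, mul_div_assoc]
  · intro j hj
    rw [Finset.mem_range] at hj
    simp [hj]

/-! ### Poisson processes with values in the finite counting measures -/

namespace IsPoissonProcess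

variable {Ω X : Type*} [MeasurableSpace Ω] [MeasurableSpace X] {μ : Measure X} {P : Measure Ω}

lemma congr {η η' : Ω → Measure X} (h : IsPoissonProcess η μ P) (hm : Measurable η')
    (he : η =ᵐ[P] η') : IsPoissonProcess η' μ P where
  measurable := hm
  counting := by
    filter_upwards [h.counting, he] with ω h1 h2
    rwa [← h2]
  law B hB := by
    rw [← h.law B hB]
    refine Measure.map_congr ?_
    filter_upwards [he] with ω hω
    rw [hω]
  indep m B hB hd := by
    refine (iIndepFun_congr fun i => ?_).1 (h.indep m B hB hd)
    filter_upwards [he] with ω hω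
    rw [hω]

lemma lintegral_apply {η : Ω → Measure X} (h : IsPoissonProcess η μ P) {B : Set X}
    (hB : MeasurableSet B) : ∫⁻ ω, η ω B ∂P = μ B := by
  rw [← lintegral_id_poissonLaw (μ B), ← h.law B hB, lintegral_map (f := fun t => t) measurable_id]
  exact (Measure.measurable_coe hB).comp h.measurable

lemma ae_apply_ne_top {η : Ω → Measure X} (h : IsPoissonProcess η μ P) {B : Set X}
    (hB : MeasurableSet B) (hμ : μ B ≠ ∞) : ∀ᵐ ω ∂P, η ω B ≠ ∞ := by
  have := ae_lt_top ((Measure.measurable_coe hB).comp h.measurable)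
    ((h.lintegral_apply hB).trans_ne hμ)
  filter_upwards [this] with ω hω using hω.ne

/-- The restriction of a Poisson process. -/
lemma restrict {η : Ω → Measure X} (h : IsPoissonProcess η μ P) {S : Set X}
    (hS : MeasurableSet S) :
    IsPoissonProcess (fun ω => (η ω).restrict S) (μ.restrict S) P where
  measurable := Measure.measurable_of_measurable_coe _ fun B hB => by
    simp only [Measure.restrict_apply hB]
    exact (Measure.measurable_coe (hB.inter hS)).comp h.measurable
  counting := by
    filter_upwards [h.counting] with ω hω
    have := hω.1
    refine ⟨inferInstance, fun B hB => ?_⟩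
    rw [Measure.restrict_apply hB]
    exact hω.2 _ (hB.inter hS)
  law B hB := by
    simp only [Measure.restrict_apply hB]
    exact h.law _ (hB.inter hS)
  indep m B hB hd := by
    simp only [Measure.restrict_apply (hB _)]
    exact h.indep m (fun i => B i ∩ S) (fun i => (hB i).inter hS)
      fun i j hij => (hd hij).mono Set.inter_subset_left Set.inter_subset_left

/-- Counts in the members of a finite measurable partition are independent. -/
lemma iIndepFun_fiber {η : Ω → Measure X} (h : IsPoissonProcess η μ P) {κ : Type*} [Finite κ]
    {B : κ → Set X} (hB : ∀ i, MeasurableSet (B i)) (hd : Pairwise fun i j => Disjoint (B i) (B j)) :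
    iIndepFun (fun i ω => η ω (B i)) P := by
  obtain ⟨n, ⟨e⟩⟩ := Finite.exists_equiv_fin κ
  have := (h.indep n (B ∘ e.symm) (fun i => hB _)
    fun i j hij => hd (e.symm.injective.ne hij)).precomp e.injective
  simpa [Function.comp_def] using this

/-- A measurable modification of a random measure which is almost surely a finite counting
measure. -/
lemma _root_.exists_finiteConfig_ae_eq {ξ : Ω → Measure X} (hm : AEMeasurable ξ P)
    (h : ∀ᵐ ω ∂P, IsCountingMeasure (ξ ω) ∧ IsFiniteMeasure (ξ ω)) :
    ∃ ξ' : Ω → FiniteConfig X, Measurable ξ' ∧ ∀ᵐ ω ∂P, ξ ω = (ξ' ω).1 := by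
  classical
  have h2 : ∀ᵐ ω ∂P, (IsCountingMeasure (hm.mk ξ ω) ∧ IsFiniteMeasure (hm.mk ξ ω)) ∧
      ξ ω = hm.mk ξ ω := by
    filter_upwards [h, hm.ae_eq_mk] with ω h1 h3
    exact ⟨h3 ▸ h1, h3⟩
  -- The exceptional null set is enlarged to a measurable one, on which the modification is set to
  -- zero.
  set N := toMeasurable P {ω | ¬ ((IsCountingMeasure (hm.mk ξ ω) ∧
    IsFiniteMeasure (hm.mk ξ ω)) ∧ ξ ω = hm.mk ξ ω)}
  have hN : MeasurableSet N := measurableSet_toMeasurable _ _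
  have hN0 : P N = 0 := by rw [measure_toMeasurable]; exact h2
  have hgood : ∀ ω ∉ N, (IsCountingMeasure (hm.mk ξ ω) ∧ IsFiniteMeasure (hm.mk ξ ω)) ∧
      ξ ω = hm.mk ξ ω := fun ω hω => by
    by_contra h3
    exact hω (subset_toMeasurable _ _ h3)
  have hall : ∀ ω, IsCountingMeasure (N.piecewise (fun _ => 0) (hm.mk ξ) ω) ∧
      IsFiniteMeasure (N.piecewise (fun _ => 0) (hm.mk ξ) ω) := fun ω => by
    by_cases hω : ω ∈ N
    · simp only [hω, Set.piecewise_eq_of_mem]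
      exact (0 : FiniteConfig X).2
    · simp only [hω, not_false_eq_true, Set.piecewise_eq_of_notMem]
      exact (hgood ω hω).1
  refine ⟨fun ω => ⟨_, hall ω⟩,
    (Measurable.piecewise hN measurable_const hm.measurable_mk).subtype_mk, ?_⟩
  filter_upwards [compl_mem_ae_iff.2 hN0] with ω hω
  have hω' : ω ∉ N := hω
  simp only [hω', not_false_eq_true, Set.piecewise_eq_of_notMem]
  exact (hgood ω hω').2

lemma exists_finiteConfig {η : Ω → Measure X} (h : IsPoissonProcess η μ P) [IsFiniteMeasure μ] :
    ∃ η' : Ω → FiniteConfig X, Measurable η' ∧ (∀ᵐ ω ∂P, η ω = (η' ω).1) ∧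
      IsPoissonProcess (fun ω => (η' ω).1) μ P := by
  obtain ⟨η', h1, h2⟩ := exists_finiteConfig_ae_eq (ξ := η) (P := P) h.measurable.aemeasurable (by
    filter_upwards [h.counting, h.ae_apply_ne_top MeasurableSet.univ (measure_ne_top _ _)]
      with ω h1 h2
    exact ⟨h1, ⟨h2.lt_top⟩⟩)
  exact ⟨η', h1, h2, h.congr (measurable_subtype_coe.comp h1) h2⟩

end IsPoissonProcess

/-! ### Finite-dimensional distributions -/

namespace FiniteConfig

variable {X : Type*} [MeasurableSpace X]

/-- The `σ`-algebra on finite counting measures generated by the evaluation at `s`. -/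
abbrev evalSpace (s : {s : Set X // MeasurableSet s}) : MeasurableSpace (FiniteConfig X) :=
  (borel ℝ≥0∞).comap fun ω : FiniteConfig X => ω.1 s.1

/-- The cylinder events `{ω | ω s ∈ F s for s ∈ t}`, `t` a finite set of measurable sets. -/
def cylinders (X : Type*) [MeasurableSpace X] : Set (Set (FiniteConfig X)) :=
  piiUnionInter (fun s : {s : Set X // MeasurableSet s} => {E | MeasurableSet[evalSpace s] E})
    Set.univ

lemma isPiSystem_cylinders : IsPiSystem (cylinders X) :=
  isPiSystem_piiUnionInter _ (fun s => @MeasurableSpace.isPiSystem_measurableSet _ (evalSpace s)) _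

/-- The σ-algebra is generated by evaluations. Since the cylinders also form a π-system, identities
between measures and independence need only be checked on them. -/
lemma generateFrom_cylinders :
    (inferInstance : MeasurableSpace (FiniteConfig X)) = .generateFrom (cylinders X) := by
  rw [cylinders, generateFrom_piiUnionInter_measurableSet (fun s => evalSpace (X := X) s)]
  change MeasurableSpace.comap _ (⨆ (s : Set X) (_ : MeasurableSet s),
    (borel ℝ≥0∞).comap fun μ : Measure X => μ s) = _
  simp only [MeasurableSpace.comap_iSup, MeasurableSpace.comap_comp, Set.mem_univ, iSup_pos,
    iSup_subtype]
  rfl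

lemma exists_of_mem_cylinders {E : Set (FiniteConfig X)} (hE : E ∈ cylinders X) :
    ∃ (t : Finset {s : Set X // MeasurableSet s}) (F : {s : Set X // MeasurableSet s} → Set ℝ≥0∞),
      (∀ s, MeasurableSet (F s)) ∧ E = {ω | ∀ s ∈ t, ω.1 s.1 ∈ F s} := by
  classical
  obtain ⟨t, -, f, hf, rfl⟩ := hE
  choose! F hF hFf using hf
  refine ⟨t, fun s => if s ∈ t then F s else ∅, fun s => ?_, ?_⟩
  · dsimp only
    split_ifs with h
    · have := hF s h
      rwa [← BorelSpace.measurable_eq (α := ℝ≥0∞)] at this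
    · exact MeasurableSet.empty
  · ext ω
    simp only [Set.mem_iInter, Set.mem_ofPred_eq]
    refine forall₂_congr fun s hs => ?_
    rw [← hFf s hs, if_pos hs, Set.mem_preimage]

lemma univ_mem_cylinders : Set.univ ∈ cylinders X :=
  ⟨∅, by simp, fun _ => Set.univ, by simp, by simp⟩

lemma measurableSet_of_mem_cylinders {E : Set (FiniteConfig X)} (hE : E ∈ cylinders X) :
    MeasurableSet E := by
  have := MeasurableSpace.measurableSet_generateFrom hE
  rwa [← generateFrom_cylinders] at this

end FiniteConfig

/-! ### The classification of points by finitely many sets -/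

section Labels

variable {X : Type*} [MeasurableSpace X]

open Classical in
/-- The pattern of membership of a point in the members of a finite family of sets. -/
def memPattern (t : Finset {s : Set X // MeasurableSet s}) (x : X) : t → Bool :=
  fun s => decide (x ∈ s.1.1)

lemma measurable_memPattern (t : Finset {s : Set X // MeasurableSet s}) :
    Measurable (memPattern t) :=
  measurable_pi_lambda _ fun s => measurable_to_bool (by
    convert s.1.2 using 1
    ext x
    simp [memPattern])

/-- The masses of the classes of points with a given membership pattern. -/
def patternMass (t : Finset {s : Set X // MeasurableSet s}) (μ : Measure X) (b : t → Bool) :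
    ℝ≥0∞ := μ (memPattern t ⁻¹' {b})

lemma measurableSet_pattern (t : Finset {s : Set X // MeasurableSet s}) (b : t → Bool) :
    MeasurableSet (memPattern t ⁻¹' {b}) := measurable_memPattern t (measurableSet_singleton b)

/-- The pattern classes are the atoms of the algebra generated by the family, and each member is a
disjoint union of atoms. Cylinder events thus become events for the atom masses, which for a Poisson
process are independent Poisson variables. -/
lemma measure_eq_sum_patternMass (t : Finset {s : Set X // MeasurableSet s}) (μ : Measure X)
    (s : t) : μ s.1.1 = ∑ b : t → Bool, if b s then patternMass t μ b else 0 := by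
  classical
  rw [← Finset.sum_filter]
  unfold patternMass
  rw [sum_measure_preimage_singleton _ fun b _ => measurableSet_pattern t b]
  congr 1
  ext x
  simp [memPattern]

lemma measurable_patternMass (t : Finset {s : Set X // MeasurableSet s}) :
    Measurable fun ω : FiniteConfig X => patternMass t ω.1 :=
  measurable_pi_lambda _ fun b => FiniteConfig.measurable_coe (measurableSet_pattern t b)

open Classical in
lemma patternMass_add_dirac (t : Finset {s : Set X // MeasurableSet s}) (ω : FiniteConfig X)
    (x : X) : patternMass t (ω + .dirac x).1 =
      patternMass t ω.1 + Pi.single (memPattern t x) 1 := by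
  ext b
  simp only [patternMass, FiniteConfig.coe_add, Measure.add_apply, FiniteConfig.coe_dirac,
    Pi.add_apply, Measure.dirac_apply' _ (measurableSet_pattern t b)]
  by_cases h : memPattern t x = b
  · subst h; simp
  · simp [h]

/-- A cylinder event, in terms of the masses of patterns. -/
def patternEvent (t' : Finset {s : Set X // MeasurableSet s})
    (t : Finset {s : Set X // MeasurableSet s}) (F : {s : Set X // MeasurableSet s} → Set ℝ≥0∞) :
    Set ((t' → Bool) → ℝ≥0∞) :=
  {N | ∀ s : t', s.1 ∈ t → (∑ b : t' → Bool, if b s then N b else 0) ∈ F s.1}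

lemma measurableSet_patternEvent (t' t : Finset {s : Set X // MeasurableSet s})
    {F : {s : Set X // MeasurableSet s} → Set ℝ≥0∞} (hF : ∀ s, MeasurableSet (F s)) :
    MeasurableSet (patternEvent t' t F) := by
  have : patternEvent t' t F = ⋂ s : t', ⋂ (_ : s.1 ∈ t),
      (fun N : (t' → Bool) → ℝ≥0∞ => ∑ b : t' → Bool, if b s then N b else 0) ⁻¹' F s.1 := by
    ext N
    simp [patternEvent]
  rw [this]
  refine MeasurableSet.iInter fun s => MeasurableSet.iInter fun _ => ?_
  refine (Finset.measurable_sum _ fun b _ => ?_) (hF _)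
  split_ifs
  · exact measurable_pi_apply b
  · exact measurable_const

lemma patternMass_mem_patternEvent {t' t : Finset {s : Set X // MeasurableSet s}} (ht : t ⊆ t')
    (F : {s : Set X // MeasurableSet s} → Set ℝ≥0∞) (ω : Measure X) :
    patternMass t' ω ∈ patternEvent t' t F ↔ ∀ s ∈ t, ω s.1 ∈ F s := by
  constructor
  · intro h s hs
    have := h ⟨s, ht hs⟩ hs
    rwa [← measure_eq_sum_patternMass t' ω ⟨s, ht hs⟩] at this
  · intro h s hs
    rw [← measure_eq_sum_patternMass t' ω s]
    exact h _ hs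

end Labels

/-! ### The Mecke formula -/

namespace IsPoissonProcess

variable {Ω X : Type*} [MeasurableSpace Ω] [MeasurableSpace X] {μ : Measure X} {P : Measure Ω}
  {η : Ω → FiniteConfig X}

lemma iIndepFun_patternMass (h : IsPoissonProcess (fun ω => (η ω).1) μ P)
    (t : Finset {s : Set X // MeasurableSet s}) :
    iIndepFun (fun b ω => patternMass t (η ω).1 b) P :=
  h.iIndepFun_fiber (fun b => measurableSet_pattern t b) fun b b' hb => by
    refine Set.disjoint_left.2 fun x hx hx' => hb ?_
    rw [← (show memPattern t x = b from hx), ← (show memPattern t x = b' from hx')]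

lemma map_patternMass (h : IsPoissonProcess (fun ω => (η ω).1) μ P) (hη : Measurable η)
    (t : Finset {s : Set X // MeasurableSet s}) :
    P.map (fun ω => patternMass t (η ω).1) =
      Measure.pi fun b => poissonLaw (patternMass t μ b) := by
  refine ((h.iIndepFun_patternMass t).map_fun_eq_pi_map fun b =>
    ((FiniteConfig.measurable_coe (measurableSet_pattern t b)).comp hη).aemeasurable).trans ?_
  congr 1
  ext1 b
  exact h.law _ (measurableSet_pattern t b)

open Classical in
-- This is the Mecke formula on a single atom: the masses of the atoms are independent, so the
-- others can be frozen and the Chen-Stein identity applied to the coordinate b.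
lemma lintegral_patternMass_mul (h : IsPoissonProcess (fun ω => (η ω).1) μ P)
    (hη : Measurable η) [IsFiniteMeasure μ] (t : Finset {s : Set X // MeasurableSet s})
    (b : t → Bool) {Φ : ((t → Bool) → ℝ≥0∞) → ℝ≥0∞} (hΦ : Measurable Φ) :
    ∫⁻ ω, patternMass t (η ω).1 b * Φ (patternMass t (η ω).1) ∂P =
      patternMass t μ b * ∫⁻ ω, Φ (patternMass t (η ω).1 + Pi.single b 1) ∂P := by
  have hm : Measurable fun ω => patternMass t (η ω).1 := (measurable_patternMass t).comp hη
  have h1 : Measurable fun N : (t → Bool) → ℝ≥0∞ => N b * Φ N := (measurable_pi_apply b).mul hΦ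
  have h2 : Measurable fun N : (t → Bool) → ℝ≥0∞ => Φ (N + Pi.single b 1) :=
    hΦ.comp (measurable_id.add_const _)
  rw [← lintegral_map h1 hm, ← lintegral_map h2 hm, ← lintegral_const_mul _ h2,
    h.map_patternMass hη t]
  refine lintegral_eq_of_lmarginal_eq {b} h1 (h2.const_mul _) ?_
  rw [lmarginal_singleton, lmarginal_singleton]
  ext N
  simp only [Function.update_self]
  have hupd : Measurable fun r : ℝ≥0∞ => Function.update N b r := measurable_update N
  rw [lintegral_mul_poissonLaw (r := patternMass t μ b) (measure_ne_top μ _) (f := fun r => Φ (Function.update N b r))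
    (hΦ.comp hupd), lintegral_const_mul _
      (show Measurable fun r => Φ (Function.update N b r + Pi.single b 1) from h2.comp hupd)]
  congr 2
  ext r
  congr 1
  ext b'
  by_cases hb : b' = b
  · subst hb; simp
  · simp [hb]

/-- S joins the family defining the cylinder, so S is a union of atoms and adding a point at x only
matters through the atom of x. The identity is then the sum of `lintegral_patternMass_mul` over the
atoms inside S. -/
lemma mecke_cylinder (h : IsPoissonProcess (fun ω => (η ω).1) μ P)
    (hη : Measurable η) [IsFiniteMeasure μ] {S : Set X} (hS : MeasurableSet S)
    {E : Set (FiniteConfig X)} (hE : E ∈ FiniteConfig.cylinders X) :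
    ∫⁻ ω, (η ω).1 S * E.indicator 1 (η ω) ∂P =
      ∫⁻ x in S, ∫⁻ ω, E.indicator 1 (η ω + .dirac x) ∂P ∂μ := by
  classical
  obtain ⟨t, F, hF, rfl⟩ := FiniteConfig.exists_of_mem_cylinders hE
  set t' := insert ⟨S, hS⟩ t with ht'
  set S' : t' := ⟨⟨S, hS⟩, Finset.mem_insert_self _ _⟩ with hS'
  set Φ : ((t' → Bool) → ℝ≥0∞) → ℝ≥0∞ := (patternEvent t' t F).indicator 1 with hΦ
  have hΦm : Measurable Φ := measurable_one.indicator (measurableSet_patternEvent t' t hF)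
  have ht₀ : t ⊆ t' := Finset.subset_insert _ _
  have key : ∀ ω : FiniteConfig X, Set.indicator {ω : FiniteConfig X | ∀ s ∈ t, ω.1 s.1 ∈ F s}
      (1 : FiniteConfig X → ℝ≥0∞) ω = Φ (patternMass t' ω.1) := fun ω => by
    simp only [hΦ, Set.indicator_apply, patternMass_mem_patternEvent ht₀]
    rfl
  simp only [key, patternMass_add_dirac]
  have hl : ∀ ω, (η ω).1 S * Φ (patternMass t' (η ω).1) = ∑ b : t' → Bool,
      if b S' then patternMass t' (η ω).1 b * Φ (patternMass t' (η ω).1) else 0 := fun ω => by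
    rw [measure_eq_sum_patternMass t' _ S', Finset.sum_mul]
    exact Finset.sum_congr rfl fun b _ => by split_ifs <;> simp
  have hm : Measurable fun ω => patternMass t' (η ω).1 := (measurable_patternMass t').comp hη
  simp only [hl]
  rw [lintegral_finsetSum]
  swap
  · intro b _
    split_ifs
    · exact ((measurable_pi_apply b).comp hm).mul (hΦm.comp hm)
    · exact measurable_const
  have hr := lintegral_map (μ := μ.restrict S) (g := memPattern t')
    (f := fun b => ∫⁻ ω, Φ (patternMass t' (η ω).1 + Pi.single b 1) ∂P)
    (measurable_of_finite _) (measurable_memPattern t')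
  rw [lintegral_fintype] at hr
  refine Eq.trans ?_ hr
  refine Finset.sum_congr rfl fun b _ => ?_
  rw [Measure.map_apply (measurable_memPattern t') (measurableSet_singleton b),
    Measure.restrict_apply (measurableSet_pattern t' b)]
  split_ifs with hb
  · rw [h.lintegral_patternMass_mul hη t' b hΦm, mul_comm]
    have : memPattern t' ⁻¹' {b} ∩ S = memPattern t' ⁻¹' {b} := Set.inter_eq_left.2 fun x hx => by
      rw [← (show memPattern t' x = b from hx)] at hb
      simpa [memPattern, hS'] using hb
    rw [this]
    rfl
  · have : memPattern t' ⁻¹' {b} ∩ S = ∅ := by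
      refine Set.eq_empty_iff_forall_notMem.2 fun x ⟨hx, hxS⟩ => hb ?_
      rw [← (show memPattern t' x = b from hx)]
      simpa [memPattern, hS'] using hxS
    simp [this]

/-- The Mecke formula. -/
theorem mecke (h : IsPoissonProcess (fun ω => (η ω).1) μ P) (hη : Measurable η)
    [IsFiniteMeasure μ] [IsProbabilityMeasure P] {f : X × FiniteConfig X → ℝ≥0∞}
    (hf : Measurable f) :
    ∫⁻ ω, ∫⁻ x, f (x, η ω) ∂(η ω).1 ∂P = ∫⁻ x, ∫⁻ ω, f (x, η ω + .dirac x) ∂P ∂μ := by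
  have hadd : Measurable fun p : X × Ω => (p.1, η p.2 + .dirac p.1) :=
    measurable_fst.prodMk ((hη.comp measurable_snd).add
      (FiniteConfig.measurable_dirac.comp measurable_fst))
  -- Both sides are integrals against measures on points and configurations: the Campbell measure,
  -- and the image of μ ⊗ P under insertion of the point. They are finite, and are compared on the
  -- π-system of products of a measurable set and a cylinder.
  set m₁ : Measure (X × FiniteConfig X) :=
    ((P.map η) ⊗ₘ (FiniteConfig.kernel X)).map Prod.swap with hm₁
  set m₂ : Measure (X × FiniteConfig X) :=
    (μ.prod P).map (fun p => (p.1, η p.2 + .dirac p.1)) with hm₂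
  have hPη : IsProbabilityMeasure (P.map η) := Measure.isProbabilityMeasure_map hη.aemeasurable
  have e₁ : ∀ g : X × FiniteConfig X → ℝ≥0∞, Measurable g →
      ∫⁻ p, g p ∂m₁ = ∫⁻ ω, ∫⁻ x, g (x, η ω) ∂(η ω).1 ∂P := fun g hg => by
    rw [hm₁, lintegral_map hg measurable_swap,
      Measure.lintegral_compProd (f := fun p => g p.swap) (hg.comp measurable_swap),
      lintegral_map (f := fun ω : FiniteConfig X => ∫⁻ x, g (ω, x).swap ∂(FiniteConfig.kernel X ω))
        (Measurable.lintegral_kernel_prod_right' (hg.comp measurable_swap)) hη]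
    rfl
  have e₂ : ∀ g : X × FiniteConfig X → ℝ≥0∞, Measurable g →
      ∫⁻ p, g p ∂m₂ = ∫⁻ x, ∫⁻ ω, g (x, η ω + .dirac x) ∂P ∂μ := fun g hg => by
    have hg' : Measurable fun p : X × Ω => g (p.1, η p.2 + .dirac p.1) := hg.comp hadd
    rw [hm₂, lintegral_map hg hadd, lintegral_prod _ hg'.aemeasurable]
  have hu : m₁ Set.univ = μ Set.univ := by
    rw [← lintegral_one, e₁ _ measurable_const]
    simpa using h.lintegral_apply MeasurableSet.univ
  have hu' : m₂ Set.univ = μ Set.univ := by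
    rw [← lintegral_one, e₂ _ measurable_const]
    simp
  have : IsFiniteMeasure m₁ := ⟨by rw [hu]; exact measure_lt_top _ _⟩
  suffices m₁ = m₂ by rw [← e₁ f hf, ← e₂ f hf, this]
  have hgen : (inferInstance : MeasurableSpace (X × FiniteConfig X)) = MeasurableSpace.generateFrom
      (Set.image2 (· ×ˢ ·) {s : Set X | MeasurableSet s} (FiniteConfig.cylinders X)) := by
    refine (generateFrom_eq_prod MeasurableSpace.generateFrom_measurableSet
      FiniteConfig.generateFrom_cylinders.symm ?_ ?_).symm
    · exact ⟨fun _ => Set.univ, fun _ => MeasurableSet.univ, Set.iUnion_const _⟩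
    · exact ⟨fun _ => Set.univ, fun _ => FiniteConfig.univ_mem_cylinders, Set.iUnion_const _⟩
  refine ext_of_generate_finite _ hgen (MeasurableSpace.isPiSystem_measurableSet.prod
    FiniteConfig.isPiSystem_cylinders) ?_ (hu.trans hu'.symm)
  rintro _ ⟨S, hS, E, hE, rfl⟩
  have hSE : MeasurableSet (S ×ˢ E) :=
    MeasurableSet.prod hS (FiniteConfig.measurableSet_of_mem_cylinders hE)
  have hind : ∀ x ω, (S ×ˢ E).indicator (1 : X × FiniteConfig X → ℝ≥0∞) (x, ω) =
      S.indicator (fun _ => E.indicator 1 ω) x := fun x ω => by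
    by_cases hx : x ∈ S <;> by_cases hω : ω ∈ E <;> simp [hx, hω]
  rw [← lintegral_indicator_one hSE, e₁ _ (measurable_one.indicator hSE),
    ← lintegral_indicator_one hSE, e₂ _ (measurable_one.indicator hSE)]
  simp only [hind]
  have hS' : MeasurableSet S := hS
  calc _ = ∫⁻ ω, (η ω).1 S * E.indicator 1 (η ω) ∂P := lintegral_congr fun ω => by
        rw [lintegral_indicator hS', setLIntegral_const, mul_comm]
    _ = ∫⁻ x in S, ∫⁻ ω, E.indicator 1 (η ω + .dirac x) ∂P ∂μ := h.mecke_cylinder hη hS' hE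
    _ = _ := by
        rw [← lintegral_indicator hS']
        refine lintegral_congr fun x => ?_
        by_cases hx : x ∈ S <;> simp [hx]

/-! ### Independence over disjoint regions -/

/-- A cylinder event for the restriction to S depends only on the masses of the atoms inside S, and
likewise for T; disjoint sets of atoms have independent masses. -/
lemma indepFun_restrict (h : IsPoissonProcess (fun ω => (η ω).1) μ P) (hη : Measurable η)
    [IsProbabilityMeasure P] {S T : Set X} (hS : MeasurableSet S) (hT : MeasurableSet T)
    (hST : Disjoint S T) :
    IndepFun (fun ω => (η ω).restrict hS) (fun ω => (η ω).restrict hT) P := by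
  classical
  have hmS : Measurable fun ω => (η ω).restrict hS := (FiniteConfig.measurable_restrict hS).comp hη
  have hmT : Measurable fun ω => (η ω).restrict hT := (FiniteConfig.measurable_restrict hT).comp hη
  have hgen : ∀ f : Ω → FiniteConfig X, MeasurableSpace.comap f inferInstance =
      MeasurableSpace.generateFrom (Set.preimage f '' FiniteConfig.cylinders X) := fun f => by
    rw [FiniteConfig.generateFrom_cylinders, MeasurableSpace.comap_generateFrom]
  have hpi : ∀ f : Ω → FiniteConfig X, IsPiSystem (Set.preimage f '' FiniteConfig.cylinders X) := by
    rintro f _ ⟨A, hA, rfl⟩ _ ⟨B, hB, rfl⟩ hne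
    refine ⟨A ∩ B, FiniteConfig.isPiSystem_cylinders A hA B hB ?_, rfl⟩
    obtain ⟨ω, hω⟩ := hne
    exact ⟨f ω, hω⟩
  rw [IndepFun_iff_Indep]
  refine IndepSets.indep hmS.comap_le hmT.comap_le (hpi _) (hpi _) (hgen _) (hgen _) ?_
  rw [IndepSets_iff]
  rintro _ _ ⟨A, hA, rfl⟩ ⟨B, hB, rfl⟩
  obtain ⟨t₁, F₁, hF₁, rfl⟩ := FiniteConfig.exists_of_mem_cylinders hA
  obtain ⟨t₂, F₂, hF₂, rfl⟩ := FiniteConfig.exists_of_mem_cylinders hB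
  set t : Finset {s : Set X // MeasurableSet s} := insert ⟨S, hS⟩ (insert ⟨T, hT⟩ (t₁ ∪ t₂)) with ht
  set S' : t := ⟨⟨S, hS⟩, by simp [ht]⟩ with hS'
  set T' : t := ⟨⟨T, hT⟩, by simp [ht]⟩ with hT'
  set U : Finset (t → Bool) := Finset.univ.filter fun b => b S' with hU
  -- A pattern that claims membership in both S and T has an empty atom. Leaving it out of V makes
  -- the two index sets disjoint and loses no mass.
  set V : Finset (t → Bool) := Finset.univ.filter fun b => b T' ∧ ¬ b S' with hV
  have hUV : Disjoint U V := Finset.disjoint_left.2 fun b hb hb' => by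
    simp only [hU, hV, Finset.mem_filter] at hb hb'
    exact hb'.2.2 hb.2
  have hmeas : ∀ b, Measurable fun ω => patternMass t (η ω).1 b := fun b =>
    (FiniteConfig.measurable_coe (measurableSet_pattern t b)).comp hη
  have hind := (h.iIndepFun_patternMass t).indepFun_finset U V hUV hmeas
  have hsub : ∀ b : t → Bool, b S' → b T' → ∀ ν : Measure X, patternMass t ν b = 0 := by
    intro b h1 h2 ν
    have : memPattern t ⁻¹' {b} = ∅ := Set.eq_empty_iff_forall_notMem.2 fun x hx => by
      rw [← (show memPattern t x = b from hx)] at h1 h2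
      simp only [memPattern, decide_eq_true_eq] at h1 h2
      exact Set.disjoint_left.1 hST h1 h2
    simp [patternMass, this]
  have hrestr : ∀ (R : Set X) (hR : MeasurableSet R) (R' : t), R'.1.1 = R → ∀ (ω : FiniteConfig X)
      (b : t → Bool), patternMass t (ω.restrict hR).1 b = if b R' then patternMass t ω.1 b else 0 := by
    intro R hR R' hRR ω b
    simp only [patternMass, FiniteConfig.coe_restrict,
      Measure.restrict_apply (measurableSet_pattern t b)]
    split_ifs with hb
    · congr 1
      refine Set.inter_eq_left.2 fun x hx => ?_
      rw [← (show memPattern t x = b from hx)] at hb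
      simpa [memPattern, hRR] using hb
    · have : memPattern t ⁻¹' {b} ∩ R = ∅ := by
        refine Set.eq_empty_iff_forall_notMem.2 fun x ⟨hx, hxR⟩ => hb ?_
        rw [← (show memPattern t x = b from hx)]
        simpa [memPattern, hRR] using hxR
      rw [this, measure_empty]
  set ext₁ : (U → ℝ≥0∞) → (t → Bool) → ℝ≥0∞ := fun N b => if hb : b ∈ U then N ⟨b, hb⟩ else 0
  set ext₂ : (V → ℝ≥0∞) → (t → Bool) → ℝ≥0∞ := fun N b => if hb : b ∈ V then N ⟨b, hb⟩ else 0
  have hext₁ : Measurable ext₁ := measurable_pi_lambda _ fun b => by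
    by_cases hb : b ∈ U <;> simp only [ext₁, hb, dite_true, dite_false] <;> fun_prop
  have hext₂ : Measurable ext₂ := measurable_pi_lambda _ fun b => by
    by_cases hb : b ∈ V <;> simp only [ext₂, hb, dite_true, dite_false] <;> fun_prop
  have e₁ : ∀ ω, patternMass t ((η ω).restrict hS).1 =
      ext₁ fun b : U => patternMass t (η ω).1 b := fun ω => by
    ext b
    rw [hrestr S hS S' rfl]
    simp [ext₁, hU]
  have e₂ : ∀ ω, patternMass t ((η ω).restrict hT).1 =
      ext₂ fun b : V => patternMass t (η ω).1 b := fun ω => by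
    ext b
    rw [hrestr T hT T' rfl]
    by_cases h1 : b T'
    · by_cases h2 : b S'
      · simp [ext₂, hV, h2, hsub b h2 h1]
      · simp [ext₂, hV, h1, h2]
    · simp [ext₂, hV, h1]
  have ht₁ : t₁ ⊆ t := fun s hs => by simp [ht, hs]
  have ht₂ : t₂ ⊆ t := fun s hs => by simp [ht, hs]
  have hA' : (fun ω => (η ω).restrict hS) ⁻¹' {ω | ∀ s ∈ t₁, ω.1 s.1 ∈ F₁ s} =
      (fun ω (b : U) => patternMass t (η ω).1 b) ⁻¹' (ext₁ ⁻¹' patternEvent t t₁ F₁) := by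
    ext ω
    simp only [Set.mem_preimage, ← e₁, patternMass_mem_patternEvent ht₁]
    rfl
  have hB' : (fun ω => (η ω).restrict hT) ⁻¹' {ω | ∀ s ∈ t₂, ω.1 s.1 ∈ F₂ s} =
      (fun ω (b : V) => patternMass t (η ω).1 b) ⁻¹' (ext₂ ⁻¹' patternEvent t t₂ F₂) := by
    ext ω
    simp only [Set.mem_preimage, ← e₂, patternMass_mem_patternEvent ht₂]
    rfl
  rw [hA', hB']
  exact indepFun_iff_measure_inter_preimage_eq_mul.1 hind _ _
    (hext₁ (measurableSet_patternEvent t t₁ hF₁)) (hext₂ (measurableSet_patternEvent t t₂ hF₂))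

end IsPoissonProcess

/-! ### Approximation of a small point process by its first order term -/

namespace FiniteConfig

variable {Y : Type*} [MeasurableSpace Y]

lemma measurable_apply {α : Type*} [MeasurableSpace α] {f : α → FiniteConfig Y}
    (hf : Measurable f) {B : Set Y} (hB : MeasurableSet B) : Measurable fun a => (f a).1 B :=
  (measurable_coe hB).comp hf

/-- The number of ordered pairs of distinct points. -/
def pairCount (ω : FiniteConfig Y) : ℝ≥0∞ := ω.1 Set.univ * (ω.1 Set.univ - 1)

lemma measurable_pairCount : Measurable (pairCount : FiniteConfig Y → ℝ≥0∞) :=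
  (measurable_coe MeasurableSet.univ).mul ((measurable_coe MeasurableSet.univ).sub_const _)

lemma pairCount_ne_top (ω : FiniteConfig Y) : ω.pairCount ≠ ∞ :=
  ENNReal.mul_ne_top (measure_ne_top _ _) (ENNReal.sub_ne_top (measure_ne_top _ _))

end FiniteConfig

lemma lintegral_toReal_le {Y : Type*} [MeasurableSpace Y] (ω : FiniteConfig Y) {f : Y → ℝ≥0∞}
    (hf : ∀ y, f y ≤ 1) : (∫⁻ y, f y ∂ω.1).toReal ≤ ω.1.real Set.univ :=
  ENNReal.toReal_mono (measure_ne_top _ _)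
    ((lintegral_mono hf).trans_eq (by simp))

namespace TVLip

variable {Y : Type*} [MeasurableSpace Y] {g : FiniteConfig Y → ℝ}

/-- The positive part of the increment of a functional at a one-point configuration. -/
def posPart (g : FiniteConfig Y → ℝ) (y : Y) : ℝ≥0∞ := ENNReal.ofReal (g (.dirac y) - g 0)

/-- The negative part of the increment of a functional at a one-point configuration. -/
def negPart (g : FiniteConfig Y → ℝ) (y : Y) : ℝ≥0∞ := ENNReal.ofReal (g 0 - g (.dirac y))

lemma measurable_posPart (hg : TVLip g) : Measurable (posPart g) :=
  ((hg.measurable.comp FiniteConfig.measurable_dirac).sub_const _).ennreal_ofReal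

lemma measurable_negPart (hg : TVLip g) : Measurable (negPart g) :=
  ((hg.measurable.comp FiniteConfig.measurable_dirac).const_sub _).ennreal_ofReal

lemma posPart_le_one (hg : TVLip g) (y : Y) : posPart g y ≤ 1 :=
  ENNReal.ofReal_le_one.2 ((le_abs_self _).trans (hg.abs_dirac_le y))

lemma negPart_le_one (hg : TVLip g) (y : Y) : negPart g y ≤ 1 :=
  ENNReal.ofReal_le_one.2 (by have := (neg_le_abs _).trans (hg.abs_dirac_le y); linarith)

lemma posPart_sub_negPart (g : FiniteConfig Y → ℝ) (y : Y) :
    (posPart g y).toReal - (negPart g y).toReal = g (.dirac y) - g 0 := by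
  rw [posPart, negPart, ENNReal.toReal_ofReal', ENNReal.toReal_ofReal',
    ← neg_sub (g (.dirac y)), max_zero_sub_max_neg_zero_eq_self]

/-- The first order approximation of a functional at a configuration. -/
def linearPart (g : FiniteConfig Y → ℝ) (ω : FiniteConfig Y) : ℝ :=
  (∫⁻ y, posPart g y ∂ω.1).toReal - (∫⁻ y, negPart g y ∂ω.1).toReal

/-- The expansion is exact for configurations with at most one point. With m ≥ 2 points the
increment and the linear part are each at most m in absolute value, and 2m ≤ 2m(m - 1). -/
lemma abs_sub_linearPart_le [StandardBorelSpace Y] (hg : TVLip g) (ω : FiniteConfig Y) :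
    |g ω - g 0 - linearPart g ω| ≤ 2 * ω.pairCount.toReal := by
  obtain ⟨m, hm⟩ := ω.exists_nat MeasurableSet.univ
  have hmr : ω.1.real Set.univ = m := by simp [Measure.real, hm]
  rcases Nat.lt_or_ge m 2 with h2 | h2
  · interval_cases m
    · have : ω = 0 := FiniteConfig.eq_zero_of_apply_univ (by simpa using hm)
      subst this
      simp [linearPart, FiniteConfig.pairCount]
    · obtain ⟨y, rfl⟩ := FiniteConfig.exists_eq_dirac (ω := ω) (by simpa using hm)
      simp only [linearPart, FiniteConfig.coe_dirac]
      rw [lintegral_dirac' _ hg.measurable_posPart, lintegral_dirac' _ hg.measurable_negPart,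
        posPart_sub_negPart]
      simp [FiniteConfig.pairCount]
  · have h1 := abs_le.1 (hg.abs_sub_zero_le ω)
    have h3 := lintegral_toReal_le ω hg.posPart_le_one
    have h4 := lintegral_toReal_le ω hg.negPart_le_one
    have hp : ω.pairCount.toReal = m * (m - 1) := by
      rw [FiniteConfig.pairCount, hm, ENNReal.toReal_mul, ENNReal.toReal_sub_of_le]
      · simp
      · exact_mod_cast (by omega : 1 ≤ m)
      · simp
    have hm2 : (2 : ℝ) ≤ m := by exact_mod_cast h2
    rw [hmr] at h1 h3 h4
    have h5 : (0 : ℝ) ≤ (∫⁻ y, posPart g y ∂ω.1).toReal := ENNReal.toReal_nonneg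
    have h6 : (0 : ℝ) ≤ (∫⁻ y, negPart g y ∂ω.1).toReal := ENNReal.toReal_nonneg
    have h7 : (m : ℝ) ≤ m * (m - 1) := by nlinarith
    rw [hp, abs_le]
    unfold linearPart
    constructor <;> linarith [h1.1, h1.2]

lemma abs_expect_sub_linearPart_le [StandardBorelSpace Y] (hg : TVLip g) {Ω : Type*}
    [MeasurableSpace Ω] {P : Measure Ω} [IsProbabilityMeasure P] {ξ : Ω → FiniteConfig Y}
    (hξ : Measurable ξ) (h : ∫⁻ ω, (ξ ω).1 Set.univ ∂P ≠ ∞)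
    (h2 : ∫⁻ ω, (ξ ω).pairCount ∂P ≠ ∞) :
    |(∫ ω, g (ξ ω) ∂P) - g 0 - ((∫⁻ ω, ∫⁻ y, posPart g y ∂(ξ ω).1 ∂P).toReal -
      (∫⁻ ω, ∫⁻ y, negPart g y ∂(ξ ω).1 ∂P).toReal)| ≤
      2 * (∫⁻ ω, (ξ ω).pairCount ∂P).toReal := by
  have key : ∀ f : Y → ℝ≥0∞, Measurable f → (∀ y, f y ≤ 1) →
      Integrable (fun ω => (∫⁻ y, f y ∂(ξ ω).1).toReal) P ∧
      ∫ ω, (∫⁻ y, f y ∂(ξ ω).1).toReal ∂P = (∫⁻ ω, ∫⁻ y, f y ∂(ξ ω).1 ∂P).toReal := by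
    intro f hf hf1
    have hm : Measurable fun ω => ∫⁻ y, f y ∂(ξ ω).1 :=
      FiniteConfig.measurable_lintegral hξ (f := fun p => f p.2) (hf.comp measurable_snd)
    have hle : ∀ ω, ∫⁻ y, f y ∂(ξ ω).1 ≤ (ξ ω).1 Set.univ := fun ω =>
      (lintegral_mono hf1).trans_eq (by simp)
    have hfin : ∫⁻ ω, ∫⁻ y, f y ∂(ξ ω).1 ∂P ≠ ∞ :=
      ((lintegral_mono hle).trans_lt h.lt_top).ne
    exact ⟨integrable_toReal_of_lintegral_ne_top hm.aemeasurable hfin,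
      integral_toReal hm.aemeasurable
        (.of_forall fun ω => (hle ω).trans_lt (measure_lt_top _ _))⟩
  obtain ⟨i1, e1⟩ := key _ hg.measurable_posPart hg.posPart_le_one
  obtain ⟨i2, e2⟩ := key _ hg.measurable_negPart hg.negPart_le_one
  have hp : Measurable fun ω => (ξ ω).pairCount := FiniteConfig.measurable_pairCount.comp hξ
  have i3 : Integrable (fun ω => (ξ ω).pairCount.toReal) P :=
    integrable_toReal_of_lintegral_ne_top hp.aemeasurable h2
  rw [← integral_toReal hp.aemeasurable
    (.of_forall fun ω => (FiniteConfig.pairCount_ne_top _).lt_top), ← e1, ← e2,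
    ← integral_const_mul]
  have i0 := hg.integrable hξ h
  have j1 : Integrable (fun ω => g (ξ ω) - g 0) P := i0.sub (integrable_const _)
  have j2 : Integrable (fun ω => linearPart g (ξ ω)) P := i1.sub i2
  have e3 : ∫ ω, linearPart g (ξ ω) ∂P = (∫ ω, (∫⁻ y, posPart g y ∂(ξ ω).1).toReal ∂P) -
      ∫ ω, (∫⁻ y, negPart g y ∂(ξ ω).1).toReal ∂P := integral_sub i1 i2
  have e4 : ∫ ω, (g (ξ ω) - g 0) ∂P = (∫ ω, g (ξ ω) ∂P) - g 0 := by
    rw [integral_sub i0 (integrable_const _)]; simp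
  rw [← e3, ← e4, ← integral_sub j1 j2, ← Real.norm_eq_abs]
  exact norm_integral_le_of_norm_le (i3.const_mul 2) (.of_forall fun ω =>
    hg.abs_sub_linearPart_le (ξ ω))

/-- Two point processes which rarely have more than one point and which have similar intensity
measures are close. -/
theorem abs_expect_sub_le [StandardBorelSpace Y] (hg : TVLip g) {Ω Ω' : Type*}
    [MeasurableSpace Ω] [MeasurableSpace Ω'] {P : Measure Ω} [IsProbabilityMeasure P]
    {P' : Measure Ω'} [IsProbabilityMeasure P'] {ξ : Ω → FiniteConfig Y} {ζ : Ω' → FiniteConfig Y}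
    (hξ : Measurable ξ) (hζ : Measurable ζ) (h : ∫⁻ ω, (ξ ω).1 Set.univ ∂P ≠ ∞)
    (h' : ∫⁻ ω, (ζ ω).1 Set.univ ∂P' ≠ ∞) {ε ε₁ ε₂ : ℝ≥0∞}
    (hε₁ : ∫⁻ ω, (ξ ω).pairCount ∂P ≤ ε₁) (hε₂ : ∫⁻ ω, (ζ ω).pairCount ∂P' ≤ ε₂)
    (h₁ : ∀ f : Y → ℝ≥0∞, Measurable f → (∀ y, f y ≤ 1) →
      ∫⁻ ω, ∫⁻ y, f y ∂(ξ ω).1 ∂P ≤ ∫⁻ ω, ∫⁻ y, f y ∂(ζ ω).1 ∂P' + ε)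
    (h₂ : ∀ f : Y → ℝ≥0∞, Measurable f → (∀ y, f y ≤ 1) →
      ∫⁻ ω, ∫⁻ y, f y ∂(ζ ω).1 ∂P' ≤ ∫⁻ ω, ∫⁻ y, f y ∂(ξ ω).1 ∂P + ε) :
    ENNReal.ofReal |(∫ ω, g (ξ ω) ∂P) - ∫ ω, g (ζ ω) ∂P'| ≤ 2 * ε₁ + 2 * ε₂ + 2 * ε := by
  by_cases ht : ε₁ = ∞ ∨ ε₂ = ∞ ∨ ε = ∞
  · rcases ht with rfl | rfl | rfl <;> simp
  push Not at ht
  obtain ⟨t1, t2, t3⟩ := ht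
  have a1 := hg.abs_expect_sub_linearPart_le hξ h (hε₁.trans_lt t1.lt_top).ne
  have a2 := hg.abs_expect_sub_linearPart_le hζ h' (hε₂.trans_lt t2.lt_top).ne
  have b1 := ENNReal.toReal_mono t1 hε₁
  have b2 := ENNReal.toReal_mono t2 hε₂
  have key : ∀ f : Y → ℝ≥0∞, Measurable f → (∀ y, f y ≤ 1) →
      |(∫⁻ ω, ∫⁻ y, f y ∂(ξ ω).1 ∂P).toReal - (∫⁻ ω, ∫⁻ y, f y ∂(ζ ω).1 ∂P').toReal| ≤
        ε.toReal := by
    intro f hf hf1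
    have f1 : ∫⁻ ω, ∫⁻ y, f y ∂(ξ ω).1 ∂P ≠ ∞ := ((lintegral_mono fun ω =>
      (lintegral_mono hf1).trans_eq (by simp)).trans_lt h.lt_top).ne
    have f2 : ∫⁻ ω, ∫⁻ y, f y ∂(ζ ω).1 ∂P' ≠ ∞ := ((lintegral_mono fun ω =>
      (lintegral_mono hf1).trans_eq (by simp)).trans_lt h'.lt_top).ne
    have c1 := ENNReal.toReal_mono (by finiteness) (h₁ f hf hf1)
    have c2 := ENNReal.toReal_mono (by finiteness) (h₂ f hf hf1)
    rw [ENNReal.toReal_add (by assumption) t3] at c1 c2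
    rw [abs_le]
    constructor <;> linarith
  have k1 := key _ hg.measurable_posPart hg.posPart_le_one
  have k2 := key _ hg.measurable_negPart hg.negPart_le_one
  rw [ENNReal.ofReal_le_iff_le_toReal (by finiteness), ENNReal.toReal_add (by finiteness)
    (by finiteness), ENNReal.toReal_add (by finiteness) (by finiteness), ENNReal.toReal_mul,
    ENNReal.toReal_mul, ENNReal.toReal_mul]
  simp only [ENNReal.toReal_ofNat]
  rw [abs_le] at *
  constructor <;> linarith [a1.1, a1.2, a2.1, a2.2, k1.1, k1.2, k2.1, k2.2]

/-! ### Replacing independent summands one at a time -/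

section Replace

variable {Ω Ω' : Type*} [MeasurableSpace Ω] [MeasurableSpace Ω'] {P : Measure Ω}
  {P' : Measure Ω'}

lemma lintegral_add_univ_ne_top {ξ ξ' : Ω → FiniteConfig Y} (hξ : Measurable ξ)
    (h : ∫⁻ ω, (ξ ω).1 Set.univ ∂P ≠ ∞) (h' : ∫⁻ ω, (ξ' ω).1 Set.univ ∂P ≠ ∞) :
    ∫⁻ ω, (ξ ω + ξ' ω).1 Set.univ ∂P ≠ ∞ := by
  simp only [FiniteConfig.coe_add, Measure.add_apply]
  rw [lintegral_add_left (FiniteConfig.measurable_apply hξ MeasurableSet.univ)]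
  exact ENNReal.add_ne_top.2 ⟨h, h'⟩

variable [IsProbabilityMeasure P] [IsProbabilityMeasure P']

lemma integrable_add_left (hg : TVLip g) {ζ : Ω' → FiniteConfig Y} (hζ : Measurable ζ)
    (h : ∫⁻ ω, (ζ ω).1 Set.univ ∂P' ≠ ∞) (ω : FiniteConfig Y) :
    Integrable (fun ω' => g (ω + ζ ω')) P' :=
  (hg.comp_add_left ω).integrable hζ h

/-- Averaging over an additional random summand. -/
lemma expect_add (hg : TVLip g) {ζ : Ω' → FiniteConfig Y} (hζ : Measurable ζ)
    (h : ∫⁻ ω, (ζ ω).1 Set.univ ∂P' ≠ ∞) : TVLip fun ω => ∫ ω', g (ω + ζ ω') ∂P' where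
  measurable := by
    have : Measurable fun p : FiniteConfig Y × Ω' => g (p.1 + ζ p.2) :=
      hg.measurable.comp (measurable_fst.add (hζ.comp measurable_snd))
    exact (this.stronglyMeasurable.integral_prod_right (ν := P')).measurable
  le ω₁ ω₂ c h₁ h₂ := by
    rw [← integral_sub (hg.integrable_add_left hζ h ω₁) (hg.integrable_add_left hζ h ω₂),
      ← Real.norm_eq_abs, ofReal_norm]
    refine (enorm_integral_le_lintegral_enorm _).trans ?_
    calc _ ≤ ∫⁻ _, c ∂P' := lintegral_mono fun ω' => by
          rw [← ofReal_norm, Real.norm_eq_abs, add_comm ω₁, add_comm ω₂]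
          exact (hg.comp_add_left (ζ ω')).le ω₁ ω₂ c h₁ h₂
      _ = c := by simp

lemma expect_add_of_indepFun (hg : TVLip g) {ξ ξ' : Ω → FiniteConfig Y} (hξ : Measurable ξ)
    (hξ' : Measurable ξ') (h : ∫⁻ ω, (ξ ω).1 Set.univ ∂P ≠ ∞)
    (h' : ∫⁻ ω, (ξ' ω).1 Set.univ ∂P ≠ ∞) (hi : IndepFun ξ ξ' P) :
    ∫ ω, g (ξ ω + ξ' ω) ∂P = ∫ ω, ∫ ω', g (ξ ω + ξ' ω') ∂P ∂P := by
  have hG : Measurable fun p : FiniteConfig Y × FiniteConfig Y => g (p.1 + p.2) :=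
    hg.measurable.comp (measurable_fst.add measurable_snd)
  have hint : Integrable (fun p : FiniteConfig Y × FiniteConfig Y => g (p.1 + p.2))
      (P.map fun ω => (ξ ω, ξ' ω)) := by
    rw [integrable_map_measure hG.aestronglyMeasurable (hξ.prodMk hξ').aemeasurable]
    exact hg.integrable (hξ.add hξ') (lintegral_add_univ_ne_top hξ h h')
  have e := (indepFun_iff_map_prod_eq_prod_map_map hξ.aemeasurable hξ'.aemeasurable).1 hi
  have := Measure.isProbabilityMeasure_map (μ := P) hξ.aemeasurable
  have := Measure.isProbabilityMeasure_map (μ := P) hξ'.aemeasurable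
  calc _ = ∫ p, g (p.1 + p.2) ∂(P.map fun ω => (ξ ω, ξ' ω)) := by
        rw [integral_map (hξ.prodMk hξ').aemeasurable hG.aestronglyMeasurable]
    _ = ∫ ω₁, ∫ ω₂, g (ω₁ + ω₂) ∂(P.map ξ') ∂(P.map ξ) := by
        rw [e] at hint ⊢
        exact integral_prod _ hint
    _ = ∫ ω, ∫ ω₂, g (ξ ω + ω₂) ∂(P.map ξ') ∂P := integral_map hξ.aemeasurable
        (hG.stronglyMeasurable.integral_prod_right (ν := P.map ξ')).aestronglyMeasurable
    _ = _ := integral_congr_ae (.of_forall fun ω => integral_map hξ'.aemeasurable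
        (hg.comp_add_left (ξ ω)).measurable.aestronglyMeasurable)

/-- Sums of independent point processes are close if the summands are. -/
theorem abs_expect_sum_sub_le {ι : Type*} {ξ : ι → Ω → FiniteConfig Y}
    {ζ : ι → Ω' → FiniteConfig Y} (hξ : ∀ i, Measurable (ξ i)) (hζ : ∀ i, Measurable (ζ i))
    (h : ∀ i, ∫⁻ ω, (ξ i ω).1 Set.univ ∂P ≠ ∞) (h' : ∀ i, ∫⁻ ω, (ζ i ω).1 Set.univ ∂P' ≠ ∞)
    (hi : ∀ (t : Finset ι) (a : ι), a ∉ t → IndepFun (fun ω => ∑ i ∈ t, ξ i ω) (ξ a) P)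
    (hi' : ∀ (t : Finset ι) (a : ι), a ∉ t → IndepFun (fun ω => ∑ i ∈ t, ζ i ω) (ζ a) P')
    {ε : ι → ℝ≥0∞} (hε : ∀ (i : ι) (g : FiniteConfig Y → ℝ), TVLip g →
      ENNReal.ofReal |(∫ ω, g (ξ i ω) ∂P) - ∫ ω, g (ζ i ω) ∂P'| ≤ ε i)
    (s : Finset ι) (hg : TVLip g) :
    ENNReal.ofReal |(∫ ω, g (∑ i ∈ s, ξ i ω) ∂P) - ∫ ω, g (∑ i ∈ s, ζ i ω) ∂P'| ≤
      ∑ i ∈ s, ε i := by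
  classical
  have hsum : ∀ s : Finset ι, Measurable fun ω => ∑ i ∈ s, ξ i ω := fun s =>
    Finset.measurable_sum s fun i _ => hξ i
  have hsum' : ∀ s : Finset ι, Measurable fun ω => ∑ i ∈ s, ζ i ω := fun s =>
    Finset.measurable_sum s fun i _ => hζ i
  have hfin : ∀ s : Finset ι, ∫⁻ ω, (∑ i ∈ s, ξ i ω).1 Set.univ ∂P ≠ ∞ := fun s => by
    simp only [FiniteConfig.coe_sum, Measure.finsetSum_apply]
    rw [lintegral_finsetSum _ fun i _ =>
      FiniteConfig.measurable_apply (hξ i) MeasurableSet.univ]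
    exact ENNReal.sum_ne_top.2 fun i _ => h i
  have hfin' : ∀ s : Finset ι, ∫⁻ ω, (∑ i ∈ s, ζ i ω).1 Set.univ ∂P' ≠ ∞ := fun s => by
    simp only [FiniteConfig.coe_sum, Measure.finsetSum_apply]
    rw [lintegral_finsetSum _ fun i _ =>
      FiniteConfig.measurable_apply (hζ i) MeasurableSet.univ]
    exact ENNReal.sum_ne_top.2 fun i _ => h' i
  induction s using Finset.induction_on generalizing g with
  | empty => simp
  | insert a s ha ih =>
    simp only [Finset.sum_insert ha, add_comm (ξ a _), add_comm (ζ a _)]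
    -- T averages over the new last summand. Exchanging the last summand costs ε a for each fixed
    -- value of the others; the rest is the induction hypothesis for T, which is again Lipschitz.
    -- Hence the induction is over all functionals.
    set T : FiniteConfig Y → ℝ := fun ω => ∫ ω', g (ω + ζ a ω') ∂P' with hT
    have hTL : TVLip T := hg.expect_add (hζ a) (h' a)
    have hT' : TVLip fun ω => ∫ ω', g (ω + ξ a ω') ∂P := hg.expect_add (hξ a) (h a)
    rw [hg.expect_add_of_indepFun (hsum s) (hξ a) (hfin s) (h a) (hi s a ha),
      hg.expect_add_of_indepFun (hsum' s) (hζ a) (hfin' s) (h' a) (hi' s a ha)]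
    calc _ ≤ ENNReal.ofReal (|(∫ ω, ∫ ω', g (∑ i ∈ s, ξ i ω + ξ a ω') ∂P ∂P) -
              ∫ ω, T (∑ i ∈ s, ξ i ω) ∂P| + |(∫ ω, T (∑ i ∈ s, ξ i ω) ∂P) -
              ∫ ω, T (∑ i ∈ s, ζ i ω) ∂P'|) := ENNReal.ofReal_le_ofReal (_root_.abs_sub_le _ _ _)
      _ ≤ ε a + ∑ i ∈ s, ε i := ?_
    rw [ENNReal.ofReal_add (abs_nonneg _) (abs_nonneg _)]
    refine add_le_add ?_ (ih hTL)
    rw [← integral_sub (hT'.integrable (hsum s) (hfin s)) (hTL.integrable (hsum s) (hfin s)),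
      ← Real.norm_eq_abs, ofReal_norm]
    refine (enorm_integral_le_lintegral_enorm _).trans ?_
    calc _ ≤ ∫⁻ _, ε a ∂P := lintegral_mono fun ω => by
          rw [← ofReal_norm, Real.norm_eq_abs]
          exact hε a _ (hg.comp_add_left _)
      _ = ε a := by simp

end Replace

end TVLip

/-! ### Geometry of the flat torus -/

namespace UnitAddCircle

lemma exists_coe_eq (t : UnitAddCircle) : ∃ u : ℝ, (u : UnitAddCircle) = t ∧ |u| = ‖t‖ := by
  induction t using QuotientAddGroup.induction_on with
  | H x =>
    refine ⟨x - round x, ?_, (UnitAddCircle.norm_eq).symm⟩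
    refine (QuotientAddGroup.eq_iff_sub_mem).2 ?_
    simp [AddSubgroup.mem_zmultiples_iff]

lemma norm_coe_of_abs_le {u : ℝ} (h : |u| ≤ 1 / 2) : ‖(u : UnitAddCircle)‖ = |u| :=
  (AddCircle.norm_coe_eq_abs_iff (p := (1 : ℝ)) one_ne_zero).2 (by simpa using h)

/-- The multiples do not wrap around the circle as long as they stay within distance 1/2. -/
lemma norm_nsmul_of_le {t : UnitAddCircle} {N : ℕ} (h : N * ‖t‖ ≤ 1 / 2) : ‖N • t‖ = N * ‖t‖ := by
  obtain ⟨u, rfl, hu⟩ := exists_coe_eq t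
  rw [← hu] at h ⊢
  have e : N • (u : UnitAddCircle) = ((N * u : ℝ) : UnitAddCircle) := by
    rw [← nsmul_eq_mul]; exact (AddCircle.coe_nsmul (p := (1 : ℝ)))
  rw [e, norm_coe_of_abs_le] <;> rw [abs_mul, Nat.abs_cast]
  exact h

lemma volume_sphere (c : UnitAddCircle) (s : ℝ) : volume (Metric.sphere c s) = 0 := by
  have hsing : ∀ t : UnitAddCircle, volume ({t} : Set UnitAddCircle) = 0 := fun t => by
    have := AddCircle.volume_closedBall (1 : ℝ) (x := t) 0
    simpa using this
  refine measure_mono_null (t := {c + (s : UnitAddCircle)} ∪ {c - (s : UnitAddCircle)}) ?_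
    (measure_union_null (hsing _) (hsing _))
  intro t ht
  rw [mem_sphere_iff_norm] at ht
  obtain ⟨u, hu, hu'⟩ := exists_coe_eq (t - c)
  rw [ht] at hu'
  have : t = c + (u : UnitAddCircle) := by rw [hu]; abel
  subst this
  rcases eq_or_eq_neg_of_abs_eq hu' with rfl | rfl
  · left; rfl
  · right; simp [sub_eq_add_neg]

instance : IsProbabilityMeasure (volume : Measure UnitAddCircle) := ⟨UnitAddCircle.measure_univ⟩

end UnitAddCircle

section Torus

variable {d : ℕ}

instance : IsProbabilityMeasure (torusVolume d) :=
  Measure.isProbabilityMeasure_map (by fun_prop)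

lemma torusVolume_apply {S : Set (FlatTorus d)} (hS : MeasurableSet S) :
    torusVolume d S = volume (WithLp.toLp 2 ⁻¹' S : Set (Fin d → UnitAddCircle)) :=
  Measure.map_apply (by fun_prop) hS

instance : (torusVolume d).IsAddLeftInvariant := ⟨fun v => by
  ext S hS
  have hv : Measurable fun x : FlatTorus d => v + x := measurable_const_add v
  rw [Measure.map_apply hv hS, torusVolume_apply (hv hS), torusVolume_apply hS]
  have := measure_preimage_add (volume : Measure (Fin d → UnitAddCircle)) v.ofLp
    (WithLp.toLp 2 ⁻¹' S)
  rw [← this]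
  rfl⟩

lemma torusVolume_preimage_sub (v : FlatTorus d) (S : Set (FlatTorus d)) :
    torusVolume d ((fun z => z - v) ⁻¹' S) = torusVolume d S := by
  have := measure_preimage_add (torusVolume d) (-v) S
  rw [← this]
  congr 1
  ext z
  simp [sub_eq_neg_add]

lemma FlatTorus.dist_apply_le (x y : FlatTorus d) (i : Fin d) : dist (x i) (y i) ≤ dist x y := by
  rw [dist_eq_norm, dist_eq_norm]
  exact PiLp.norm_apply_le (x - y) i

lemma torusVolume_closedBall_le (x : FlatTorus d) (r : ℝ) :
    torusVolume d (Metric.closedBall x r) ≤ ENNReal.ofReal (2 * r) ^ d := by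
  rw [torusVolume_apply Metric.isClosed_closedBall.measurableSet]
  refine (measure_mono (t := Set.univ.pi fun i => Metric.closedBall (x i) r) ?_).trans ?_
  · intro y hy i _
    exact (FlatTorus.dist_apply_le _ _ i).trans hy
  · rw [volume_pi_pi]
    refine (Finset.prod_le_pow_card _ _ (ENNReal.ofReal (2 * r)) fun i _ => ?_).trans_eq (by simp)
    rw [AddCircle.volume_closedBall]
    exact ENNReal.ofReal_le_ofReal (min_le_right _ _)

/-- The ball contains the cube of half side r/d, because d (r/d)² ≤ r². The half side r/√d would
also do, but only the order in r matters. -/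
lemma le_torusVolume_closedBall (x : FlatTorus d) {r : ℝ} (hr : 0 ≤ r) (hd : 0 < d)
    (hr1 : 2 * (r / d) ≤ 1) :
    ENNReal.ofReal (2 * (r / d)) ^ d ≤ torusVolume d (Metric.closedBall x r) := by
  rw [torusVolume_apply Metric.isClosed_closedBall.measurableSet]
  refine le_trans ?_ (measure_mono (s := Set.univ.pi fun i => Metric.closedBall (x i) (r / d)) ?_)
  · rw [volume_pi_pi]
    simp only [AddCircle.volume_closedBall, min_eq_right hr1]
    simp
  · intro y hy
    simp only [Set.mem_pi, Set.mem_univ, forall_const, Metric.mem_closedBall] at hy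
    simp only [Set.mem_preimage, Metric.mem_closedBall, PiLp.dist_eq_of_L2]
    refine Real.sqrt_le_iff.2 ⟨hr, ?_⟩
    have hd' : (1 : ℝ) ≤ d := by exact_mod_cast hd
    calc ∑ i, dist (y i) (x i) ^ 2 ≤ ∑ _i : Fin d, (r / d) ^ 2 :=
          Finset.sum_le_sum fun i _ => pow_le_pow_left₀ dist_nonneg (hy i) 2
      _ = r ^ 2 / d := by
          rw [Finset.sum_const, Finset.card_univ, Fintype.card_fin, nsmul_eq_mul]
          field_simp
      _ ≤ r ^ 2 := div_le_self (by positivity) hd'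

/-- By Fubini it suffices to fix all coordinates but one: the remaining coordinate then lies at a
prescribed distance from that of x, which leaves at most two points of the circle. -/
lemma torusVolume_sphere (hd : 0 < d) (x : FlatTorus d) (r : ℝ) :
    torusVolume d (Metric.sphere x r) = 0 := by
  classical
  have hS : MeasurableSet (WithLp.toLp 2 ⁻¹' Metric.sphere x r : Set (Fin d → UnitAddCircle)) :=
    (WithLp.measurable_toLp 2 _) Metric.isClosed_sphere.measurableSet
  rw [torusVolume_apply Metric.isClosed_sphere.measurableSet, ← lintegral_indicator_one hS]
  set i₀ : Fin d := ⟨0, hd⟩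
  rw [volume_pi, lintegral_eq_of_lmarginal_eq (μ := fun _ : Fin d => (volume : Measure UnitAddCircle))
    {i₀} (g := fun _ => 0) (measurable_one.indicator hS) measurable_const]
  · simp
  rw [lmarginal_singleton, lmarginal_singleton]
  ext y
  simp only [lintegral_zero]
  have hm : Measurable fun t : UnitAddCircle => Function.update y i₀ t := measurable_update y
  rw [← nonpos_iff_eq_zero]
  calc _ ≤ ∫⁻ t, (Metric.sphere (x i₀)
          (√(r ^ 2 - ∑ i ∈ Finset.univ.erase i₀, dist (y i) (x i) ^ 2))).indicator 1 t := by
        refine lintegral_mono fun t => ?_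
        by_cases ht : Function.update y i₀ t ∈
          (WithLp.toLp 2 ⁻¹' Metric.sphere x r : Set (Fin d → UnitAddCircle))
        swap
        · simp [ht]
        have ht' : t ∈ Metric.sphere (x i₀)
            (√(r ^ 2 - ∑ i ∈ Finset.univ.erase i₀, dist (y i) (x i) ^ 2)) := by
          simp only [Set.mem_preimage, mem_sphere_iff_norm, ← dist_eq_norm, PiLp.dist_eq_of_L2] at ht
          rw [← Finset.add_sum_erase _ _ (Finset.mem_univ i₀)] at ht
          rw [Metric.mem_sphere, ← ht, Real.sq_sqrt (by positivity)]
          have : ∑ i ∈ Finset.univ.erase i₀, dist (Function.update y i₀ t i) (x i) ^ 2 =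
              ∑ i ∈ Finset.univ.erase i₀, dist (y i) (x i) ^ 2 :=
            Finset.sum_congr rfl fun i hi => by
              rw [Function.update_of_ne (Finset.ne_of_mem_erase hi)]
          rw [this, Function.update_self, add_sub_cancel_right, Real.sqrt_sq dist_nonneg]
        rw [Set.indicator_of_mem ht, Set.indicator_of_mem ht']
        simp only [Pi.one_apply, le_refl]
    _ = 0 := by
        rw [lintegral_indicator_one Metric.isClosed_sphere.measurableSet]
        exact UnitAddCircle.volume_sphere _ _

lemma FlatTorus.norm_nsmul_of_le {v : FlatTorus d} {N : ℕ} (h : N * ‖v‖ ≤ 1 / 2) :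
    ‖N • v‖ = N * ‖v‖ := by
  have h1 : ∀ i, ‖(N • v) i‖ = N * ‖v i‖ := fun i => by
    change ‖N • v i‖ = _
    refine UnitAddCircle.norm_nsmul_of_le (le_trans ?_ h)
    gcongr
    exact PiLp.norm_apply_le v i
  rw [PiLp.norm_eq_of_L2, PiLp.norm_eq_of_L2]
  simp only [h1, mul_pow, ← Finset.mul_sum]
  rw [Real.sqrt_mul (by positivity), Real.sqrt_sq (by positivity)]

/-- The volume of the part of a translated set outside the original set is subadditive. -/
lemma torusVolume_translate_diff_add_le (A : Set (FlatTorus d)) (v w : FlatTorus d) :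
    torusVolume d (((fun z => z - (v + w)) ⁻¹' A) \ A) ≤
      torusVolume d (((fun z => z - v) ⁻¹' A) \ A) + torusVolume d (((fun z => z - w) ⁻¹' A) \ A) := by
  rw [← torusVolume_preimage_sub v (((fun z => z - w) ⁻¹' A) \ A)]
  refine (measure_mono ?_).trans (measure_union_le _ _)
  rintro z ⟨hz, hzA⟩
  by_cases h : z - v ∈ A
  · exact Or.inl ⟨h, hzA⟩
  · refine Or.inr ⟨?_, h⟩
    simpa [sub_sub] using hz

lemma torusVolume_translate_diff_nsmul_le (A : Set (FlatTorus d)) (v : FlatTorus d) (N : ℕ) :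
    torusVolume d (((fun z => z - N • v) ⁻¹' A) \ A) ≤
      N * torusVolume d (((fun z => z - v) ⁻¹' A) \ A) := by
  induction N with
  | zero => simp
  | succ N ih =>
    rw [succ_nsmul]
    refine (torusVolume_translate_diff_add_le A _ _).trans ?_
    push_cast
    rw [add_mul, one_mul]
    gcongr

/-- A ball that is moved by a small distance sweeps out a proportional volume. -/
lemma torusVolume_closedBall_le_mul_diff (x y : FlatTorus d) {r : ℝ} {N : ℕ}
    (h1 : 2 * r < N * dist x y) (h2 : N * dist x y ≤ 1 / 2) :
    torusVolume d (Metric.closedBall 0 r) ≤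
      N * torusVolume d (Metric.closedBall y r \ Metric.closedBall x r) := by
  set A : Set (FlatTorus d) := Metric.closedBall 0 r with hA
  have hv : ‖y - x‖ = dist x y := by rw [dist_comm, dist_eq_norm]
  have hN := FlatTorus.norm_nsmul_of_le (v := y - x) (N := N) (by rwa [hv])
  rw [hv] at hN
  -- The N-fold shift has length N |y - x| > 2r, so it moves the ball off itself and the difference
  -- is the whole translate.
  have e1 : ((fun z => z - N • (y - x)) ⁻¹' A) \ A = (fun z => z - N • (y - x)) ⁻¹' A := by
    refine sdiff_eq_left.2 (Set.disjoint_left.2 fun z hz hz' => ?_)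
    simp only [hA, Set.mem_preimage, mem_closedBall_zero_iff] at hz hz'
    have := norm_sub_le z (z - N • (y - x))
    rw [sub_sub_cancel, hN] at this
    linarith
  have e2 : Metric.closedBall y r \ Metric.closedBall x r =
      (fun z => z - x) ⁻¹' (((fun z => z - (y - x)) ⁻¹' A) \ A) := by
    ext z
    simp [hA, dist_eq_norm]
  rw [e2, torusVolume_preimage_sub, ← torusVolume_preimage_sub (N • (y - x)) A, ← e1]
  exact torusVolume_translate_diff_nsmul_le A (y - x) N

lemma torusVolume_closedBall (x : FlatTorus d) (r : ℝ) :
    torusVolume d (Metric.closedBall x r) = torusVolume d (Metric.closedBall 0 r) := by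
  rw [← torusVolume_preimage_sub x (Metric.closedBall 0 r)]
  congr 1
  ext z
  simp [dist_eq_norm]

/-! ### Measures with a bounded density -/

section Density

variable {lam : FlatTorus d → ℝ} {lamMinus lamPlus : ℝ}

lemma torusMeasure_le (hlam : ∀ x, lam x ≤ lamPlus) (S : Set (FlatTorus d)) :
    torusMeasure lam S ≤ ENNReal.ofReal lamPlus * torusVolume d S := by
  have h : torusMeasure lam ≤ (torusVolume d).withDensity fun _ => ENNReal.ofReal lamPlus :=
    withDensity_mono (.of_forall fun x => ENNReal.ofReal_le_ofReal (hlam x))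
  simpa [withDensity_const] using h S

lemma le_torusMeasure (hlam : ∀ x, lamMinus ≤ lam x) (S : Set (FlatTorus d)) :
    ENNReal.ofReal lamMinus * torusVolume d S ≤ torusMeasure lam S := by
  have h : ((torusVolume d).withDensity fun _ => ENNReal.ofReal lamMinus) ≤ torusMeasure lam :=
    withDensity_mono (.of_forall fun x => ENNReal.ofReal_le_ofReal (hlam x))
  simpa [withDensity_const] using h S

lemma torusMeasure_sphere (hd : 0 < d) (x : FlatTorus d) (r : ℝ) :
    torusMeasure lam (Metric.sphere x r) = 0 :=
  withDensity_absolutelyContinuous _ _ (torusVolume_sphere hd x r)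

end Density

end Torus

/-! ### The `k`-nearest neighbour radius -/

section Knn

variable {d : ℕ}

/-- Only a countable infimum is visibly measurable; rational radii suffice because the count
increases with the radius. -/
lemma knnRadius_eq_iInf_rat (k : ℕ) (x : FlatTorus d) (ω : Measure (FlatTorus d)) :
    knnRadius k x ω = ⨅ (q : ℚ) (_ : 0 < (q : ℝ))
      (_ : (k : ℝ≥0∞) ≤ ω (Metric.closedBall x (q : ℝ) \ {x})), ENNReal.ofReal q := by
  refine le_antisymm (le_iInf fun q => le_iInf fun hq => le_iInf fun h => ?_) ?_
  · exact iInf_le_of_le (q : ℝ) (iInf_le_of_le hq (iInf_le _ h))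
  · refine le_iInf fun r => le_iInf fun hr => le_iInf fun h => ENNReal.le_of_forall_pos_le_add ?_
    intro ε hε _
    obtain ⟨q, hq1, hq2⟩ := exists_rat_btwn (show r < r + ε by simpa using hε)
    refine (iInf_le_of_le q (iInf_le_of_le (hr.trans hq1) (iInf_le _ (h.trans
      (measure_mono (Set.sdiff_subset_sdiff_left (Metric.closedBall_subset_closedBall hq1.le)))))
      )).trans ?_
    refine (ENNReal.ofReal_le_ofReal hq2.le).trans ?_
    exact ENNReal.ofReal_add_le.trans (add_le_add_right ENNReal.ofReal_coe_nnreal.le _)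

lemma measurableSet_closedBall_sdiff (x : FlatTorus d) (r : ℝ) :
    MeasurableSet (Metric.closedBall x r \ {x}) :=
  MeasurableSet.diff measurableSet_closedBall (measurableSet_singleton x)

lemma measurable_apply_closedBall_sdiff {α : Type*} [MeasurableSpace α] {x : α → FlatTorus d}
    {ω : α → FiniteConfig (FlatTorus d)} (hx : Measurable x) (hω : Measurable ω) (r : ℝ) :
    Measurable fun a => (ω a).1 (Metric.closedBall (x a) r \ {x a}) := by
  have hS : MeasurableSet {p : α × FlatTorus d | dist p.2 (x p.1) ≤ r ∧ p.2 ≠ x p.1} := by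
    refine MeasurableSet.inter (measurableSet_le (measurable_snd.dist (hx.comp measurable_fst))
      measurable_const) ?_
    exact (measurableSet_eq_fun measurable_snd (hx.comp measurable_fst)).compl
  exact FiniteConfig.measurable_measure hω hS

lemma measurable_knnRadius (k : ℕ) : Measurable fun p : FlatTorus d × FiniteConfig (FlatTorus d) =>
    knnRadius k p.1 p.2.1 := by
  simp only [knnRadius_eq_iInf_rat]
  refine Measurable.iInf fun q => Measurable.iInf fun _ => ?_
  have hE : MeasurableSet {p : FlatTorus d × FiniteConfig (FlatTorus d) |
      (k : ℝ≥0∞) ≤ p.2.1 (Metric.closedBall p.1 (q : ℝ) \ {p.1})} :=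
    measurableSet_le measurable_const
      (measurable_apply_closedBall_sdiff measurable_fst measurable_snd _)
  -- An infimum over an event is the value on the event and ∞ off it, so it is written with
  -- indicators.
  have : (fun p : FlatTorus d × FiniteConfig (FlatTorus d) =>
      ⨅ (_ : (k : ℝ≥0∞) ≤ p.2.1 (Metric.closedBall p.1 (q : ℝ) \ {p.1})), ENNReal.ofReal q) =
      fun p => Set.indicator {p : FlatTorus d × FiniteConfig (FlatTorus d) |
        (k : ℝ≥0∞) ≤ p.2.1 (Metric.closedBall p.1 (q : ℝ) \ {p.1})} (fun _ => ENNReal.ofReal q) p +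
      Set.indicator {p : FlatTorus d × FiniteConfig (FlatTorus d) |
        (k : ℝ≥0∞) ≤ p.2.1 (Metric.closedBall p.1 (q : ℝ) \ {p.1})}ᶜ (fun _ => ∞) p := by
    ext p
    by_cases h : (k : ℝ≥0∞) ≤ p.2.1 (Metric.closedBall p.1 (q : ℝ) \ {p.1}) <;> simp [h]
  rw [this]
  exact (measurable_const.indicator hE).add (measurable_const.indicator hE.compl)

lemma measurable_knnMass (K : Measure (FlatTorus d)) [SFinite K] (k : ℕ) :
    Measurable fun p : FlatTorus d × FiniteConfig (FlatTorus d) => knnMass K k p.1 p.2.1 := by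
  have hS : MeasurableSet {q : (FlatTorus d × FiniteConfig (FlatTorus d)) × FlatTorus d |
      edist q.2 q.1.1 ≤ knnRadius k q.1.1 q.1.2.1} :=
    measurableSet_le (measurable_snd.edist (measurable_fst.comp measurable_fst))
      ((measurable_knnRadius k).comp measurable_fst)
  exact measurable_measure_prodMk_left hS

/-- Adding or moving mass at `x` does not change the `k`-nearest neighbour radius of `x`. -/
lemma knnRadius_congr {k : ℕ} {x : FlatTorus d} {ω ω' : Measure (FlatTorus d)}
    (h : ∀ r, ω (Metric.closedBall x r \ {x}) = ω' (Metric.closedBall x r \ {x})) :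
    knnRadius k x ω = knnRadius k x ω' := by
  simp only [knnRadius, h]

lemma knnMass_congr {K : Measure (FlatTorus d)} {k : ℕ} {x : FlatTorus d}
    {ω ω' : Measure (FlatTorus d)}
    (h : ∀ r, ω (Metric.closedBall x r \ {x}) = ω' (Metric.closedBall x r \ {x})) :
    knnMass K k x ω = knnMass K k x ω' := by
  rw [knnMass, knnMass, knnRadius_congr h]

lemma add_dirac_apply_sdiff (ω : FiniteConfig (FlatTorus d)) (x : FlatTorus d) (r : ℝ) :
    (ω + .dirac x).1 (Metric.closedBall x r \ {x}) = ω.1 (Metric.closedBall x r \ {x}) := by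
  simp only [FiniteConfig.coe_add, Measure.add_apply, FiniteConfig.coe_dirac,
    Measure.dirac_apply' _ (measurableSet_closedBall_sdiff x r)]
  simp

lemma knnMass_add_dirac (K : Measure (FlatTorus d)) (k : ℕ) (x : FlatTorus d)
    (ω : FiniteConfig (FlatTorus d)) : knnMass K k x (ω + .dirac x).1 = knnMass K k x ω.1 :=
  knnMass_congr fun r => add_dirac_apply_sdiff ω x r

/-- The count in a closed ball is right-continuous in the radius when ω is finite, so the infimum
defining the radius is attained at every positive level. -/
lemma knnRadius_le_iff {k : ℕ} {x : FlatTorus d} {ω : Measure (FlatTorus d)} [IsFiniteMeasure ω]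
    {r : ℝ} (hr : 0 < r) :
    knnRadius k x ω ≤ ENNReal.ofReal r ↔ (k : ℝ≥0∞) ≤ ω (Metric.closedBall x r \ {x}) := by
  refine ⟨fun h => ?_, fun h => iInf_le_of_le r (iInf_le_of_le hr (iInf_le _ h))⟩
  have hs : Metric.closedBall x r \ {x} =
      ⋂ m : ℕ, Metric.closedBall x (r + 1 / ((m : ℝ) + 1)) \ {x} := by
    ext y
    simp only [Set.mem_sdiff, Metric.mem_closedBall, Set.mem_iInter, Set.mem_singleton_iff]
    refine ⟨fun ⟨h1, h2⟩ m => ⟨h1.trans ?_, h2⟩, fun h1 => ⟨?_, (h1 0).2⟩⟩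
    · have : (0 : ℝ) ≤ 1 / ((m : ℝ) + 1) := by positivity
      linarith
    · have ht : Tendsto (fun m : ℕ => r + 1 / ((m : ℝ) + 1)) atTop (𝓝 (r + 0)) :=
        tendsto_const_nhds.add tendsto_one_div_add_atTop_nhds_zero_nat
      rw [add_zero] at ht
      exact ge_of_tendsto' ht fun m => (h1 m).1
  have ht : Tendsto (fun m : ℕ => ω (Metric.closedBall x (r + 1 / ((m : ℝ) + 1)) \ {x})) atTop
      (𝓝 (ω (Metric.closedBall x r \ {x}))) := by
    rw [hs]
    refine tendsto_measure_iInter_atTop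
      (fun m => (measurableSet_closedBall_sdiff x _).nullMeasurableSet) ?_
      ⟨0, measure_ne_top _ _⟩
    intro m m' hm
    refine Set.sdiff_subset_sdiff_left (Metric.closedBall_subset_closedBall ?_)
    have := one_div_le_one_div_of_le (show (0 : ℝ) < (m : ℝ) + 1 by positivity)
      (show (m : ℝ) + 1 ≤ m' + 1 by gcongr)
    linarith
  refine ge_of_tendsto' ht fun m => ?_
  have hlt : knnRadius k x ω < ENNReal.ofReal (r + 1 / ((m : ℝ) + 1)) :=
    h.trans_lt ((ENNReal.ofReal_lt_ofReal_iff (by positivity)).2 (by simp; positivity))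
  simp only [knnRadius, iInf_lt_iff] at hlt
  obtain ⟨r', hr', h1, h2⟩ := hlt
  refine h1.trans (measure_mono (Set.sdiff_subset_sdiff_left (Metric.closedBall_subset_closedBall ?_)))
  exact ((ENNReal.ofReal_lt_ofReal_iff (by positivity)).1 h2).le

/-! ### Balls of prescribed mass -/

/-- The mass is the distribution function of the distance to x, whose atoms would be spheres of
positive mass. -/
lemma continuous_measureReal_closedBall {K : Measure (FlatTorus d)} [IsProbabilityMeasure K]
    {x : FlatTorus d} (hK : ∀ r, K (Metric.sphere x r) = 0) :
    Continuous fun r => K.real (Metric.closedBall x r) := by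
  have hm : Measurable fun y : FlatTorus d => dist y x := measurable_id.dist measurable_const
  set ν := K.map fun y => dist y x with hν
  have : IsProbabilityMeasure ν := Measure.isProbabilityMeasure_map hm.aemeasurable
  have e : (fun r => K.real (Metric.closedBall x r)) = cdf ν := by
    ext r
    rw [cdf_eq_real, hν, map_measureReal_apply hm measurableSet_Iic]
    rfl
  rw [e, continuous_iff_continuousAt]
  intro r
  rw [(monotone_cdf ν).continuousAt_iff_leftLim_eq_rightLim, StieltjesFunction.rightLim_eq]
  have h1 := (cdf ν).measure_singleton r
  rw [measure_cdf, hν, Measure.map_apply hm (measurableSet_singleton r)] at h1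
  have h2 : (fun y => dist y x) ⁻¹' {r} = Metric.sphere x r := rfl
  rw [h2, hK, eq_comm, ENNReal.ofReal_eq_zero] at h1
  exact le_antisymm ((monotone_cdf ν).leftLim_le le_rfl) (by linarith)

/-- Balls of prescribed mass `u`, with the largest possible radius. -/
lemma exists_radius {K : Measure (FlatTorus d)} [IsProbabilityMeasure K]
    {x : FlatTorus d} (hK : ∀ r, K (Metric.sphere x r) = 0) {u : ℝ} (hu : 0 < u) (hu1 : u < 1) :
    ∃ ρ : ℝ, 0 < ρ ∧ K.real (Metric.closedBall x ρ) = u ∧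
      ∀ r, K.real (Metric.closedBall x r) ≤ u → r ≤ ρ := by
  have hc := continuous_measureReal_closedBall hK
  set F : ℝ → ℝ := fun r => K.real (Metric.closedBall x r) with hF
  have hmono : Monotone F := fun r s hrs =>
    measureReal_mono (Metric.closedBall_subset_closedBall hrs)
  have h0 : F 0 = 0 := by
    have := hK 0
    rw [Metric.sphere_zero] at this
    simp [hF, Measure.real, this]
  have hlim : ∃ b, u < F b := by
    have ht : Tendsto (fun m : ℕ => K (Metric.closedBall x (m : ℝ))) atTop (𝓝 (K Set.univ)) := by
      rw [← Metric.iUnion_closedBall_nat x]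
      exact tendsto_measure_iUnion_atTop fun m m' h =>
        Metric.closedBall_subset_closedBall (by exact_mod_cast h)
    have ht' : Tendsto (fun m : ℕ => F m) atTop (𝓝 1) := by
      have := (ENNReal.tendsto_toReal (by simp)).comp ht
      simpa [hF, Measure.real, Function.comp_def] using this
    obtain ⟨m, hm⟩ := (ht'.eventually (lt_mem_nhds hu1)).exists
    exact ⟨m, hm⟩
  obtain ⟨b, hb⟩ := hlim
  obtain ⟨r₀, hr₀⟩ := mem_range_of_exists_le_of_exists_ge hc ⟨0, h0.trans_le hu.le⟩ ⟨b, hb.le⟩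
  -- The radii of mass u may fill an interval. The supremum is taken so that a ball has mass at most
  -- u exactly when its radius is at most ρ.
  set S : Set ℝ := {r | F r ≤ u} with hS
  have hSc : IsClosed S := isClosed_le hc continuous_const
  have hSb : BddAbove S := ⟨b, fun r hr => by
    by_contra! h
    exact absurd (hmono h.le) (not_le.2 (lt_of_le_of_lt hr hb))⟩
  have hmem : sSup S ∈ S := hSc.csSup_mem ⟨r₀, hr₀.le⟩ hSb
  have hle : ∀ r, F r ≤ u → r ≤ sSup S := fun r hr => le_csSup hSb hr
  have heq : F (sSup S) = u := le_antisymm hmem (hr₀ ▸ hmono (hle r₀ hr₀.le))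
  refine ⟨sSup S, ?_, heq, hle⟩
  by_contra! h
  have := hmono h
  rw [heq, h0] at this
  linarith

open Classical in
/-- The radius of the largest ball around `x` of mass `u`. -/
def massRadius (K : Measure (FlatTorus d)) (x : FlatTorus d) (u : ℝ) : ℝ :=
  if h : ∃ ρ : ℝ, 0 < ρ ∧ K.real (Metric.closedBall x ρ) = u ∧
      ∀ r, K.real (Metric.closedBall x r) ≤ u → r ≤ ρ then h.choose else 0

lemma massRadius_spec {K : Measure (FlatTorus d)} [IsProbabilityMeasure K]
    {x : FlatTorus d} (hK : ∀ r, K (Metric.sphere x r) = 0) {u : ℝ} (hu : 0 < u) (hu1 : u < 1) :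
    0 < massRadius K x u ∧ K.real (Metric.closedBall x (massRadius K x u)) = u ∧
      ∀ r, K.real (Metric.closedBall x r) ≤ u → r ≤ massRadius K x u := by
  have h := exists_radius hK hu hu1
  rw [massRadius, dif_pos h]
  exact h.choose_spec

lemma knnMass_le_one (K : Measure (FlatTorus d)) [IsProbabilityMeasure K] (k : ℕ) (x : FlatTorus d)
    (ω : Measure (FlatTorus d)) : knnMass K k x ω ≤ 1 := prob_le_one

/-- The mass of the `k`-nearest neighbour ball exceeds `u` if and only if the ball of mass `u`
has less than `k` points. -/
lemma lt_knnMass_iff {K : Measure (FlatTorus d)} [IsProbabilityMeasure K]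
    {x : FlatTorus d} (hK : ∀ r, K (Metric.sphere x r) = 0) {u : ℝ} (hu : 0 < u) (hu1 : u < 1)
    {k : ℕ} {ω : Measure (FlatTorus d)} [IsFiniteMeasure ω] :
    u < (knnMass K k x ω).toReal ↔
      ω (Metric.closedBall x (massRadius K x u) \ {x}) < k := by
  obtain ⟨h1, h2, h3⟩ := massRadius_spec hK hu hu1
  rw [← not_le, ← not_le, ← knnRadius_le_iff h1, not_iff_not]
  have hball : ∀ r, 0 ≤ r → {y | edist y x ≤ ENNReal.ofReal r} = Metric.closedBall x r :=
    fun r hr => by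
      ext y
      simp [edist_dist, ENNReal.ofReal_le_ofReal_iff hr]
  constructor
  · intro h
    -- An infinite radius gives the whole torus, of mass 1 > u, against the assumption.
    by_cases ht : knnRadius k x ω = ∞
    · rw [knnMass, ht] at h
      simp at h
      linarith
    · rw [← ENNReal.ofReal_toReal ht]
      rw [knnMass, ← ENNReal.ofReal_toReal ht, hball _ ENNReal.toReal_nonneg] at h
      exact ENNReal.ofReal_le_ofReal (h3 _ h)
  · intro h
    rw [← h2, Measure.real, ← hball _ h1.le]
    exact ENNReal.toReal_mono (measure_ne_top _ _) (measure_mono fun y hy => le_trans hy h)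

end Knn

/-! ### The tail of the Poisson law and the Erlang law -/

lemma poissonTail_nonneg (k : ℕ) {v : ℝ} (hv : 0 ≤ v) : 0 ≤ poissonTail k v := by
  unfold poissonTail; positivity

lemma poissonTail_zero {k : ℕ} (hk : 1 ≤ k) : poissonTail k 0 = 1 := by
  obtain ⟨j, rfl⟩ : ∃ j, k = j + 1 := ⟨k - 1, by omega⟩
  simp [poissonTail, Finset.sum_range_succ']

/-- Half of the exponent pays for the polynomial: v^j / j! = 2^j (v/2)^j / j! ≤ 2^j e^{v/2}, and the
powers of 2 sum to less than 2^k. -/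
lemma poissonTail_le (k : ℕ) {v : ℝ} (hv : 0 ≤ v) :
    poissonTail k v ≤ 2 ^ k * Real.exp (-(v / 2)) := by
  have h1 : ∀ j ∈ Finset.range k, v ^ j / (j.factorial : ℝ) ≤ 2 ^ j * Real.exp (v / 2) := by
    intro j _
    have := Real.pow_div_factorial_le_exp (x := v / 2) (by positivity) j
    calc v ^ j / (j.factorial : ℝ) = 2 ^ j * ((v / 2) ^ j / j.factorial) := by
          rw [div_pow]; field_simp
      _ ≤ _ := by gcongr
  have h2 : ∑ j ∈ Finset.range k, v ^ j / (j.factorial : ℝ) ≤ 2 ^ k * Real.exp (v / 2) := by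
    refine (Finset.sum_le_sum h1).trans ?_
    rw [← Finset.sum_mul]
    gcongr
    have := geom_sum_eq (show (2 : ℝ) ≠ 1 by norm_num) k
    rw [this]
    norm_num
  calc poissonTail k v ≤ Real.exp (-v) * (2 ^ k * Real.exp (v / 2)) := by
        unfold poissonTail; gcongr
    _ = 2 ^ k * Real.exp (-(v / 2)) := by
        rw [mul_left_comm, ← Real.exp_add]; ring_nf

/-- The derivatives of consecutive terms telescope, which leaves minus the Erlang density. -/
lemma hasDerivAt_poissonTail (j : ℕ) (v : ℝ) :
    HasDerivAt (poissonTail (j + 1)) (-(Real.exp (-v) * v ^ j / (j.factorial : ℝ))) v := by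
  have hexp : HasDerivAt (fun v : ℝ => Real.exp (-v)) (-Real.exp (-v)) v := by
    simpa using (hasDerivAt_neg v).exp
  induction j with
  | zero =>
    have : poissonTail 1 = fun v => Real.exp (-v) := by ext v; simp [poissonTail]
    rw [this]
    simpa using hexp
  | succ j ih =>
    have e : poissonTail (j + 1 + 1) =
        fun v => poissonTail (j + 1) v + Real.exp (-v) * (v ^ (j + 1) / ((j + 1).factorial : ℝ)) := by
      ext v
      rw [poissonTail, poissonTail, Finset.sum_range_succ _ (j + 1), mul_add]
    rw [e]
    have h2 := ih.add (hexp.mul ((hasDerivAt_pow (j + 1) v).div_const ((j + 1).factorial : ℝ)))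
    refine h2.congr_deriv ?_
    have h3 : (j.factorial : ℝ) ≠ 0 := by positivity
    rw [Nat.factorial_succ]
    push_cast
    have h4 : ((j : ℝ) + 1) ≠ 0 := by positivity
    field_simp
    ring

lemma tendsto_poissonTail (k : ℕ) : Tendsto (poissonTail k) atTop (𝓝 0) := by
  have h1 : Tendsto (fun v : ℝ => 2 ^ k * Real.exp (-(v / 2))) atTop (𝓝 0) := by
    have : Tendsto (fun v : ℝ => Real.exp (-(v / 2))) atTop (𝓝 0) :=
      Real.tendsto_exp_neg_atTop_nhds_zero.comp (tendsto_id.atTop_div_const (by norm_num))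
    simpa using this.const_mul (2 ^ k : ℝ)
  refine tendsto_of_tendsto_of_tendsto_of_le_of_le' tendsto_const_nhds h1 ?_ ?_
  · filter_upwards [eventually_ge_atTop 0] with v hv using poissonTail_nonneg k hv
  · filter_upwards [eventually_ge_atTop 0] with v hv using poissonTail_le k hv

/-- The density of the Erlang law with shape `k`. -/
def erlangDensity (k : ℕ) (v : ℝ) : ℝ := Real.exp (-v) * v ^ (k - 1) / ((k - 1).factorial : ℝ)

lemma measurable_erlangDensity (k : ℕ) : Measurable (erlangDensity k) := by
  unfold erlangDensity; fun_prop

/-- The Erlang law with shape `k`. -/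
def erlang (k : ℕ) : Measure ℝ :=
  (volume.restrict (Set.Ioi 0)).withDensity fun v => ENNReal.ofReal (erlangDensity k v)

/-- The k-th point of a unit rate Poisson process lies beyond v when fewer than k points fall below
v. Analytically, the Poisson tail is a primitive of minus the Erlang density and vanishes at
infinity. -/
lemma erlang_Ioi {k : ℕ} (hk : 1 ≤ k) {v : ℝ} (hv : 0 ≤ v) :
    erlang k (Set.Ioi v) = ENNReal.ofReal (poissonTail k v) := by
  obtain ⟨j, rfl⟩ : ∃ j, k = j + 1 := ⟨k - 1, by omega⟩
  have hd : ∀ t ∈ Set.Ici v, HasDerivAt (fun t => -poissonTail (j + 1) t)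
      (erlangDensity (j + 1) t) t := fun t _ => by
    refine (hasDerivAt_poissonTail j t).fun_neg.congr_deriv ?_
    simp [erlangDensity]
  have hnn : ∀ t ∈ Set.Ioi v, 0 ≤ erlangDensity (j + 1) t := fun t ht => by
    have : 0 < t := hv.trans_lt ht
    unfold erlangDensity; positivity
  have ht : Tendsto (fun t => -poissonTail (j + 1) t) atTop (𝓝 0) := by
    simpa using (tendsto_poissonTail (j + 1)).neg
  have hint := integrableOn_Ioi_deriv_of_nonneg' hd hnn ht
  have hval := integral_Ioi_of_hasDerivAt_of_nonneg' hd hnn ht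
  rw [erlang, withDensity_apply _ measurableSet_Ioi, Measure.restrict_restrict measurableSet_Ioi,
    Set.inter_eq_left.2 (Set.Ioi_subset_Ioi hv),
    ← ofReal_integral_eq_lintegral_ofReal hint (ae_restrict_of_forall_mem measurableSet_Ioi hnn),
    hval]
  simp

lemma erlang_univ {k : ℕ} (hk : 1 ≤ k) : erlang k Set.univ = 1 := by
  have h := erlang_Ioi hk le_rfl
  rw [poissonTail_zero hk, ENNReal.ofReal_one] at h
  rw [← h, erlang, withDensity_apply _ MeasurableSet.univ, withDensity_apply _ measurableSet_Ioi,
    Measure.restrict_univ, Measure.restrict_restrict measurableSet_Ioi, Set.inter_self]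

/-! ### The law of the mass of the `k`-nearest neighbour ball -/

section KnnLaw

variable {d : ℕ} {Ω : Type*} [MeasurableSpace Ω] {P : Measure Ω}
  {η : Ω → FiniteConfig (FlatTorus d)} {K : Measure (FlatTorus d)} [IsProbabilityMeasure K]

lemma measurable_knnMass_apply (hη : Measurable η) (K : Measure (FlatTorus d)) [SFinite K] (k : ℕ)
    (x : FlatTorus d) : Measurable fun ω => knnMass K k x (η ω).1 := by
  have h : Measurable fun ω => (x, η ω) := measurable_const.prodMk hη
  have h' := (measurable_knnMass K k).comp h
  exact h'

lemma IsPoissonProcess.measure_lt {μ : Measure (FlatTorus d)} [IsFiniteMeasure μ]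
    (h : IsPoissonProcess (fun ω => (η ω).1) μ P) {B : Set (FlatTorus d)}
    (hB : MeasurableSet B) (k : ℕ) :
    P {ω | (η ω).1 B < k} = ENNReal.ofReal (poissonTail k (μ.real B)) := by
  rw [Measure.real, ← poissonLaw_Iio (measure_ne_top _ _), ← h.law B hB,
    Measure.map_apply (f := fun ω => (η ω).1 B)
      ((Measure.measurable_coe hB).comp h.measurable) measurableSet_Iio]
  rfl

/-- The event says that the ball of mass v/n has fewer than k points apart from x. Its intensity is
v whatever the position x and the density. -/
lemma measure_lt_knnMass {n k : ℕ} (h : IsPoissonProcess (fun ω => (η ω).1) ((n : ℝ≥0∞) • K) P)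
    {x : FlatTorus d} (hK : ∀ r, K (Metric.sphere x r) = 0) {v : ℝ} (hv : 0 < v) (hvn : v < n) :
    P {ω | v < n * (knnMass K k x (η ω).1).toReal} = ENNReal.ofReal (poissonTail k v) := by
  have hn : (0 : ℝ) < n := hv.trans hvn
  have hu : 0 < v / n := by positivity
  have hu1 : v / n < 1 := (div_lt_one hn).2 hvn
  have e : {ω | v < n * (knnMass K k x (η ω).1).toReal} =
      {ω | (η ω).1 (Metric.closedBall x (massRadius K x (v / n)) \ {x}) < k} := by
    ext ω
    simp only [Set.mem_ofPred_eq]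
    rw [← lt_knnMass_iff hK hu hu1, div_lt_iff₀' hn]
  have : IsFiniteMeasure ((n : ℝ≥0∞) • K) := ⟨by simp [ENNReal.natCast_lt_top]⟩
  rw [e, h.measure_lt (measurableSet_closedBall_sdiff _ _)]
  congr 2
  have h0 : K {x} = 0 := by simpa [Metric.sphere_zero] using hK 0
  rw [Measure.real, Measure.smul_apply, measure_sdiff_null h0, smul_eq_mul, ENNReal.toReal_mul,
    ← Measure.real, (massRadius_spec hK hu hu1).2.1]
  simp only [ENNReal.toReal_natCast]
  field_simp

/-- The tails agree for every level below n by `measure_lt_knnMass` and `erlang_Ioi`. The truncation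
at n reflects that no ball has mass above one. -/
lemma map_knnMass [IsProbabilityMeasure P] {n k : ℕ} (hn : 0 < n) (hk : 1 ≤ k) (hη : Measurable η)
    (h : IsPoissonProcess (fun ω => (η ω).1) ((n : ℝ≥0∞) • K) P)
    {x : FlatTorus d} (hK : ∀ r, K (Metric.sphere x r) = 0) :
    P.map (fun ω => (n : ℝ) * (knnMass K k x (η ω).1).toReal) =
      (erlang k).map fun v => min v (n : ℝ) := by
  have hm : Measurable fun ω => (n : ℝ) * (knnMass K k x (η ω).1).toReal :=
    (measurable_knnMass_apply hη K k x).ennreal_toReal.const_mul _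
  have hm' : Measurable fun v : ℝ => min v (n : ℝ) := measurable_id.min measurable_const
  have hprob : IsProbabilityMeasure (erlang k) := ⟨erlang_univ hk⟩
  have h1 : IsProbabilityMeasure (P.map fun ω => (n : ℝ) * (knnMass K k x (η ω).1).toReal) :=
    Measure.isProbabilityMeasure_map hm.aemeasurable
  have h2 : IsProbabilityMeasure ((erlang k).map fun v => min v (n : ℝ)) :=
    Measure.isProbabilityMeasure_map hm'.aemeasurable
  have hn' : (0 : ℝ) < n := by exact_mod_cast hn
  have key : ∀ v : ℝ, 0 < v → (P.map fun ω => (n : ℝ) * (knnMass K k x (η ω).1).toReal) (Set.Ioi v) =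
      ((erlang k).map fun v => min v (n : ℝ)) (Set.Ioi v) := by
    intro v hv
    rw [Measure.map_apply hm measurableSet_Ioi, Measure.map_apply hm' measurableSet_Ioi]
    rcases lt_or_ge v n with hvn | hvn
    · have e1 : (fun v => min v (n : ℝ)) ⁻¹' Set.Ioi v = Set.Ioi v := by
        ext t; simp [hvn]
      rw [e1, erlang_Ioi hk hv.le, ← measure_lt_knnMass h hK hv hvn]
      rfl
    · have e1 : (fun v => min v (n : ℝ)) ⁻¹' Set.Ioi v = ∅ := by
        ext t; simp [hvn]
      have e2 : (fun ω => (n : ℝ) * (knnMass K k x (η ω).1).toReal) ⁻¹' Set.Ioi v = ∅ := by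
        ext ω
        simp only [Set.mem_preimage, Set.mem_Ioi, Set.mem_empty_iff_false, iff_false, not_lt]
        refine le_trans ?_ hvn
        have : (knnMass K k x (η ω).1).toReal ≤ 1 :=
          ENNReal.toReal_le_of_le_ofReal zero_le_one (by simpa using knnMass_le_one K k x _)
        nlinarith
      rw [e1, e2, measure_empty, measure_empty]
  -- The tail formula needs v > 0; the value at 0 follows by monotone limits, and for v ≤ 0 both
  -- tails are then forced to be 1.
  have hIoi0 : (P.map fun ω => (n : ℝ) * (knnMass K k x (η ω).1).toReal) (Set.Ioi 0) =
      ((erlang k).map fun v => min v (n : ℝ)) (Set.Ioi 0) := by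
    have hU : Set.Ioi (0 : ℝ) = ⋃ m : ℕ, Set.Ioi (1 / ((m : ℝ) + 1)) := by
      ext t
      simp only [Set.mem_Ioi, Set.mem_iUnion]
      refine ⟨fun ht => exists_nat_one_div_lt ht, fun ⟨m, hm⟩ => lt_trans (by positivity) hm⟩
    have hmono : Monotone fun m : ℕ => Set.Ioi (1 / ((m : ℝ) + 1)) := fun a b hab =>
      Set.Ioi_subset_Ioi (one_div_le_one_div_of_le (by positivity) (by gcongr))
    rw [hU, hmono.measure_iUnion, hmono.measure_iUnion]
    congr 1 with m
    exact key _ (by positivity)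
  have hone : ((erlang k).map fun v => min v (n : ℝ)) (Set.Ioi 0) = 1 := by
    rw [Measure.map_apply hm' measurableSet_Ioi]
    have e1 : (fun v => min v (n : ℝ)) ⁻¹' Set.Ioi 0 = Set.Ioi 0 := by
      ext t; simp [hn]
    rw [e1, erlang_Ioi hk le_rfl, poissonTail_zero hk, ENNReal.ofReal_one]
  have hall : ∀ v : ℝ, (P.map fun ω => (n : ℝ) * (knnMass K k x (η ω).1).toReal) (Set.Ioi v) =
      ((erlang k).map fun v => min v (n : ℝ)) (Set.Ioi v) := by
    intro v
    rcases lt_or_ge 0 v with hv | hv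
    · exact key v hv
    · have g1 := measure_mono (μ := P.map fun ω => (n : ℝ) * (knnMass K k x (η ω).1).toReal)
        (Set.Ioi_subset_Ioi hv)
      have g2 := measure_mono (μ := (erlang k).map fun v => min v (n : ℝ)) (Set.Ioi_subset_Ioi hv)
      rw [hIoi0, hone] at g1
      rw [hone] at g2
      exact (le_antisymm prob_le_one g1).trans (le_antisymm prob_le_one g2).symm
  refine Measure.ext_of_Iic _ _ fun v => ?_
  rw [← Set.compl_Ioi, prob_compl_eq_one_sub measurableSet_Ioi, prob_compl_eq_one_sub measurableSet_Ioi,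
    hall]

end KnnLaw

/-! ### The point process of large nearest neighbour balls -/

section KnnConfig

variable {d : ℕ}

/-- The centred mass of the `k`-nearest neighbour ball. -/
def knnLevel (K : Measure (FlatTorus d)) (n k : ℕ) (ω : Measure (FlatTorus d)) (x : FlatTorus d) :
    ℝ := (n : ℝ) * (knnMass K k x ω).toReal - knnCentring n k

lemma measurable_knnLevel (K : Measure (FlatTorus d)) [SFinite K] (n k : ℕ) :
    Measurable fun p : FlatTorus d × FiniteConfig (FlatTorus d) => knnLevel K n k p.2.1 p.1 :=
  ((measurable_knnMass K k).ennreal_toReal.const_mul _).sub_const _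

lemma measurable_knnLevel_right (K : Measure (FlatTorus d)) [SFinite K] (n k : ℕ)
    (ω : FiniteConfig (FlatTorus d)) : Measurable (knnLevel K n k ω.1) := by
  have h : Measurable fun x : FlatTorus d => (x, ω) := measurable_prodMk_right
  have h' := (measurable_knnLevel K n k).comp h
  exact h'

lemma measurable_knnPoint (K : Measure (FlatTorus d)) [SFinite K] (n k : ℕ)
    (ω : FiniteConfig (FlatTorus d)) : Measurable fun x => (x, knnLevel K n k ω.1 x) :=
  measurable_id.prodMk (measurable_knnLevel_right K n k ω)

/-- A point is not its own neighbour, so the point inserted by the Mecke formula can be dropped and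
the level evaluated at a deterministic x. -/
lemma knnLevel_add_dirac (K : Measure (FlatTorus d)) (n k : ℕ) (ω : FiniteConfig (FlatTorus d))
    (x : FlatTorus d) : knnLevel K n k (ω + .dirac x).1 x = knnLevel K n k ω.1 x := by
  rw [knnLevel, knnLevel, knnMass_add_dirac]

/-- `knnProcess`, as a map between spaces of finite counting measures. -/
def knnConfig (K : Measure (FlatTorus d)) [SFinite K] (n k : ℕ) (ω : FiniteConfig (FlatTorus d)) :
    FiniteConfig (FlatTorus d × ℝ) := ω.map (measurable_knnPoint K n k ω)

variable (K : Measure (FlatTorus d)) [IsProbabilityMeasure K] (n k : ℕ)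

lemma coe_knnConfig (ω : FiniteConfig (FlatTorus d)) :
    (knnConfig K n k ω).1 = knnProcess K n k ω.1 := rfl

lemma knnConfig_apply (ω : FiniteConfig (FlatTorus d)) {A : Set (FlatTorus d × ℝ)}
    (hA : MeasurableSet A) : (knnConfig K n k ω).1 A = ω.1 {x | (x, knnLevel K n k ω.1 x) ∈ A} :=
  Measure.map_apply (measurable_knnPoint K n k ω) hA

lemma measurable_knnConfig : Measurable (knnConfig K n k) := by
  have h : Measurable fun p : FiniteConfig (FlatTorus d) × FlatTorus d =>
      (p.2, knnLevel K n k p.1.1 p.2) := by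
    have h' : Measurable fun p : FiniteConfig (FlatTorus d) × FlatTorus d => p.swap :=
      measurable_swap
    have h'' := (measurable_knnLevel K n k).comp h'
    exact measurable_snd.prodMk h''
  exact FiniteConfig.measurable_map (g := fun ω => ω) measurable_id h

/-- The first moment of functionals of the nearest neighbour process. -/
lemma lintegral_knnConfig {Ω : Type*} [MeasurableSpace Ω] {P : Measure Ω} [IsProbabilityMeasure P]
    {η : Ω → FiniteConfig (FlatTorus d)} (hη : Measurable η) {μ : Measure (FlatTorus d)}
    [IsFiniteMeasure μ] (h : IsPoissonProcess (fun ω => (η ω).1) μ P)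
    {f : FlatTorus d × ℝ → ℝ≥0∞} (hf : Measurable f) :
    ∫⁻ ω, ∫⁻ y, f y ∂(knnConfig K n k (η ω)).1 ∂P =
      ∫⁻ x, ∫⁻ ω, f (x, knnLevel K n k (η ω).1 x) ∂P ∂μ := by
  have hF : Measurable fun p : FlatTorus d × FiniteConfig (FlatTorus d) =>
      f (p.1, knnLevel K n k p.2.1 p.1) :=
    hf.comp (measurable_fst.prodMk (measurable_knnLevel K n k))
  have := h.mecke hη hF
  simp only [knnLevel_add_dirac] at this
  rw [← this]
  exact lintegral_congr fun ω => lintegral_map hf (measurable_knnPoint K n k (η ω))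

lemma lintegral_comp_knnLevel {n k : ℕ} (hn : 0 < n) (hk : 1 ≤ k) {Ω : Type*} [MeasurableSpace Ω]
    {P : Measure Ω} [IsProbabilityMeasure P] {η : Ω → FiniteConfig (FlatTorus d)}
    (hη : Measurable η) (h : IsPoissonProcess (fun ω => (η ω).1) ((n : ℝ≥0∞) • K) P)
    {x : FlatTorus d} (hK : ∀ r, K (Metric.sphere x r) = 0) {f : ℝ → ℝ≥0∞} (hf : Measurable f) :
    ∫⁻ ω, f (knnLevel K n k (η ω).1 x) ∂P =
      ∫⁻ v, f (min v n - knnCentring n k) ∂(erlang k) := by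
  have hm : Measurable fun ω => (n : ℝ) * (knnMass K k x (η ω).1).toReal :=
    (measurable_knnMass_apply hη K k x).ennreal_toReal.const_mul _
  have hm' : Measurable fun v : ℝ => min v (n : ℝ) := measurable_id.min measurable_const
  have hf' : Measurable fun v => f (v - knnCentring n k) := hf.comp (measurable_id.sub_const _)
  rw [← lintegral_map hf' hm', ← map_knnMass hn hk hη h hK, lintegral_map hf' hm]
  rfl

end KnnConfig

/-! ### The limit of the Erlang law -/

section ErlangLimit

/-- The ratio of the density of the centred Erlang law, times `n`, and of its limit. -/
def knnRatio (n k : ℕ) (t : ℝ) : ℝ := ((knnCentring n k + t) / Real.log n) ^ (k - 1)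

/-- The centring is made for this identity: n e^{-a_n} (log n)^{k-1} / (k-1)! = 1. -/
lemma exp_neg_knnCentring {n k : ℕ} (hn : 2 ≤ n) (hk : 1 ≤ k) :
    Real.exp (-(knnCentring n k)) = ((k - 1).factorial : ℝ) / (n * Real.log n ^ (k - 1)) := by
  have hn0 : (0 : ℝ) < n := by positivity
  have hL : 0 < Real.log n := Real.log_pos (by exact_mod_cast hn)
  have hf : (0 : ℝ) < ((k - 1).factorial : ℝ) := by positivity
  have : -(knnCentring n k) = Real.log ((k - 1).factorial : ℝ) -
      (Real.log n + ((k - 1 : ℕ) : ℝ) * Real.log (Real.log n)) := by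
    rw [knnCentring, Nat.cast_sub hk, Nat.cast_one]; ring
  rw [this, Real.exp_sub, Real.exp_add, Real.exp_log hf, Real.exp_log hn0, Real.exp_nat_mul,
    Real.exp_log hL]

lemma mul_erlangDensity {n k : ℕ} (hn : 2 ≤ n) (hk : 1 ≤ k) (t : ℝ) :
    n * erlangDensity k (knnCentring n k + t) = Real.exp (-t) * knnRatio n k t := by
  have hn0 : (0 : ℝ) < n := by positivity
  have hL : 0 < Real.log n := Real.log_pos (by exact_mod_cast hn)
  have hf : (0 : ℝ) < ((k - 1).factorial : ℝ) := by positivity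
  rw [erlangDensity, knnRatio, neg_add, Real.exp_add, exp_neg_knnCentring hn hk, div_pow]
  field_simp

/-- The total variation error of the intensity of the nearest neighbour process above level `b`. -/
def erlangError (n k : ℕ) (b : ℝ) : ℝ≥0∞ :=
  n * ENNReal.ofReal (poissonTail k n) +
    ∫⁻ t in Set.Ioi b, ENNReal.ofReal (Real.exp (-t) * |knnRatio n k t - 1|)

lemma measurable_knnRatio (n k : ℕ) : Measurable (knnRatio n k) := by
  unfold knnRatio; fun_prop

/-- This is the translation v = t + a_n. The assumption on b keeps the region t > b inside the
support v > 0 of the Erlang law. -/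
lemma lintegral_shift_erlang {n k : ℕ} (hn : 2 ≤ n) (hk : 1 ≤ k) {b : ℝ}
    (hb : 0 ≤ knnCentring n k + b) {f : ℝ → ℝ≥0∞} (hf : Measurable f) :
    n * ∫⁻ v, (Set.Ioi b).indicator f (v - knnCentring n k) ∂(erlang k) =
      ∫⁻ t in Set.Ioi b, f t * ENNReal.ofReal (Real.exp (-t) * knnRatio n k t) := by
  have hI : Measurable ((Set.Ioi b).indicator f) := hf.indicator measurableSet_Ioi
  have hd : Measurable fun v => ENNReal.ofReal (erlangDensity k v) :=
    (measurable_erlangDensity k).ennreal_ofReal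
  have hI' : Measurable fun v => (Set.Ioi b).indicator f (v - knnCentring n k) :=
    hI.comp (measurable_id.sub_const _)
  rw [erlang, lintegral_withDensity_eq_lintegral_mul _ hd hI', ← lintegral_indicator measurableSet_Ioi,
    ← lintegral_add_right_eq_self _ (knnCentring n k), ← lintegral_indicator measurableSet_Ioi,
    ← lintegral_const_mul' _ _ (by simp)]
  refine lintegral_congr fun t => ?_
  by_cases ht : t ∈ Set.Ioi b
  · have ht' : t + knnCentring n k ∈ Set.Ioi 0 := by
      have : b < t := ht
      simp only [Set.mem_Ioi]; linarith
    rw [Set.indicator_of_mem ht', Set.indicator_of_mem ht, Pi.mul_apply, add_sub_cancel_right,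
      Set.indicator_of_mem ht, ← mul_assoc, mul_comm (f t), ← mul_erlangDensity hn hk,
      ENNReal.ofReal_mul (by positivity), ENNReal.ofReal_natCast, add_comm]
  · rw [Set.indicator_of_notMem ht]
    by_cases ht' : t + knnCentring n k ∈ Set.Ioi 0
    · rw [Set.indicator_of_mem ht', Pi.mul_apply, add_sub_cancel_right, Set.indicator_of_notMem ht]
      simp
    · rw [Set.indicator_of_notMem ht', mul_zero]

/-- Two functions that agree up to n differ in mean by at most the Erlang mass beyond n. This
removes or restores the truncation at n. -/
lemma lintegral_erlang_le_add {n k : ℕ} (hk : 1 ≤ k) {f g : ℝ → ℝ≥0∞} (hf : Measurable f)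
    (hfg : ∀ v : ℝ, v ≤ n → g v = f v) (hg : ∀ v, g v ≤ 1) :
    n * ∫⁻ v, g v ∂(erlang k) ≤ n * ∫⁻ v, f v ∂(erlang k) +
      n * ENNReal.ofReal (poissonTail k n) := by
  rw [← erlang_Ioi hk (Nat.cast_nonneg n), ← mul_add]
  gcongr
  rw [← lintegral_indicator_one measurableSet_Ioi, ← lintegral_add_left hf]
  refine lintegral_mono fun v => ?_
  rcases le_or_gt v n with hv | hv
  · rw [hfg v hv]; exact le_self_add
  · rw [Set.indicator_of_mem (show v ∈ Set.Ioi (n : ℝ) from hv)]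
    exact (hg v).trans le_add_self

/-- Together with `le_lintegral_erlang`, this is a total variation bound between intensities, tested
on all f with values in [0, 1]. The two parts of `erlangError` pay for the truncation and for the
density ratio. -/
lemma lintegral_erlang_le {n k : ℕ} (hn : 2 ≤ n) (hk : 1 ≤ k) {b : ℝ}
    (hb : 0 ≤ knnCentring n k + b) {f : ℝ → ℝ≥0∞} (hf : Measurable f) (hf1 : ∀ t, f t ≤ 1) :
    n * ∫⁻ v, (Set.Ioi b).indicator f (min v n - knnCentring n k) ∂(erlang k) ≤
      (∫⁻ t in Set.Ioi b, f t * ENNReal.ofReal (Real.exp (-t))) + erlangError n k b := by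
  have hI : Measurable ((Set.Ioi b).indicator f) := hf.indicator measurableSet_Ioi
  have hI1 : ∀ t, (Set.Ioi b).indicator f t ≤ 1 := fun t =>
    (Set.indicator_le_self _ _ t).trans (hf1 t)
  refine (lintegral_erlang_le_add hk
    (f := fun v => (Set.Ioi b).indicator f (v - knnCentring n k))
    (hI.comp (measurable_id.sub_const _)) (fun v hv => by rw [min_eq_left hv])
    fun v => hI1 _).trans ?_
  rw [lintegral_shift_erlang hn hk hb hf, erlangError, add_left_comm, add_comm]
  gcongr
  rw [← lintegral_add_left (by fun_prop)]
  refine lintegral_mono fun t => ?_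
  have h1 : ENNReal.ofReal (Real.exp (-t) * knnRatio n k t) ≤ ENNReal.ofReal (Real.exp (-t)) +
      ENNReal.ofReal (Real.exp (-t) * |knnRatio n k t - 1|) := by
    rw [← ENNReal.ofReal_add (by positivity) (by positivity)]
    refine ENNReal.ofReal_le_ofReal ?_
    nlinarith [le_abs_self (knnRatio n k t - 1), Real.exp_pos (-t)]
  calc f t * ENNReal.ofReal (Real.exp (-t) * knnRatio n k t)
      ≤ f t * (ENNReal.ofReal (Real.exp (-t)) +
        ENNReal.ofReal (Real.exp (-t) * |knnRatio n k t - 1|)) := by gcongr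
    _ ≤ _ := by
        rw [mul_add]
        gcongr
        exact (mul_le_mul_left (hf1 t) _).trans_eq (one_mul _)

lemma le_lintegral_erlang {n k : ℕ} (hn : 2 ≤ n) (hk : 1 ≤ k) {b : ℝ}
    (hb : 0 ≤ knnCentring n k + b) {f : ℝ → ℝ≥0∞} (hf : Measurable f) (hf1 : ∀ t, f t ≤ 1) :
    (∫⁻ t in Set.Ioi b, f t * ENNReal.ofReal (Real.exp (-t))) ≤
      n * ∫⁻ v, (Set.Ioi b).indicator f (min v n - knnCentring n k) ∂(erlang k) +
        erlangError n k b := by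
  have hI : Measurable ((Set.Ioi b).indicator f) := hf.indicator measurableSet_Ioi
  have hI1 : ∀ t, (Set.Ioi b).indicator f t ≤ 1 := fun t =>
    (Set.indicator_le_self _ _ t).trans (hf1 t)
  have h0 := lintegral_erlang_le_add (n := n) hk
    (f := fun v => (Set.Ioi b).indicator f (min v n - knnCentring n k))
    (g := fun v => (Set.Ioi b).indicator f (v - knnCentring n k))
    (hI.comp ((measurable_id.min measurable_const).sub_const _))
    (fun v hv => by rw [min_eq_left hv]) (fun v => hI1 _)
  rw [lintegral_shift_erlang hn hk hb hf] at h0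
  rw [erlangError, ← add_assoc]
  refine le_trans ?_ (add_le_add_left h0 _)
  rw [← lintegral_add_left (by have := measurable_knnRatio n k; fun_prop)]
  refine lintegral_mono fun t => ?_
  have h1 : ENNReal.ofReal (Real.exp (-t)) ≤ ENNReal.ofReal (Real.exp (-t) * knnRatio n k t) +
      ENNReal.ofReal (Real.exp (-t) * |knnRatio n k t - 1|) := by
    refine le_trans (ENNReal.ofReal_le_ofReal ?_) ENNReal.ofReal_add_le
    nlinarith [neg_le_abs (knnRatio n k t - 1), Real.exp_pos (-t)]
  calc f t * ENNReal.ofReal (Real.exp (-t))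
      ≤ f t * (ENNReal.ofReal (Real.exp (-t) * knnRatio n k t) +
        ENNReal.ofReal (Real.exp (-t) * |knnRatio n k t - 1|)) := by gcongr
    _ ≤ _ := by
        rw [mul_add]
        gcongr
        exact (mul_le_mul_left (hf1 t) _).trans_eq (one_mul _)

end ErlangLimit

/-! ### Second factorial moments -/

namespace IsPoissonProcess

variable {Ω X : Type*} [MeasurableSpace Ω] [MeasurableSpace X] {μ : Measure X} {P : Measure Ω}
  {η : Ω → FiniteConfig X}

/-- The Campbell formula. -/
lemma lintegral_lintegral (h : IsPoissonProcess (fun ω => (η ω).1) μ P) (hη : Measurable η)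
    [IsFiniteMeasure μ] [IsProbabilityMeasure P] {f : X → ℝ≥0∞} (hf : Measurable f) :
    ∫⁻ ω, ∫⁻ x, f x ∂(η ω).1 ∂P = ∫⁻ x, f x ∂μ := by
  simpa using h.mecke hη (f := fun p => f p.1) (hf.comp measurable_fst)

/-- The second factorial moment of the number of points selected by a decreasing rule. -/
lemma lintegral_selected_pairs_le (h : IsPoissonProcess (fun ω => (η ω).1) μ P) (hη : Measurable η)
    [IsFiniteMeasure μ] [IsProbabilityMeasure P] {E : Set (X × FiniteConfig X)}
    (hE : MeasurableSet E) (hself : ∀ x ω, (x, ω + .dirac x) ∈ E ↔ (x, ω) ∈ E)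
    (hmono : ∀ x y ω, (y, ω + .dirac x) ∈ E → (y, ω) ∈ E) :
    ∫⁻ ω, (η ω).1 {x | (x, η ω) ∈ E} * ((η ω).1 {x | (x, η ω) ∈ E} - 1) ∂P ≤
      ∫⁻ x, ∫⁻ y, P {ω | (x, η ω) ∈ E ∧ (y, η ω) ∈ E} ∂μ ∂μ := by
  have hsec : ∀ ω : FiniteConfig X, MeasurableSet {x | (x, ω) ∈ E} := fun ω =>
    measurable_prodMk_right hE
  have hcm : Measurable fun ω : FiniteConfig X => ω.1 {x | (x, ω) ∈ E} :=
    FiniteConfig.measurable_measure (g := fun ω : FiniteConfig X => ω) measurable_id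
      (measurable_swap hE)
  set c : FiniteConfig X → ℝ≥0∞ := fun ω => ω.1 {x | (x, ω) ∈ E} with hc
  have hF : Measurable fun p : X × FiniteConfig X => E.indicator 1 p * (c p.2 - 1) :=
    (measurable_one.indicator hE).mul ((hcm.comp measurable_snd).sub_const _)
  -- The Mecke formula is used twice. The first use singles out a selected point x; subtracting 1
  -- cancels its own count, and by `hself` and `hmono` it can be deleted when selecting the others.
  -- The second use does the same for y.
  calc ∫⁻ ω, (η ω).1 {x | (x, η ω) ∈ E} * ((η ω).1 {x | (x, η ω) ∈ E} - 1) ∂P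
      = ∫⁻ ω, ∫⁻ x, E.indicator 1 (x, η ω) * (c (η ω) - 1) ∂(η ω).1 ∂P := by
        refine lintegral_congr fun ω => ?_
        have e : ∀ x, E.indicator (1 : X × FiniteConfig X → ℝ≥0∞) (x, η ω) =
            {x | (x, η ω) ∈ E}.indicator 1 x := fun x => by
            by_cases hx : (x, η ω) ∈ E
            · rw [Set.indicator_of_mem hx, Set.indicator_of_mem (show x ∈ {x | (x, η ω) ∈ E} from hx)]
              rfl
            · rw [Set.indicator_of_notMem hx,
                Set.indicator_of_notMem (show x ∉ {x | (x, η ω) ∈ E} from hx)]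
        simp only [e]
        rw [lintegral_mul_const _ (measurable_one.indicator (hsec _)),
          lintegral_indicator_one (hsec _)]
    _ = ∫⁻ x, ∫⁻ ω, E.indicator 1 (x, η ω + .dirac x) * (c (η ω + .dirac x) - 1) ∂P ∂μ :=
        h.mecke hη hF
    _ ≤ ∫⁻ x, ∫⁻ ω, ∫⁻ y, E.indicator 1 (x, η ω) * E.indicator 1 (y, η ω) ∂(η ω).1 ∂P ∂μ := by
        refine lintegral_mono fun x => lintegral_mono fun ω => ?_
        by_cases hx : (x, η ω) ∈ E
        · have e : ∀ y, E.indicator (1 : X × FiniteConfig X → ℝ≥0∞) (y, η ω) =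
            {x | (x, η ω) ∈ E}.indicator 1 y := fun x => by
            by_cases hx : (x, η ω) ∈ E
            · rw [Set.indicator_of_mem hx, Set.indicator_of_mem (show x ∈ {x | (x, η ω) ∈ E} from hx)]
              rfl
            · rw [Set.indicator_of_notMem hx,
                Set.indicator_of_notMem (show x ∉ {x | (x, η ω) ∈ E} from hx)]
          simp only [Set.indicator_of_mem hx, Set.indicator_of_mem ((hself x _).2 hx), e, Pi.one_apply,
            one_mul]
          rw [lintegral_indicator_one (hsec _)]
          have e1 : c (η ω + .dirac x) = (η ω).1 {y | (y, η ω + .dirac x) ∈ E} + 1 := by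
            simp only [hc, FiniteConfig.coe_add, Measure.add_apply, FiniteConfig.coe_dirac]
            rw [Measure.dirac_apply' _ (hsec _), Set.indicator_of_mem (by simpa [hself] using hx)]
            rfl
          rw [e1, ENNReal.add_sub_cancel_right (by simp)]
          exact measure_mono fun y hy => hmono x y _ hy
        · rw [Set.indicator_of_notMem (by rwa [hself]), zero_mul]
          exact zero_le
    _ = ∫⁻ x, ∫⁻ y, ∫⁻ ω, E.indicator 1 (x, η ω + .dirac y) *
          E.indicator 1 (y, η ω + .dirac y) ∂P ∂μ ∂μ := by
        refine lintegral_congr fun x => ?_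
        have hx : Measurable fun p : X × FiniteConfig X => (x, p.2) :=
          measurable_const.prodMk measurable_snd
        exact h.mecke hη (f := fun p => E.indicator 1 (x, p.2) * E.indicator 1 p)
          (((measurable_one.indicator hE).comp hx).mul (measurable_one.indicator hE))
    _ ≤ _ := by
        refine lintegral_mono fun x => lintegral_mono fun y => ?_
        have hm : ∀ z, MeasurableSet {ω | (z, η ω) ∈ E} := fun z =>
          (measurable_const.prodMk hη) hE
        change _ ≤ P ({ω | (x, η ω) ∈ E} ∩ {ω | (y, η ω) ∈ E})
        rw [← lintegral_indicator_one ((hm x).inter (hm y))]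
        refine lintegral_mono fun ω => ?_
        by_cases h1 : (x, η ω + .dirac y) ∈ E
        · by_cases h2 : (y, η ω + .dirac y) ∈ E
          · have h3 : ω ∈ {ω | (x, η ω) ∈ E} ∩ {ω | (y, η ω) ∈ E} :=
              ⟨hmono _ _ _ h1, hmono _ _ _ h2⟩
            rw [Set.indicator_of_mem h1, Set.indicator_of_mem h2, Set.indicator_of_mem h3]
            simp
          · simp [h2]
        · simp [h1]

lemma lintegral_pairCount (h : IsPoissonProcess (fun ω => (η ω).1) μ P) (hη : Measurable η)
    [IsFiniteMeasure μ] [IsProbabilityMeasure P] :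
    ∫⁻ ω, (η ω).pairCount ∂P ≤ μ Set.univ ^ 2 := by
  have := h.lintegral_selected_pairs_le hη (E := Set.univ) MeasurableSet.univ (by simp) (by simp)
  simpa [FiniteConfig.pairCount, sq] using this

/-- Two disjoint regions are independently poor in points. -/
lemma measure_lt_inter (h : IsPoissonProcess (fun ω => (η ω).1) μ P)
    {A B : Set X} (hA : MeasurableSet A) (hB : MeasurableSet B)
    (hAB : Disjoint A B) (k : ℕ) :
    P {ω | (η ω).1 A < k ∧ (η ω).1 B < k} = P {ω | (η ω).1 A < k} * P {ω | (η ω).1 B < k} := by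
  have hi : iIndepFun (fun i ω => (η ω).1 (![A, B] i)) P := by
    refine h.indep 2 ![A, B] (fun i => by fin_cases i <;> simpa) fun i j hij => ?_
    fin_cases i <;> fin_cases j <;> first | exact absurd rfl hij | simpa using hAB | simpa using hAB.symm
  have h01 := hi.indepFun (show (0 : Fin 2) ≠ 1 by decide)
  exact indepFun_iff_measure_inter_preimage_eq_mul.1 h01 (Set.Iio k) (Set.Iio k) measurableSet_Iio
    measurableSet_Iio

end IsPoissonProcess

/-! ### Exceedances -/

section Exceed

variable {d : ℕ}

/-- The ball around `x` which has less than `k` points besides `x` when `x` exceeds level `b`. -/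
def levelBall (K : Measure (FlatTorus d)) (n k : ℕ) (b : ℝ) (x : FlatTorus d) :
    Set (FlatTorus d) := Metric.closedBall x (massRadius K x ((knnCentring n k + b) / n))

lemma measurableSet_levelBall (K : Measure (FlatTorus d)) (n k : ℕ) (b : ℝ) (x : FlatTorus d) :
    MeasurableSet (levelBall K n k b x) := measurableSet_closedBall

variable {K : Measure (FlatTorus d)} {n k : ℕ} {b : ℝ}

section Level

variable [IsProbabilityMeasure K] (hK : ∀ x r, K (Metric.sphere x r) = 0) (hv : 0 < knnCentring n k + b)
  (hvn : knnCentring n k + b < n)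

include hK hv hvn

lemma lt_knnLevel_iff {x : FlatTorus d} {ω : Measure (FlatTorus d)} [IsFiniteMeasure ω] :
    b < knnLevel K n k ω x ↔ ω (levelBall K n k b x \ {x}) < k := by
  have hn : (0 : ℝ) < n := hv.trans hvn
  rw [levelBall, ← lt_knnMass_iff (hK x) (div_pos hv hn) ((div_lt_one hn).2 hvn),
    div_lt_iff₀' hn, knnLevel, lt_sub_iff_add_lt']

lemma measureReal_levelBall (x : FlatTorus d) :
    n * K.real (levelBall K n k b x) = knnCentring n k + b := by
  have hn : (0 : ℝ) < n := hv.trans hvn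
  rw [levelBall, (massRadius_spec (hK x) (div_pos hv hn) ((div_lt_one hn).2 hvn)).2.1]
  field_simp

end Level

lemma smul_real_sdiff_singleton (hK : ∀ x r, K (Metric.sphere x r) = 0) (x : FlatTorus d)
    (S : Set (FlatTorus d)) : ((n : ℝ≥0∞) • K).real (S \ {x}) = n * K.real S := by
  have h0 : K {x} = 0 := by simpa [Metric.sphere_zero] using hK x 0
  simp [Measure.real, measure_sdiff_null h0]

/-- Once the ball of radius r has k points, the nearest neighbour radius is at most r, so only
points inside O are consulted. -/
lemma knnMass_restrict {x : FlatTorus d} {r : ℝ} (hr : 0 < r) {O : Set (FlatTorus d)}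
    (hO : Metric.closedBall x r ⊆ O) {ω : Measure (FlatTorus d)}
    (hω : (k : ℝ≥0∞) ≤ ω (Metric.closedBall x r \ {x})) :
    knnMass K k x (ω.restrict O) = knnMass K k x ω := by
  have hle : ∀ s, s ≤ r → ω.restrict O (Metric.closedBall x s \ {x}) =
      ω (Metric.closedBall x s \ {x}) := fun s hs => by
    rw [Measure.restrict_apply (measurableSet_closedBall_sdiff x s), Set.inter_eq_left.2]
    exact Set.sdiff_subset.trans ((Metric.closedBall_subset_closedBall hs).trans hO)
  suffices knnRadius k x (ω.restrict O) = knnRadius k x ω by rw [knnMass, knnMass, this]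
  refine le_antisymm ?_ ?_
  · refine le_iInf fun s => le_iInf fun hs => le_iInf fun h => ?_
    rcases le_total s r with hsr | hsr
    · exact iInf_le_of_le s (iInf_le_of_le hs (iInf_le_of_le (by rwa [hle s hsr]) le_rfl))
    · exact iInf_le_of_le r (iInf_le_of_le hr (iInf_le_of_le (by rwa [hle r le_rfl])
        (ENNReal.ofReal_le_ofReal hsr)))
  · refine le_iInf fun s => le_iInf fun hs => le_iInf fun h => ?_
    exact iInf_le_of_le s (iInf_le_of_le hs (iInf_le_of_le
      (h.trans (Measure.restrict_le_self _)) le_rfl))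

instance isFiniteMeasure_natCast_smul {X : Type*} [MeasurableSpace X] (μ : Measure X)
    [IsFiniteMeasure μ] (n : ℕ) : IsFiniteMeasure ((n : ℝ≥0∞) • μ) :=
  ⟨by rw [Measure.smul_apply, smul_eq_mul]; finiteness⟩

/-- The process of exceedances of level `b` in `I`, computed from the points in `O`. -/
def blockConfig (K : Measure (FlatTorus d)) [SFinite K] (n k : ℕ) (b : ℝ) {I O : Set (FlatTorus d)}
    (hI : MeasurableSet I) (hO : MeasurableSet O) (ω : FiniteConfig (FlatTorus d)) :
    FiniteConfig (FlatTorus d × ℝ) :=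
  (knnConfig K n k (ω.restrict hO)).restrict (hI.prod (measurableSet_Ioi (a := b)))

variable [IsProbabilityMeasure K] {I O : Set (FlatTorus d)} (hI : MeasurableSet I) (hO : MeasurableSet O)

lemma measurable_blockConfig : Measurable (blockConfig K n k b hI hO) :=
  (FiniteConfig.measurable_restrict _).comp
    ((measurable_knnConfig K n k).comp (FiniteConfig.measurable_restrict hO))

variable {Ω : Type*} [MeasurableSpace Ω] {P : Measure Ω} [IsProbabilityMeasure P]
  {η : Ω → FiniteConfig (FlatTorus d)}

/-- This is the Mecke formula for the process restricted to O; only the points of I above level b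
are counted. -/
lemma lintegral_blockConfig (hη : Measurable η)
    (h : IsPoissonProcess (fun ω => (η ω).1) ((n : ℝ≥0∞) • K) P) (hsub : I ⊆ O)
    {f : FlatTorus d × ℝ → ℝ≥0∞} (hf : Measurable f) :
    ∫⁻ ω, ∫⁻ y, f y ∂(blockConfig K n k b hI hO (η ω)).1 ∂P =
      ∫⁻ x in I, n * ∫⁻ ω, (Set.Ioi b).indicator (fun t => f (x, t))
        (knnLevel K n k ((η ω).restrict hO).1 x) ∂P ∂K := by
  have hS : MeasurableSet (I ×ˢ Set.Ioi b) := hI.prod measurableSet_Ioi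
  have e := lintegral_knnConfig K n k (η := fun ω => (η ω).restrict hO)
    ((FiniteConfig.measurable_restrict hO).comp hη) (h.restrict hO) (hf.indicator hS)
  calc _ = ∫⁻ ω, ∫⁻ y, (I ×ˢ Set.Ioi b).indicator f y ∂(knnConfig K n k ((η ω).restrict hO)).1 ∂P :=
        lintegral_congr fun ω => (lintegral_indicator hS _).symm
    _ = ∫⁻ x in O, I.indicator (fun x => ∫⁻ ω, (Set.Ioi b).indicator (fun t => f (x, t))
        (knnLevel K n k ((η ω).restrict hO).1 x) ∂P) x ∂((n : ℝ≥0∞) • K) := by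
        rw [e]
        refine lintegral_congr fun x => ?_
        by_cases hx : x ∈ I
        · rw [Set.indicator_of_mem hx]
          refine lintegral_congr fun ω => ?_
          by_cases ht : knnLevel K n k ((η ω).restrict hO).1 x ∈ Set.Ioi b
          · rw [Set.indicator_of_mem ht, Set.indicator_of_mem (Set.mk_mem_prod hx ht)]
          · rw [Set.indicator_of_notMem ht, Set.indicator_of_notMem fun h => ht h.2]
        · rw [Set.indicator_of_notMem hx, ← lintegral_zero (μ := P)]
          refine lintegral_congr fun ω => ?_
          rw [Set.indicator_of_notMem fun h => hx h.1]
    _ = _ := by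
        rw [← lintegral_indicator hO, ← lintegral_indicator hI, lintegral_smul_measure, smul_eq_mul,
          ← lintegral_const_mul' _ _ (by simp)]
        refine lintegral_congr fun x => ?_
        by_cases hx : x ∈ I
        · rw [Set.indicator_of_mem (hsub hx), Set.indicator_of_mem hx, Set.indicator_of_mem hx]
        · rw [Set.indicator_of_notMem hx]
          by_cases hxO : x ∈ O
          · rw [Set.indicator_of_mem hxO, Set.indicator_of_notMem hx, mul_zero]
          · rw [Set.indicator_of_notMem hxO, mul_zero]

end Exceed

/-! ### Exceedances in a block -/

/-- The intensity `e^{-t} dt` above the level `b`. -/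
def levelLaw (b : ℝ) : Measure ℝ :=
  (volume.withDensity fun t => ENNReal.ofReal (Real.exp (-t))).restrict (Set.Ioi b)

lemma lintegral_levelLaw (b : ℝ) {f : ℝ → ℝ≥0∞} (hf : Measurable f) :
    ∫⁻ t, f t ∂(levelLaw b) = ∫⁻ t in Set.Ioi b, f t * ENNReal.ofReal (Real.exp (-t)) := by
  rw [levelLaw, restrict_withDensity measurableSet_Ioi,
    lintegral_withDensity_eq_lintegral_mul _ (by fun_prop) hf]
  exact lintegral_congr fun t => mul_comm _ _

lemma levelLaw_univ (b : ℝ) : levelLaw b Set.univ = ENNReal.ofReal (Real.exp (-b)) := by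
  rw [levelLaw, Measure.restrict_apply_univ, withDensity_apply _ measurableSet_Ioi,
    ← ofReal_integral_eq_lintegral_ofReal (integrableOn_exp_neg_Ioi b)
      (.of_forall fun t => (Real.exp_pos _).le), integral_exp_neg_Ioi]

instance (b : ℝ) : IsFiniteMeasure (levelLaw b) := ⟨by rw [levelLaw_univ]; simp⟩

lemma lintegral_le_add_of_eq {Ω : Type*} [MeasurableSpace Ω] {P : Measure Ω} {F G : Ω → ℝ≥0∞}
    {A : Set Ω} (hA : MeasurableSet A) (hF : ∀ ω, F ω ≤ 1) (hFG : ∀ ω ∉ A, F ω = G ω) :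
    ∫⁻ ω, F ω ∂P ≤ ∫⁻ ω, G ω ∂P + P A := by
  rw [← lintegral_indicator_one hA, ← lintegral_add_right _ (measurable_one.indicator hA)]
  refine lintegral_mono fun ω => ?_
  by_cases h : ω ∈ A
  · rw [Set.indicator_of_mem h]
    exact (hF ω).trans le_add_self
  · exact (hFG ω h).le.trans le_self_add

section Block

variable {d : ℕ} {K : Measure (FlatTorus d)} {n k : ℕ} {b : ℝ}
  {I O : Set (FlatTorus d)} (hI : MeasurableSet I) (hO : MeasurableSet O)
  {Ω : Type*} [MeasurableSpace Ω] {P : Measure Ω} {η : Ω → FiniteConfig (FlatTorus d)}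

lemma measurableSet_lt_apply (hη : Measurable η) {B : Set (FlatTorus d)}
    (hB : MeasurableSet B) : MeasurableSet {ω | (η ω).1 B < k} :=
  ((FiniteConfig.measurable_coe hB).comp hη) measurableSet_Iio

lemma knnLevel_restrict {x : FlatTorus d} {r : ℝ} (hr : 0 < r)
    (hxO : Metric.closedBall x r ⊆ O) {ω : FiniteConfig (FlatTorus d)}
    (hω : ¬ ω.1 (Metric.closedBall x r \ {x}) < k) :
    knnLevel K n k (ω.restrict hO).1 x = knnLevel K n k ω.1 x := by
  rw [knnLevel, knnLevel, FiniteConfig.coe_restrict, knnMass_restrict hr hxO (not_lt.1 hω)]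

variable [IsProbabilityMeasure K]

lemma measure_sparse_le (h : IsPoissonProcess (fun ω => (η ω).1) ((n : ℝ≥0∞) • K) P)
    (hK : ∀ x r, K (Metric.sphere x r) = 0) {r : ℝ} {pr : ℝ≥0∞} {x : FlatTorus d}
    (hpr : ENNReal.ofReal (poissonTail k (n * K.real (Metric.closedBall x r))) ≤ pr) :
    P {ω | (η ω).1 (Metric.closedBall x r \ {x}) < k} ≤ pr := by
  rw [h.measure_lt (measurableSet_closedBall_sdiff x r) k, smul_real_sdiff_singleton hK]
  exact hpr

variable [IsProbabilityMeasure P] (hη : Measurable η) (h : IsPoissonProcess (fun ω => (η ω).1) ((n : ℝ≥0∞) • K) P)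
  (hK : ∀ x r, K (Metric.sphere x r) = 0) (hn : 2 ≤ n) (hk : 1 ≤ k)
  (hb : 0 ≤ knnCentring n k + b) {r : ℝ} (hr : 0 < r) (hsub : ∀ x ∈ I, Metric.closedBall x r ⊆ O)
  {pr : ℝ≥0∞}
  (hpr : ∀ x, ENNReal.ofReal (poissonTail k (n * K.real (Metric.closedBall x r))) ≤ pr)

include hη h hK hn hk hb hr hsub hpr

/-- For each x in I, replacing the level computed in O by the true level costs the probability `pr`
that the ball of radius r is sparse. The true level has the truncated Erlang law, and `erlangError`
compares it with the limit. -/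
lemma lintegral_blockConfig_le {f : FlatTorus d × ℝ → ℝ≥0∞} (hf : Measurable f)
    (hf1 : ∀ y, f y ≤ 1) :
    ∫⁻ ω, ∫⁻ y, f y ∂(blockConfig K n k b hI hO (η ω)).1 ∂P ≤
      (∫⁻ x in I, ∫⁻ t, f (x, t) ∂(levelLaw b) ∂K) + (erlangError n k b + n * pr) * K I := by
  have hsub' : I ⊆ O := fun x hx => hsub x hx (Metric.mem_closedBall_self hr.le)
  rw [lintegral_blockConfig hI hO hη h hsub' hf, ← setLIntegral_const,
    ← lintegral_add_right _ measurable_const]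
  refine setLIntegral_mono' hI fun x hx => ?_
  have hfx : Measurable fun t => f (x, t) := hf.comp measurable_prodMk_left
  have hG : Measurable ((Set.Ioi b).indicator fun t => f (x, t)) := hfx.indicator measurableSet_Ioi
  have h1 := lintegral_le_add_of_eq (P := P)
    (F := fun ω => (Set.Ioi b).indicator (fun t => f (x, t)) (knnLevel K n k ((η ω).restrict hO).1 x))
    (G := fun ω => (Set.Ioi b).indicator (fun t => f (x, t)) (knnLevel K n k (η ω).1 x))
    (measurableSet_lt_apply (k := k) hη (measurableSet_closedBall_sdiff x r))
    (fun ω => (Set.indicator_le_self _ _ _).trans (hf1 _))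
    (fun ω hω => by rw [knnLevel_restrict hO hr (hsub x hx) hω])
  have h2 := lintegral_erlang_le hn hk hb hfx fun t => hf1 _
  rw [lintegral_comp_knnLevel K (by lia) hk hη h (hK x) hG] at h1
  calc _ ≤ (n : ℝ≥0∞) * (∫⁻ v, (Set.Ioi b).indicator (fun t => f (x, t))
        (min v n - knnCentring n k) ∂(erlang k) + pr) := by
        gcongr
        exact h1.trans (add_le_add_right (measure_sparse_le h hK (hpr x)) _)
    _ ≤ _ := by
        rw [mul_add, lintegral_levelLaw b hfx, ← add_assoc]
        gcongr

lemma le_lintegral_blockConfig {f : FlatTorus d × ℝ → ℝ≥0∞} (hf : Measurable f)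
    (hf1 : ∀ y, f y ≤ 1) :
    (∫⁻ x in I, ∫⁻ t, f (x, t) ∂(levelLaw b) ∂K) ≤
      ∫⁻ ω, ∫⁻ y, f y ∂(blockConfig K n k b hI hO (η ω)).1 ∂P +
        (erlangError n k b + n * pr) * K I := by
  have hsub' : I ⊆ O := fun x hx => hsub x hx (Metric.mem_closedBall_self hr.le)
  rw [lintegral_blockConfig hI hO hη h hsub' hf, ← setLIntegral_const,
    ← lintegral_add_right _ measurable_const]
  refine setLIntegral_mono' hI fun x hx => ?_
  have hfx : Measurable fun t => f (x, t) := hf.comp measurable_prodMk_left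
  have hG : Measurable ((Set.Ioi b).indicator fun t => f (x, t)) := hfx.indicator measurableSet_Ioi
  have h1 := lintegral_le_add_of_eq (P := P)
    (G := fun ω => (Set.Ioi b).indicator (fun t => f (x, t)) (knnLevel K n k ((η ω).restrict hO).1 x))
    (F := fun ω => (Set.Ioi b).indicator (fun t => f (x, t)) (knnLevel K n k (η ω).1 x))
    (measurableSet_lt_apply (k := k) hη (measurableSet_closedBall_sdiff x r))
    (fun ω => (Set.indicator_le_self _ _ _).trans (hf1 _))
    (fun ω hω => by rw [knnLevel_restrict hO hr (hsub x hx) hω])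
  have h2 := le_lintegral_erlang hn hk hb hfx fun t => hf1 _
  rw [lintegral_comp_knnLevel K (by lia) hk hη h (hK x) hG] at h1
  rw [lintegral_levelLaw b hfx]
  refine h2.trans ?_
  rw [add_comm (erlangError n k b), ← add_assoc]
  refine add_le_add_left ?_ _
  rw [← mul_add]
  gcongr
  exact h1.trans (add_le_add_right (measure_sparse_le h hK (hpr x)) _)

end Block

/-! ### Pairs of exceedances in a block -/

section Pairs

variable {d : ℕ} {K : Measure (FlatTorus d)} [IsProbabilityMeasure K] {n k : ℕ} {b : ℝ}
  {I O : Set (FlatTorus d)} (hI : MeasurableSet I) (hO : MeasurableSet O)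
  {Ω : Type*} [MeasurableSpace Ω] {P : Measure Ω}
  {η : Ω → FiniteConfig (FlatTorus d)}

/-- The ball of y is replaced by its part outside the ball of x. Fewer than k points there is a
weaker requirement, but it is independent of the requirement at x. -/
lemma measure_levelBall_lt_inter_le
    (h : IsPoissonProcess (fun ω => (η ω).1) ((n : ℝ≥0∞) • K) P)
    (hK : ∀ x r, K (Metric.sphere x r) = 0) (hv : 0 < knnCentring n k + b)
    (hvn : knnCentring n k + b < n) (x y : FlatTorus d) :
    P {ω | (η ω).1 (levelBall K n k b x \ {x}) < k ∧ (η ω).1 (levelBall K n k b y \ {y}) < k} ≤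
      ENNReal.ofReal (poissonTail k (knnCentring n k + b)) *
        ENNReal.ofReal (poissonTail k (n * K.real (levelBall K n k b y \ levelBall K n k b x))) := by
  have hx := measurableSet_levelBall K n k b x
  have hy := measurableSet_levelBall K n k b y
  have hA := hx.diff (measurableSet_singleton x)
  have hB := (hy.diff hx).diff (measurableSet_singleton y)
  calc _ ≤ P {ω | (η ω).1 (levelBall K n k b x \ {x}) < k ∧
        (η ω).1 ((levelBall K n k b y \ levelBall K n k b x) \ {y}) < k} :=
        measure_mono fun ω hω => ⟨hω.1, lt_of_le_of_lt
          (measure_mono (Set.sdiff_subset_sdiff_left Set.sdiff_subset)) hω.2⟩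
    _ = _ := by
        rw [h.measure_lt_inter hA hB, h.measure_lt hA, h.measure_lt hB,
          smul_real_sdiff_singleton hK, smul_real_sdiff_singleton hK,
          measureReal_levelBall hK hv hvn]
        exact (Set.disjoint_sdiff_right).mono Set.sdiff_subset Set.sdiff_subset

/-- Being an exceedance is a decreasing selection rule, since further points can only fill the level
ball. So `lintegral_selected_pairs_le` applies to the process restricted to O. -/
lemma lintegral_pairCount_blockConfig_le [IsProbabilityMeasure P] (hη : Measurable η)
    (h : IsPoissonProcess (fun ω => (η ω).1) ((n : ℝ≥0∞) • K) P)
    (hK : ∀ x r, K (Metric.sphere x r) = 0) (hv : 0 < knnCentring n k + b)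
    (hvn : knnCentring n k + b < n) (hsub : ∀ x ∈ I, levelBall K n k b x ⊆ O) :
    ∫⁻ ω, (blockConfig K n k b hI hO (η ω)).pairCount ∂P ≤
      ∫⁻ x in I, ∫⁻ y in I, ENNReal.ofReal (poissonTail k (knnCentring n k + b)) *
        ENNReal.ofReal (poissonTail k (n * K.real (levelBall K n k b y \ levelBall K n k b x)))
          ∂((n : ℝ≥0∞) • K) ∂((n : ℝ≥0∞) • K) := by
  set E : Set (FlatTorus d × FiniteConfig (FlatTorus d)) :=
    {p | p.1 ∈ I ∧ b < knnLevel K n k p.2.1 p.1} with hE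
  have hEm : MeasurableSet E := (measurable_fst hI).inter (measurable_knnLevel K n k measurableSet_Ioi)
  have hmem : ∀ x (ω : FiniteConfig (FlatTorus d)),
      (x, ω) ∈ E ↔ x ∈ I ∧ ω.1 (levelBall K n k b x \ {x}) < k := fun x ω => by
    rw [← lt_knnLevel_iff hK hv hvn]; rfl
  have key := (h.restrict hO).lintegral_selected_pairs_le (η := fun ω => (η ω).restrict hO)
    ((FiniteConfig.measurable_restrict hO).comp hη) hEm
    (fun x ω => by simp only [hE, Set.mem_ofPred_eq, knnLevel_add_dirac])
    (fun x y ω hy => by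
      rw [hmem] at hy ⊢
      exact ⟨hy.1, lt_of_le_of_lt (by simp) hy.2⟩)
  have hcount : ∀ ω : FiniteConfig (FlatTorus d), (blockConfig K n k b hI hO ω).1 Set.univ =
      (ω.restrict hO).1 {x | (x, ω.restrict hO) ∈ E} := fun ω => by
    rw [blockConfig, FiniteConfig.coe_restrict, Measure.restrict_apply_univ,
      knnConfig_apply _ _ _ _ (hI.prod measurableSet_Ioi)]
    rfl
  simp only [FiniteConfig.pairCount, hcount]
  refine key.trans ?_
  -- For x in I the level ball lies inside O, so the restriction to O is not felt.
  have hres : ∀ x ∈ I, ∀ ω : Ω, ((η ω).restrict hO).1 (levelBall K n k b x \ {x}) =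
      (η ω).1 (levelBall K n k b x \ {x}) := fun x hx ω => by
    rw [FiniteConfig.coe_restrict, Measure.restrict_apply
      ((measurableSet_levelBall K n k b x).diff (measurableSet_singleton x)),
      Set.inter_eq_left.2 (Set.sdiff_subset.trans (hsub x hx))]
  calc _ ≤ ∫⁻ x in O, I.indicator (fun x => ∫⁻ y in O, I.indicator (fun y =>
        ENNReal.ofReal (poissonTail k (knnCentring n k + b)) *
        ENNReal.ofReal (poissonTail k (n * K.real (levelBall K n k b y \ levelBall K n k b x)))) y
          ∂((n : ℝ≥0∞) • K)) x ∂((n : ℝ≥0∞) • K) := by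
        refine lintegral_mono fun x => ?_
        by_cases hx : x ∈ I
        · rw [Set.indicator_of_mem hx]
          refine lintegral_mono fun y => ?_
          by_cases hy : y ∈ I
          · rw [Set.indicator_of_mem hy]
            simp only [hmem, hx, hy, true_and, hres]
            exact measure_levelBall_lt_inter_le h hK hv hvn x y
          · simp [hmem, hy]
        · simp [hmem, hx]
    _ ≤ _ := by
        refine (setLIntegral_le_lintegral _ _).trans ?_
        rw [lintegral_indicator hI]
        refine lintegral_mono fun x => (setLIntegral_le_lintegral _ _).trans ?_
        rw [lintegral_indicator hI]

end Pairs

/-! ### The limit process in a block -/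

section Limit

variable {d : ℕ} {K : Measure (FlatTorus d)} [IsProbabilityMeasure K] {b : ℝ}
  {I : Set (FlatTorus d)} (hI : MeasurableSet I)
  {Ω' : Type*} [MeasurableSpace Ω'] {P' : Measure Ω'}
  {ζ : Ω' → FiniteConfig (FlatTorus d × ℝ)}

/-- The points of the limit process above `I`. -/
def limitBlock (hI : MeasurableSet I) (ω : FiniteConfig (FlatTorus d × ℝ)) :
    FiniteConfig (FlatTorus d × ℝ) := ω.restrict (hI.prod MeasurableSet.univ)

lemma measurable_limitBlock : Measurable (limitBlock hI) := FiniteConfig.measurable_restrict _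

lemma isPoissonProcess_limitBlock
    (h : IsPoissonProcess (fun ω => (ζ ω).1) (K.prod (levelLaw b)) P') :
    IsPoissonProcess (fun ω => (limitBlock hI (ζ ω)).1) ((K.restrict I).prod (levelLaw b)) P' := by
  have := h.restrict (hI.prod MeasurableSet.univ)
  rwa [← Measure.prod_restrict, Measure.restrict_univ] at this

variable [IsProbabilityMeasure P']

lemma lintegral_limitBlock (hζ : Measurable ζ)
    (h : IsPoissonProcess (fun ω => (ζ ω).1) (K.prod (levelLaw b)) P')
    {f : FlatTorus d × ℝ → ℝ≥0∞} (hf : Measurable f) :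
    ∫⁻ ω, ∫⁻ y, f y ∂(limitBlock hI (ζ ω)).1 ∂P' =
      ∫⁻ x in I, ∫⁻ t, f (x, t) ∂(levelLaw b) ∂K := by
  rw [(isPoissonProcess_limitBlock hI h).lintegral_lintegral ((measurable_limitBlock hI).comp hζ) hf,
    lintegral_prod _ hf.aemeasurable]

lemma lintegral_limitBlock_univ (hζ : Measurable ζ)
    (h : IsPoissonProcess (fun ω => (ζ ω).1) (K.prod (levelLaw b)) P') :
    ∫⁻ ω, (limitBlock hI (ζ ω)).1 Set.univ ∂P' = ENNReal.ofReal (Real.exp (-b)) * K I := by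
  have := lintegral_limitBlock hI hζ h (f := fun _ => 1) measurable_const
  simpa [levelLaw_univ] using this

lemma lintegral_pairCount_limitBlock_le (hζ : Measurable ζ)
    (h : IsPoissonProcess (fun ω => (ζ ω).1) (K.prod (levelLaw b)) P') :
    ∫⁻ ω, (limitBlock hI (ζ ω)).pairCount ∂P' ≤ (ENNReal.ofReal (Real.exp (-b)) * K I) ^ 2 := by
  refine ((isPoissonProcess_limitBlock hI h).lintegral_pairCount
    ((measurable_limitBlock hI).comp hζ)).trans_eq ?_
  rw [← Set.univ_prod_univ, Measure.prod_prod, Measure.restrict_apply_univ, levelLaw_univ, mul_comm]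

end Limit

/-! ### Comparison of the exceedance process and its limit -/

namespace FiniteConfig

lemma restrict_restrict_of_subset {X : Type*} [MeasurableSpace X] (ω : FiniteConfig X) {S T : Set X}
    (hS : MeasurableSet S) (hT : MeasurableSet T) (h : S ⊆ T) :
    (ω.restrict hT).restrict hS = ω.restrict hS :=
  Subtype.ext (Measure.restrict_restrict_of_subset h)

end FiniteConfig

namespace IsPoissonProcess

lemma lintegral_selected {Ω X : Type*} [MeasurableSpace Ω] [MeasurableSpace X] {μ : Measure X}
    {P : Measure Ω} {η : Ω → FiniteConfig X}
    (h : IsPoissonProcess (fun ω => (η ω).1) μ P) (hη : Measurable η)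
    [IsFiniteMeasure μ] [IsProbabilityMeasure P] {E : Set (X × FiniteConfig X)}
    (hE : MeasurableSet E) (hself : ∀ x ω, (x, ω + .dirac x) ∈ E ↔ (x, ω) ∈ E) :
    ∫⁻ ω, (η ω).1 {x | (x, η ω) ∈ E} ∂P = ∫⁻ x, P {ω | (x, η ω) ∈ E} ∂μ := by
  have key := h.mecke hη (f := E.indicator 1) (measurable_one.indicator hE)
  have e1 : ∀ ω, ∫⁻ x, E.indicator 1 (x, η ω) ∂(η ω).1 = (η ω).1 {x | (x, η ω) ∈ E} := fun ω => by
    have hm : MeasurableSet {x | (x, η ω) ∈ E} := measurable_prodMk_right hE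
    rw [← lintegral_indicator_one hm]
    rfl
  have e2 : ∀ x, ∫⁻ ω, E.indicator 1 (x, η ω + .dirac x) ∂P = P {ω | (x, η ω) ∈ E} := fun x => by
    have hm : MeasurableSet {ω | (x, η ω) ∈ E} := (measurable_const.prodMk hη) hE
    rw [← lintegral_indicator_one hm]
    refine lintegral_congr fun ω => ?_
    by_cases hx : (x, η ω) ∈ E
    · rw [Set.indicator_of_mem ((hself _ _).2 hx), Set.indicator_of_mem (by exact hx)]; rfl
    · rw [Set.indicator_of_notMem (mt (hself _ _).1 hx), Set.indicator_of_notMem (by exact hx)]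
  simpa only [e1, e2] using key

end IsPoissonProcess

section Compare

variable {d : ℕ} {K : Measure (FlatTorus d)} [IsProbabilityMeasure K] {n k : ℕ} {b : ℝ}
  {Ω : Type*} [MeasurableSpace Ω] {P : Measure Ω} {η : Ω → FiniteConfig (FlatTorus d)}
  {Ω' : Type*} [MeasurableSpace Ω'] {P' : Measure Ω'} [IsProbabilityMeasure P']
  {ζ : Ω' → FiniteConfig (FlatTorus d × ℝ)}

lemma blockConfig_apply {I O : Set (FlatTorus d)} (hI : MeasurableSet I) (hO : MeasurableSet O)
    (hsub : I ⊆ O) (ω : FiniteConfig (FlatTorus d)) {A : Set (FlatTorus d × ℝ)}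
    (hA : MeasurableSet A) : (blockConfig K n k b hI hO ω).1 A =
      ω.1 {x | x ∈ I ∧ b < knnLevel K n k (ω.restrict hO).1 x ∧
        (x, knnLevel K n k (ω.restrict hO).1 x) ∈ A} := by
  have hS : MeasurableSet (A ∩ I ×ˢ Set.Ioi b) := hA.inter (hI.prod measurableSet_Ioi)
  have hm : MeasurableSet {x | (x, knnLevel K n k (ω.restrict hO).1 x) ∈ A ∩ I ×ˢ Set.Ioi b} :=
    measurable_knnPoint K n k _ hS
  rw [blockConfig, FiniteConfig.coe_restrict, Measure.restrict_apply hA, knnConfig_apply _ _ _ _ hS,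
    FiniteConfig.coe_restrict ω hO, Measure.restrict_apply (by exact hm)]
  congr 1
  ext x
  simp only [Set.mem_inter_iff, Set.mem_ofPred_eq, Set.mem_prod, Set.mem_Ioi]
  constructor
  · rintro ⟨⟨h1, h2, h3⟩, -⟩
    exact ⟨h2, h3, h1⟩
  · rintro ⟨h1, h2, h3⟩
    exact ⟨⟨h3, h1, h2⟩, hsub h1⟩

lemma measurableSet_blockConfig_apply {I O : Set (FlatTorus d)} (hI : MeasurableSet I)
    (hO : MeasurableSet O) (ω : FiniteConfig (FlatTorus d)) {A : Set (FlatTorus d × ℝ)}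
    (hA : MeasurableSet A) : MeasurableSet {x | x ∈ I ∧ b < knnLevel K n k (ω.restrict hO).1 x ∧
        (x, knnLevel K n k (ω.restrict hO).1 x) ∈ A} :=
  hI.inter ((measurable_knnLevel_right K n k _ measurableSet_Ioi).inter
    (measurable_knnPoint K n k _ hA))

lemma blockConfig_univ_le {I O : Set (FlatTorus d)} (hI : MeasurableSet I) (hO : MeasurableSet O)
    (hsub : I ⊆ O) (ω : FiniteConfig (FlatTorus d)) :
    (blockConfig K n k b hI hO ω).1 Set.univ ≤ ω.1 Set.univ := by
  rw [blockConfig_apply hI hO hsub ω MeasurableSet.univ]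
  exact measure_mono (Set.subset_univ _)

lemma lintegral_blockConfig_univ_ne_top {I O : Set (FlatTorus d)} (hI : MeasurableSet I)
    (hO : MeasurableSet O) (hsub : I ⊆ O)
    (h : IsPoissonProcess (fun ω => (η ω).1) ((n : ℝ≥0∞) • K) P) :
    ∫⁻ ω, (blockConfig K n k b hI hO (η ω)).1 Set.univ ∂P ≠ ∞ := by
  refine ne_top_of_le_ne_top ?_ (lintegral_mono fun ω => blockConfig_univ_le hI hO hsub (η ω))
  rw [h.lintegral_apply MeasurableSet.univ]
  exact measure_ne_top _ _

variable [IsProbabilityMeasure P]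

/-- A block only looks at the points in O; this gives the independence of blocks whose sets O are
disjoint. -/
lemma blockConfig_restrict {I O U : Set (FlatTorus d)} (hI : MeasurableSet I) (hO : MeasurableSet O)
    (hU : MeasurableSet U) (hOU : O ⊆ U) (ω : FiniteConfig (FlatTorus d)) :
    blockConfig K n k b hI hO (ω.restrict hU) = blockConfig K n k b hI hO ω := by
  rw [blockConfig, FiniteConfig.restrict_restrict_of_subset _ _ _ hOU, blockConfig]

lemma lintegral_limitBlock_univ_ne_top {I : Set (FlatTorus d)} (hI : MeasurableSet I)
    (hζ : Measurable ζ) (h : IsPoissonProcess (fun ω => (ζ ω).1) (K.prod (levelLaw b)) P') :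
    ∫⁻ ω, (limitBlock hI (ζ ω)).1 Set.univ ∂P' ≠ ∞ := by
  rw [lintegral_limitBlock_univ hI hζ h]
  finiteness

/-- The bound for the number of pairs of exceedances in `I`. -/
def pairBound (K : Measure (FlatTorus d)) (n k : ℕ) (b : ℝ) (I : Set (FlatTorus d)) : ℝ≥0∞ :=
  ∫⁻ x in I, ∫⁻ y in I, ENNReal.ofReal (poissonTail k (knnCentring n k + b)) *
    ENNReal.ofReal (poissonTail k (n * K.real (levelBall K n k b y \ levelBall K n k b x)))
      ∂((n : ℝ≥0∞) • K) ∂((n : ℝ≥0∞) • K)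

/-- The error of the Poisson approximation in a block. -/
def blockError (K : Measure (FlatTorus d)) (n k : ℕ) (b : ℝ) (pr : ℝ≥0∞) (I : Set (FlatTorus d)) :
    ℝ≥0∞ :=
  2 * pairBound K n k b I + 2 * (ENNReal.ofReal (Real.exp (-b)) * K I) ^ 2 +
    2 * ((erlangError n k b + n * pr) * K I)

section

variable (hη : Measurable η) (h : IsPoissonProcess (fun ω => (η ω).1) ((n : ℝ≥0∞) • K) P)
  (hζ : Measurable ζ) (h' : IsPoissonProcess (fun ω => (ζ ω).1) (K.prod (levelLaw b)) P')
  (hK : ∀ x r, K (Metric.sphere x r) = 0) (hn : 2 ≤ n) (hk : 1 ≤ k)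
  (hv : 0 < knnCentring n k + b) (hvn : knnCentring n k + b < n) {r : ℝ} (hr : 0 < r)
  (hball : ∀ x, levelBall K n k b x ⊆ Metric.closedBall x r) {pr : ℝ≥0∞}
  (hpr : ∀ x, ENNReal.ofReal (poissonTail k (n * K.real (Metric.closedBall x r))) ≤ pr)

include hη h hζ h' hK hn hk hv hvn hr hball hpr

/-- Poisson approximation of the exceedances in one block. -/
lemma abs_expect_blockConfig_sub_le {I O : Set (FlatTorus d)} (hI : MeasurableSet I)
    (hO : MeasurableSet O) (hsub : ∀ x ∈ I, Metric.closedBall x r ⊆ O)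
    {g : FiniteConfig (FlatTorus d × ℝ) → ℝ} (hg : TVLip g) :
    ENNReal.ofReal |(∫ ω, g (blockConfig K n k b hI hO (η ω)) ∂P) -
      ∫ ω, g (limitBlock hI (ζ ω)) ∂P'| ≤ blockError K n k b pr I := by
  have hsub' : I ⊆ O := fun x hx => hsub x hx (Metric.mem_closedBall_self hr.le)
  refine hg.abs_expect_sub_le ((measurable_blockConfig hI hO).comp hη)
    ((measurable_limitBlock hI).comp hζ) (lintegral_blockConfig_univ_ne_top hI hO hsub' h)
    (lintegral_limitBlock_univ_ne_top hI hζ h')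
    (lintegral_pairCount_blockConfig_le hI hO hη h hK hv hvn fun x hx => (hball x).trans (hsub x hx))
    (lintegral_pairCount_limitBlock_le hI hζ h') (fun f hf hf1 => ?_) (fun f hf hf1 => ?_)
  · have := lintegral_blockConfig_le hI hO hη h hK hn hk hv.le hr hsub hpr hf hf1
    rwa [← lintegral_limitBlock hI hζ h' hf] at this
  · have := le_lintegral_blockConfig hI hO hη h hK hn hk hv.le hr hsub hpr hf hf1
    rwa [← lintegral_limitBlock hI hζ h' hf] at this

variable {ι : Type*} [Fintype ι] {I O : ι → Set (FlatTorus d)} (hI : ∀ i, MeasurableSet (I i))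
  (hO : ∀ i, MeasurableSet (O i)) (hsub : ∀ i, ∀ x ∈ I i, Metric.closedBall x r ⊆ O i)
  (hd : Pairwise fun i j => Disjoint (O i) (O j))

include hI hO hsub hd

/-- Disjoint sets O make the block contributions independent, and the limit process is independent
over the disjoint sets I, so the blocks can be exchanged one at a time. -/
lemma abs_expect_sum_blockConfig_sub_le {g : FiniteConfig (FlatTorus d × ℝ) → ℝ} (hg : TVLip g) :
    ENNReal.ofReal |(∫ ω, g (∑ i, blockConfig K n k b (hI i) (hO i) (η ω)) ∂P) -
      ∫ ω, g (∑ i, limitBlock (hI i) (ζ ω)) ∂P'| ≤ ∑ i, blockError K n k b pr (I i) := by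
  classical
  have hsub' : ∀ i, I i ⊆ O i := fun i x hx => hsub i x hx (Metric.mem_closedBall_self hr.le)
  have hdI : ∀ (t : Finset ι) (a : ι), a ∉ t → ∀ i ∈ t, Disjoint (O i) (O a) := fun t a ha i hi =>
    hd fun hia => ha (hia ▸ hi)
  refine TVLip.abs_expect_sum_sub_le (fun i => (measurable_blockConfig (hI i) (hO i)).comp hη)
    (fun i => (measurable_limitBlock (hI i)).comp hζ)
    (fun i => lintegral_blockConfig_univ_ne_top (hI i) (hO i) (hsub' i) h)
    (fun i => lintegral_limitBlock_univ_ne_top (hI i) hζ h') (fun t a ha => ?_) (fun t a ha => ?_)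
    (fun i g hg => abs_expect_blockConfig_sub_le hη h hζ h' hK hn hk hv hvn hr hball hpr (hI i) (hO i)
      (hsub i) hg) Finset.univ hg
  · have hU : MeasurableSet (⋃ i ∈ t, O i) := t.measurableSet_biUnion fun i _ => hO i
    have hm : Measurable fun ω => ∑ i ∈ t, blockConfig K n k b (hI i) (hO i) ω :=
      Finset.measurable_sum t fun i _ => measurable_blockConfig (hI i) (hO i)
    have hi := (h.indepFun_restrict hη hU (hO a)
      (Set.disjoint_iUnion₂_left.2 (hdI t a ha))).comp hm
      (measurable_blockConfig (K := K) (n := n) (k := k) (b := b) (hI a) (hO a))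
    refine hi.congr (.of_forall fun ω => ?_) (.of_forall fun ω => ?_)
    · exact Finset.sum_congr rfl fun i hi => blockConfig_restrict (hI i) (hO i) hU
        (Set.subset_biUnion_of_mem (u := O) hi) (η ω)
    · exact blockConfig_restrict (hI a) (hO a) (hO a) le_rfl (η ω)
  · have hU : MeasurableSet (⋃ i ∈ t, I i) := t.measurableSet_biUnion fun i _ => hI i
    have hm : Measurable fun ω => ∑ i ∈ t, limitBlock (hI i) ω :=
      Finset.measurable_sum t fun i _ => measurable_limitBlock (hI i)
    have hi := (h'.indepFun_restrict hζ (hU.prod MeasurableSet.univ) ((hI a).prod MeasurableSet.univ)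
      (Set.disjoint_prod.2 (.inl (Set.disjoint_iUnion₂_left.2
        fun i hi => (hdI t a ha i hi).mono (hsub' i) (hsub' a))))).comp hm
      (measurable_limitBlock (hI a))
    refine hi.congr (.of_forall fun ω => ?_) (.of_forall fun ω => ?_)
    · exact Finset.sum_congr rfl fun i hi =>
        FiniteConfig.restrict_restrict_of_subset _ _ _
          (Set.prod_mono (Set.subset_biUnion_of_mem (u := I) hi) le_rfl)
    · exact FiniteConfig.restrict_restrict_of_subset _ ((hI a).prod MeasurableSet.univ) _ le_rfl

/-- Poisson approximation of the exceedances, given a decomposition of the space into blocks. -/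
theorem abs_expect_blockConfig_univ_sub_le {g : FiniteConfig (FlatTorus d × ℝ) → ℝ} (hg : TVLip g) :
    ENNReal.ofReal |(∫ ω, g (blockConfig K n k b .univ .univ (η ω)) ∂P) - ∫ ω, g (ζ ω) ∂P'| ≤
      (n * ENNReal.ofReal (poissonTail k (knnCentring n k + b)) * K (⋃ i, I i)ᶜ + n * pr) +
        ∑ i, blockError K n k b pr (I i) + ENNReal.ofReal (Real.exp (-b)) * K (⋃ i, I i)ᶜ := by
  classical
  have hsub' : ∀ i, I i ⊆ O i := fun i x hx => hsub i x hx (Metric.mem_closedBall_self hr.le)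
  have hdI : Pairwise fun i j => Disjoint (I i) (I j) := fun i j hij =>
    (hd hij).mono (hsub' i) (hsub' j)
  have hC : MeasurableSet (⋃ i, I i)ᶜ := (MeasurableSet.iUnion hI).compl
  have hmid := abs_expect_sum_blockConfig_sub_le hη h hζ h' hK hn hk hv hvn hr hball hpr hI hO hsub hd hg
  -- The block version of the limit only lacks the points above the corridors, whose expected number
  -- is e^{-b} times the mass of the corridors.
  have hlast : ENNReal.ofReal |(∫ ω, g (∑ i, limitBlock (hI i) (ζ ω)) ∂P') - ∫ ω, g (ζ ω) ∂P'| ≤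
      ENNReal.ofReal (Real.exp (-b)) * K (⋃ i, I i)ᶜ := by
    have hsum : ∀ (ω : FiniteConfig (FlatTorus d × ℝ)) A, MeasurableSet A →
        (∑ i, limitBlock (hI i) ω).1 A = ω.1 (⋃ i, A ∩ I i ×ˢ Set.univ) := fun ω A hA => by
      rw [measure_iUnion (fun i j hij => ?_) fun i => hA.inter ((hI i).prod MeasurableSet.univ),
        tsum_fintype, FiniteConfig.coe_sum, Measure.finsetSum_apply]
      · exact Finset.sum_congr rfl fun i _ => Measure.restrict_apply hA
      · exact (Set.disjoint_prod.2 (.inl (hdI hij))).mono Set.inter_subset_right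
          Set.inter_subset_right
    have hfin : ∫⁻ ω, (ζ ω).1 Set.univ ∂P' ≠ ∞ := by
      rw [h'.lintegral_apply MeasurableSet.univ]
      exact measure_ne_top _ _
    have hle : ∀ ω A, MeasurableSet A → (∑ i, limitBlock (hI i) (ζ ω)).1 A ≤ (ζ ω).1 A :=
      fun ω A hA => by
        rw [hsum _ A hA]
        exact measure_mono (Set.iUnion_subset fun i => Set.inter_subset_left)
    rw [← lintegral_limitBlock_univ hC hζ h']
    refine hg.abs_integral_sub_le (Finset.measurable_sum _ fun i _ =>
      (measurable_limitBlock (hI i)).comp hζ) hζ (ne_top_of_le_ne_top hfin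
        (lintegral_mono fun ω => hle ω _ MeasurableSet.univ)) hfin
      (fun ω A hA => (hle ω A hA).trans le_self_add) (fun ω A hA => ?_)
    simp only [Function.comp_apply]
    rw [hsum _ A hA, limitBlock, FiniteConfig.coe_restrict, Measure.restrict_apply_univ]
    refine (measure_mono fun p hp => ?_).trans (measure_union_le _ _)
    by_cases hpI : p.1 ∈ ⋃ i, I i
    · obtain ⟨i, hi⟩ := Set.mem_iUnion.1 hpI
      exact .inl (Set.mem_iUnion.2 ⟨i, hp, hi, trivial⟩)
    · exact .inr ⟨hpI, trivial⟩
  have hfirst : ENNReal.ofReal |(∫ ω, g (blockConfig K n k b .univ .univ (η ω)) ∂P) -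
      ∫ ω, g (∑ i, blockConfig K n k b (hI i) (hO i) (η ω)) ∂P| ≤
      n * ENNReal.ofReal (poissonTail k (knnCentring n k + b)) * K (⋃ i, I i)ᶜ + n * pr := by
    have hsum : ∀ (ω : FiniteConfig (FlatTorus d)) A, MeasurableSet A →
        (∑ i, blockConfig K n k b (hI i) (hO i) ω).1 A =
          ω.1 (⋃ i, {x | x ∈ I i ∧ b < knnLevel K n k (ω.restrict (hO i)).1 x ∧
            (x, knnLevel K n k (ω.restrict (hO i)).1 x) ∈ A}) := fun ω A hA => by
      rw [measure_iUnion (fun i j hij => ?_)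
        fun i => measurableSet_blockConfig_apply (hI i) (hO i) ω hA,
        tsum_fintype, FiniteConfig.coe_sum, Measure.finsetSum_apply]
      · exact Finset.sum_congr rfl fun i _ => blockConfig_apply (hI i) (hO i) (hsub' i) ω hA
      · exact (hdI hij).mono (fun x hx => hx.1) fun x hx => hx.1
    have hfull : ∀ (ω : FiniteConfig (FlatTorus d)) A, MeasurableSet A →
        (blockConfig K n k b .univ .univ ω).1 A =
          ω.1 {x | b < knnLevel K n k ω.1 x ∧ (x, knnLevel K n k ω.1 x) ∈ A} := fun ω A hA => by
      rw [blockConfig_apply .univ .univ le_rfl ω hA]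
      simp [FiniteConfig.coe_restrict]
    have hfin : ∫⁻ ω, (η ω).1 Set.univ ∂P ≠ ∞ := by
      rw [h.lintegral_apply MeasurableSet.univ]
      exact measure_ne_top _ _
    -- A point counted differently by the full process and by the blocks is either an exceedance in
    -- a corridor (`E₁`) or has a sparse ball of radius r (`E₂`).
    set E₁ : Set (FlatTorus d × FiniteConfig (FlatTorus d)) :=
      {p | p.1 ∈ (⋃ i, I i)ᶜ ∧ b < knnLevel K n k p.2.1 p.1} with hE₁
    set E₂ : Set (FlatTorus d × FiniteConfig (FlatTorus d)) :=
      {p | p.2.1 (Metric.closedBall p.1 r \ {p.1}) < k} with hE₂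
    have hE₁m : MeasurableSet E₁ :=
      (measurable_fst hC).inter (measurable_knnLevel K n k measurableSet_Ioi)
    have hE₂m : MeasurableSet E₂ :=
      measurable_apply_closedBall_sdiff measurable_fst measurable_snd r measurableSet_Iio
    have hD₁ : ∫⁻ ω, (η ω).1 {x | (x, η ω) ∈ E₁} ∂P ≤
        n * ENNReal.ofReal (poissonTail k (knnCentring n k + b)) * K (⋃ i, I i)ᶜ := by
      rw [h.lintegral_selected hη hE₁m
        fun x ω => by simp only [hE₁, Set.mem_ofPred_eq, knnLevel_add_dirac],
        lintegral_smul_measure, smul_eq_mul, mul_assoc, ← setLIntegral_const, ← lintegral_indicator hC]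
      gcongr with x
      by_cases hx : x ∈ (⋃ i, I i)ᶜ
      · rw [Set.indicator_of_mem hx, ← measureReal_levelBall hK hv hvn x,
          ← smul_real_sdiff_singleton hK, ← h.measure_lt
            ((measurableSet_levelBall K n k b x).diff (measurableSet_singleton x))]
        refine measure_mono fun ω hω => ?_
        exact (lt_knnLevel_iff hK hv hvn).1 hω.2
      · rw [Set.indicator_of_notMem hx, nonpos_iff_eq_zero]
        convert measure_empty (μ := P)
        ext ω
        simpa [hE₁] using fun h => absurd h (by simpa using hx)
    have hD₂ : ∫⁻ ω, (η ω).1 {x | (x, η ω) ∈ E₂} ∂P ≤ n * pr := by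
      rw [h.lintegral_selected hη hE₂m
        fun x ω => by simp only [hE₂, Set.mem_ofPred_eq, add_dirac_apply_sdiff],
        lintegral_smul_measure, smul_eq_mul]
      gcongr
      exact (lintegral_mono fun x => measure_sparse_le h hK (hpr x)).trans_eq (by simp)
    have hDm : Measurable fun ω => (η ω).1 {x | (x, η ω) ∈ E₂} :=
      (FiniteConfig.measurable_measure (g := fun ω : FiniteConfig (FlatTorus d) => ω) measurable_id
        (measurable_swap hE₂m)).comp hη
    have hlev : ∀ i, ∀ x ∈ I i, ∀ ω : FiniteConfig (FlatTorus d), (x, ω) ∉ E₂ →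
        knnLevel K n k (ω.restrict (hO i)).1 x = knnLevel K n k ω.1 x := fun i x hx ω hω =>
      knnLevel_restrict (hO i) hr (hsub i x hx) hω
    refine (hg.abs_integral_sub_le (D := fun ω => (η ω).1 {x | (x, η ω) ∈ E₁} +
        (η ω).1 {x | (x, η ω) ∈ E₂}) ((measurable_blockConfig _ _).comp hη)
      (Finset.measurable_sum _ fun i _ => (measurable_blockConfig (hI i) (hO i)).comp hη)
      (lintegral_blockConfig_univ_ne_top _ _ le_rfl h) (ne_top_of_le_ne_top hfin
        (lintegral_mono fun ω => ?_)) (fun ω A hA => ?_) fun ω A hA => ?_).trans ?_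
    · simp only [Function.comp_apply]
      rw [hsum _ _ MeasurableSet.univ]
      exact measure_mono (Set.subset_univ _)
    · simp only [Function.comp_apply]
      rw [hfull _ A hA, hsum _ A hA]
      refine (measure_mono fun x hx => ?_).trans ((measure_union_le _ _).trans
        (add_le_add_right (measure_union_le _ _) _))
      by_cases hx2 : (x, η ω) ∈ E₂
      · exact .inr (.inr hx2)
      by_cases hxI : x ∈ ⋃ i, I i
      · obtain ⟨i, hi⟩ := Set.mem_iUnion.1 hxI
        refine .inl (Set.mem_iUnion.2 ⟨i, hi, ?_⟩)
        rwa [hlev i x hi _ hx2]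
      · exact .inr (.inl ⟨hxI, hx.1⟩)
    · simp only [Function.comp_apply]
      rw [hfull _ A hA, hsum _ A hA, add_comm (_ : ℝ≥0∞) ((η ω).1 {x | (x, η ω) ∈ E₂}), ← add_assoc]
      refine le_trans ((measure_mono fun x hx => ?_).trans (measure_union_le _ _)) le_self_add
      by_cases hx2 : (x, η ω) ∈ E₂
      · exact .inr hx2
      obtain ⟨i, hi, hx'⟩ := Set.mem_iUnion.1 hx
      rw [hlev i x hi _ hx2] at hx'
      exact .inl hx'
    · rw [lintegral_add_right _ hDm]
      exact add_le_add hD₁ hD₂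
  have htri : ∀ a b c e : ℝ, ENNReal.ofReal |a - e| ≤ ENNReal.ofReal |a - b| +
      ENNReal.ofReal |b - c| + ENNReal.ofReal |c - e| := fun a b c e => by
    rw [← ENNReal.ofReal_add (abs_nonneg _) (abs_nonneg _), ← ENNReal.ofReal_add (by positivity)
      (abs_nonneg _)]
    refine ENNReal.ofReal_le_ofReal ?_
    calc |a - e| = |(a - b) + (b - c) + (c - e)| := by ring_nf
      _ ≤ _ := abs_add_three _ _ _
  exact (htri _ _ _ _).trans (add_le_add (add_le_add hfirst hmid) hlast)

end

end Compare

/-! ### Pairs of nearby exceedances -/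

/-- The constant `∑_j (j + 1)^d e^{-j}`. -/
def expLayerConst (d : ℕ) : ℝ≥0∞ := ∑' j : ℕ, ENNReal.ofReal (Real.exp (-j)) * ((j : ℝ≥0∞) + 1) ^ d

lemma expLayerConst_ne_top (d : ℕ) : expLayerConst d ≠ ∞ := by
  have h1 : Summable fun j : ℕ => ((j : ℝ) + 1) ^ d * Real.exp (-j) := by
    have h := (summable_nat_add_iff 1).2 (Real.summable_pow_mul_exp_neg_nat_mul d one_pos)
    refine (h.mul_left (Real.exp 1)).congr fun j => ?_
    rw [mul_left_comm, ← Real.exp_add]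
    push_cast
    ring_nf
  have h2 : expLayerConst d = ∑' j : ℕ, ENNReal.ofReal (((j : ℝ) + 1) ^ d * Real.exp (-j)) := by
    refine tsum_congr fun j => ?_
    rw [ENNReal.ofReal_mul (by positivity), mul_comm, ENNReal.ofReal_pow (by positivity),
      ENNReal.ofReal_add (by positivity) zero_le_one]
    simp
  rw [h2]
  exact h1.tsum_ofReal_ne_top

section Sweep

variable {d : ℕ} {lam : FlatTorus d → ℝ} {lamMinus lamPlus : ℝ} (hm : 0 < lamMinus)
  (hlam : ∀ x, lamMinus ≤ lam x ∧ lam x ≤ lamPlus)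

include hlam

/-- With j the integer part of c |x - y|, the integrand is at most e^{-j} and y lies in the ball of
radius (j + 1)/c. Summing over these balls costs the volume (2/c)^d times a convergent series. -/
lemma lintegral_exp_neg_dist_le (x : FlatTorus d) {c : ℝ} (hc : 0 < c) :
    ∫⁻ y, ENNReal.ofReal (Real.exp (-(c * dist x y))) ∂(torusMeasure lam) ≤
      ENNReal.ofReal lamPlus * ENNReal.ofReal (2 / c) ^ d * expLayerConst d := by
  have hball : ∀ j : ℕ, MeasurableSet (Metric.closedBall x ((j + 1) / c)) := fun j =>
    measurableSet_closedBall
  calc _ ≤ ∫⁻ y, ∑' j : ℕ, (Metric.closedBall x ((j + 1) / c)).indicator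
          (fun _ => ENNReal.ofReal (Real.exp (-j))) y ∂(torusMeasure lam) := by
        refine lintegral_mono fun y => ?_
        have h0 : 0 ≤ c * dist x y := by positivity
        refine le_trans ?_ (ENNReal.le_tsum ⌊c * dist x y⌋₊)
        rw [Set.indicator_of_mem]
        · exact ENNReal.ofReal_le_ofReal (Real.exp_le_exp.2 (neg_le_neg (Nat.floor_le h0)))
        · rw [Metric.mem_closedBall, dist_comm, le_div_iff₀' hc]
          exact (Nat.lt_floor_add_one _).le
    _ = ∑' j : ℕ, ENNReal.ofReal (Real.exp (-j)) *
          torusMeasure lam (Metric.closedBall x ((j + 1) / c)) := by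
        rw [lintegral_tsum fun j => (measurable_const.indicator (hball j)).aemeasurable]
        exact tsum_congr fun j => lintegral_indicator_const (hball j) _
    _ ≤ ∑' j : ℕ, ENNReal.ofReal lamPlus * ENNReal.ofReal (2 / c) ^ d *
          (ENNReal.ofReal (Real.exp (-j)) * ((j : ℝ≥0∞) + 1) ^ d) := by
        refine ENNReal.tsum_le_tsum fun j => ?_
        have h1 : ENNReal.ofReal (2 * ((j + 1) / c)) = ENNReal.ofReal (2 / c) * ((j : ℝ≥0∞) + 1) := by
          rw [← ENNReal.ofReal_natCast, ← ENNReal.ofReal_one, ← ENNReal.ofReal_add (by positivity)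
            zero_le_one, ← ENNReal.ofReal_mul (by positivity)]
          congr 1; ring
        calc _ ≤ ENNReal.ofReal (Real.exp (-j)) * (ENNReal.ofReal lamPlus *
              (ENNReal.ofReal (2 / c) * ((j : ℝ≥0∞) + 1)) ^ d) := by
              gcongr
              refine (torusMeasure_le (fun x => (hlam x).2) _).trans ?_
              gcongr
              exact (torusVolume_closedBall_le _ _).trans_eq (by rw [h1])
          _ = _ := by rw [mul_pow]; ring
    _ = _ := ENNReal.tsum_mul_left

variable [IsProbabilityMeasure (torusMeasure lam)]

include hm

/-- The ball around y is first shrunk to the radius of the ball around x, so that it becomes a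
translate. The translation argument bounds the volume of the difference below, and the density
bounds turn volumes into masses. -/
lemma mul_le_measureReal_closedBall_diff_of_le {x y : FlatTorus d} {ρx ρy r : ℝ} (h0 : 0 ≤ ρx)
    (hxy : ρx ≤ ρy) (hx : ρx ≤ r) (hr : 8 * r ≤ 1) (hdist : dist x y ≤ 2 * r) :
    lamMinus * (torusMeasure lam).real (Metric.closedBall x ρx) * dist x y ≤
      4 * r * lamPlus *
        (torusMeasure lam).real (Metric.closedBall y ρy \ Metric.closedBall x ρx) := by
  have hp : 0 < lamPlus := hm.trans_le ((hlam x).1.trans (hlam x).2)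
  have hreal : ∀ S, (torusMeasure lam).real S ≤ lamPlus * (torusVolume d).real S := fun S => by
    have := ENNReal.toReal_mono (by finiteness) (torusMeasure_le (fun x => (hlam x).2) S)
    rwa [ENNReal.toReal_mul, ENNReal.toReal_ofReal hp.le] at this
  have hreal' : ∀ S, lamMinus * (torusVolume d).real S ≤ (torusMeasure lam).real S := fun S => by
    have := ENNReal.toReal_mono (by finiteness) (le_torusMeasure (fun x => (hlam x).1) S)
    rwa [ENNReal.toReal_mul, ENNReal.toReal_ofReal hm.le] at this
  rcases (dist_nonneg (x := x) (y := y)).eq_or_lt with hs | hs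
  · rw [← hs, mul_zero]
    have : 0 ≤ r := h0.trans hx
    positivity
  set s := dist x y
  -- N is the least convenient number of steps of length s that exceed the diameter 2ρx. Then N s ≤
  -- 2ρx + s ≤ 4r, and 4r ≤ 1/2 excludes wrapping around the torus.
  set N : ℕ := ⌊2 * ρx / s⌋₊ + 1 with hN
  have hN1 : 2 * ρx < N * s := by
    rw [← div_lt_iff₀ hs, hN]
    exact_mod_cast Nat.lt_floor_add_one _
  have hN2 : N * s ≤ 4 * r := by
    have := Nat.floor_le (show 0 ≤ 2 * ρx / s by positivity)
    rw [le_div_iff₀ hs] at this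
    rw [hN]; push_cast; linarith
  have h3 := torusVolume_closedBall_le_mul_diff x y hN1 (by linarith)
  rw [← torusVolume_closedBall x] at h3
  have h4 : (torusVolume d).real (Metric.closedBall x ρx) ≤
      N * (torusVolume d).real (Metric.closedBall y ρy \ Metric.closedBall x ρx) := by
    have := ENNReal.toReal_mono (by finiteness) (h3.trans (mul_le_mul_right (measure_mono
      (Set.sdiff_subset_sdiff_left (Metric.closedBall_subset_closedBall hxy))) _))
    simpa [Measure.real] using this
  set D := Metric.closedBall y ρy \ Metric.closedBall x ρx
  calc lamMinus * (torusMeasure lam).real (Metric.closedBall x ρx) * s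
      ≤ lamMinus * (lamPlus * (N * (torusVolume d).real D)) * s := by
        gcongr
        exact (hreal _).trans (by gcongr)
    _ = (N * s) * lamPlus * (lamMinus * (torusVolume d).real D) := by ring
    _ ≤ _ := mul_le_mul (mul_le_mul_of_nonneg_right hN2 hp.le) (hreal' D) (by positivity)
        (mul_nonneg (mul_nonneg (by norm_num) (h0.trans hx)) hp.le)

/-- Since both balls have mass u, the two one-sided differences have equal mass. So the roles of x
and y can be exchanged to make the first radius the smaller one. -/
lemma mul_le_measureReal_closedBall_diff {x y : FlatTorus d} {ρx ρy r u : ℝ} (hx0 : 0 ≤ ρx)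
    (hy0 : 0 ≤ ρy) (hx : ρx ≤ r) (hy : ρy ≤ r) (hr : 8 * r ≤ 1) (hdist : dist x y ≤ 2 * r)
    (hux : (torusMeasure lam).real (Metric.closedBall x ρx) = u)
    (huy : (torusMeasure lam).real (Metric.closedBall y ρy) = u) :
    lamMinus * u * dist x y ≤ 4 * r * lamPlus *
        (torusMeasure lam).real (Metric.closedBall y ρy \ Metric.closedBall x ρx) := by
  rcases le_total ρx ρy with h | h
  · rw [← hux]
    exact mul_le_measureReal_closedBall_diff_of_le hm hlam hx0 h hx hr hdist
  · have := mul_le_measureReal_closedBall_diff_of_le hm hlam hy0 h hy hr (by rwa [dist_comm])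
    rw [huy, dist_comm] at this
    have h1 := measureReal_inter_add_sdiff (μ := torusMeasure lam) (s := Metric.closedBall x ρx)
      (measurableSet_closedBall (x := y) (ε := ρy))
    have h2 := measureReal_inter_add_sdiff (μ := torusMeasure lam) (s := Metric.closedBall y ρy)
      (measurableSet_closedBall (x := x) (ε := ρx))
    rw [hux] at h1
    rw [huy, Set.inter_comm] at h2
    rwa [show (torusMeasure lam).real (Metric.closedBall y ρy \ Metric.closedBall x ρx) =
      (torusMeasure lam).real (Metric.closedBall x ρx \ Metric.closedBall y ρy) by linarith]

/-- The expected number of pairs of exceedances in `I`. -/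
lemma pairBound_le (hd : 0 < d) {n k : ℕ} {b : ℝ} (hv : 0 < knnCentring n k + b)
    (hvn : knnCentring n k + b < n) {r : ℝ} (hr0 : 0 < r) (hr : 8 * r ≤ 1)
    (hball : ∀ x, massRadius (torusMeasure lam) x ((knnCentring n k + b) / n) ≤ r)
    (I : Set (FlatTorus d)) :
    pairBound (torusMeasure lam) n k b I ≤
      (n * ENNReal.ofReal (poissonTail k (knnCentring n k + b)) * torusMeasure lam I) ^ 2 +
      (n * ENNReal.ofReal (poissonTail k (knnCentring n k + b)) * torusMeasure lam I) *
        (n * 2 ^ k * (ENNReal.ofReal lamPlus * ENNReal.ofReal (2 /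
          (lamMinus * (knnCentring n k + b) / (8 * r * lamPlus))) ^ d * expLayerConst d)) := by
  set K := torusMeasure lam
  set v := knnCentring n k + b
  set p := ENNReal.ofReal (poissonTail k v)
  have hp : 0 < lamPlus := hm.trans_le ((hlam 0).1.trans (hlam 0).2)
  -- The sweep bound gives the difference set intensity at least 2c |x - y|; the halved exponent in
  -- `poissonTail_le` leaves c, which explains the 8.
  set c := lamMinus * v / (8 * r * lamPlus) with hc
  have hc0 : 0 < c := by positivity
  have hn : (0 : ℝ) < n := hv.trans hvn
  have hK : ∀ x r, K (Metric.sphere x r) = 0 := torusMeasure_sphere hd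
  have hspec := fun x => massRadius_spec (hK x) (div_pos hv hn) ((div_lt_one hn).2 hvn)
  -- Beyond distance 2r the level balls are disjoint and the second factor is the full tail p.
  -- Within 2r the sweep bound applies. The sum of the two bounds covers both cases.
  have hpt : ∀ x y, ENNReal.ofReal (poissonTail k (n * K.real (levelBall K n k b y \
      levelBall K n k b x))) ≤ p + 2 ^ k * ENNReal.ofReal (Real.exp (-(c * dist x y))) := fun x y => by
    rcases le_or_gt (dist x y) (2 * r) with h | h
    · refine le_trans ?_ le_add_self
      rw [show (2 : ℝ≥0∞) ^ k = ENNReal.ofReal (2 ^ k) by simp [ENNReal.ofReal_pow],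
        ← ENNReal.ofReal_mul (by positivity)]
      refine ENNReal.ofReal_le_ofReal ((poissonTail_le k (by positivity)).trans ?_)
      gcongr
      have h1 := mul_le_measureReal_closedBall_diff hm hlam (hspec x).1.le (hspec y).1.le (hball x)
        (hball y) hr h (hspec x).2.1 (hspec y).2.1
      have h2 : c * dist x y = n * (lamMinus * (v / n) * dist x y) / (8 * r * lamPlus) := by
        rw [hc]; field_simp
      rw [h2, div_le_iff₀ (by positivity)]
      calc _ ≤ n * (4 * r * lamPlus * K.real (levelBall K n k b y \ levelBall K n k b x)) := 
            mul_le_mul_of_nonneg_left h1 hn.le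
        _ = _ := by ring
    · refine le_trans (le_of_eq ?_) le_self_add
      have hdis : Disjoint (levelBall K n k b y) (levelBall K n k b x) :=
        Metric.closedBall_disjoint_closedBall (by
          rw [dist_comm]
          linarith [hball x, hball y])
      rw [hdis.sdiff_eq_left, measureReal_levelBall hK hv hvn]
  have hI' : ((n : ℝ≥0∞) • K) I = n * K I := rfl
  calc pairBound K n k b I ≤ ∫⁻ x in I, ∫⁻ y in I, p * (p + 2 ^ k *
          ENNReal.ofReal (Real.exp (-(c * dist x y)))) ∂((n : ℝ≥0∞) • K) ∂((n : ℝ≥0∞) • K) := by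
        unfold pairBound
        gcongr with x y
        exact hpt x y
    _ ≤ ∫⁻ x in I, p * (p * (n * K I) + n * 2 ^ k * (ENNReal.ofReal lamPlus *
          ENNReal.ofReal (2 / c) ^ d * expLayerConst d)) ∂((n : ℝ≥0∞) • K) := by
        gcongr with x
        have hme : Measurable fun y => ENNReal.ofReal (Real.exp (-(c * dist x y))) := by fun_prop
        rw [lintegral_const_mul' _ _ ENNReal.ofReal_ne_top, lintegral_add_left measurable_const,
          setLIntegral_const, hI', lintegral_const_mul' _ _ (by simp)]
        gcongr p * (_ + ?_)
        rw [mul_comm (n : ℝ≥0∞), mul_assoc]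
        gcongr
        refine (setLIntegral_le_lintegral _ _).trans ?_
        rw [lintegral_smul_measure, smul_eq_mul]
        gcongr
        exact lintegral_exp_neg_dist_le hlam x hc0
    _ = _ := by
        rw [setLIntegral_const, hI']
        ring

end Sweep

/-! ### Decomposition of the torus into slabs -/

section Slab

variable {d : ℕ}

/-- The points whose `i`-th coordinate is within `w` of the centre of the `j`-th of `m` arcs. -/
def slab (i : Fin d) (m : ℕ) (w : ℝ) (j : Fin m) : Set (FlatTorus d) :=
  {x | dist (x i) (((j + 1 / 2 : ℝ) / m : ℝ) : UnitAddCircle) ≤ w}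

variable (i : Fin d) {m : ℕ}

lemma measurableSet_slab (w : ℝ) (j : Fin m) : MeasurableSet (slab i m w j) := by
  have : Measurable fun x : FlatTorus d => x i := by fun_prop
  exact measurableSet_le (this.dist measurable_const) measurable_const

lemma torusVolume_slab {w : ℝ} (hw1 : 2 * w ≤ 1) (j : Fin m) :
    torusVolume d (slab i m w j) = ENNReal.ofReal (2 * w) := by
  rw [torusVolume_apply (measurableSet_slab i w j)]
  have e : (WithLp.toLp 2 ⁻¹' slab i m w j : Set (Fin d → UnitAddCircle)) =
      Function.eval i ⁻¹' Metric.closedBall (((j + 1 / 2 : ℝ) / m : ℝ) : UnitAddCircle) w := rfl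
  rw [e, volume_pi, (measurePreserving_eval (fun _ : Fin d => (volume : Measure UnitAddCircle)) i).measure_preimage
    measurableSet_closedBall.nullMeasurableSet, AddCircle.volume_closedBall, min_eq_right hw1]

lemma closedBall_subset_slab {x : FlatTorus d} {w r : ℝ} {j : Fin m} (hx : x ∈ slab i m w j) :
    Metric.closedBall x r ⊆ slab i m (w + r) j := fun y hy => by
  have h1 := (FlatTorus.dist_apply_le y x i).trans hy
  have h2 : dist (x i) _ ≤ w := hx
  exact (dist_triangle (y i) (x i) _).trans (by linarith)

/-- Centres of different slabs are at least 1/m apart on the circle, which exceeds 2w. -/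
lemma disjoint_slab {w : ℝ} (hw : 2 * w * m < 1) : Pairwise fun j l => Disjoint (slab i m w j) (slab i m w l) := by
  intro j l hjl
  refine Set.disjoint_left.2 fun x hj hl => ?_
  have hm : 0 < m := j.pos
  have hmr : (0 : ℝ) < m := by exact_mod_cast hm
  have h1 : dist (((j + 1 / 2 : ℝ) / m : ℝ) : UnitAddCircle) (((l + 1 / 2 : ℝ) / m : ℝ) : UnitAddCircle)
      ≤ 2 * w := by
    have h1 : dist (x i) _ ≤ w := hj
    have h2 : dist (x i) _ ≤ w := hl
    have := dist_triangle_left (((j + 1 / 2 : ℝ) / m : ℝ) : UnitAddCircle) (((l + 1 / 2 : ℝ) / m : ℝ) : UnitAddCircle) (x i)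
    linarith
  rw [dist_eq_norm, ← AddCircle.coe_sub, UnitAddCircle.norm_eq] at h1
  set a : ℝ := (j + 1 / 2 : ℝ) / m - (l + 1 / 2 : ℝ) / m with ha
  -- Scaled by m, the signed distance of the centres is an integer. If it is below 1 in absolute
  -- value, it vanishes, so m divides j - l and the indices agree.
  have h2 : m * (a - round a) = (((j : ℤ) - l - m * round a : ℤ) : ℝ) := by
    rw [ha]; push_cast; field_simp; ring
  have h3 : |(((j : ℤ) - l - m * round a : ℤ) : ℝ)| < 1 := by
    rw [← h2, abs_mul, abs_of_pos hmr]
    nlinarith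
  have h4 : (j : ℤ) - l - m * round a = 0 := by
    rw [← Int.cast_abs] at h3
    exact Int.abs_lt_one_iff.1 (by exact_mod_cast h3)
  have h5 : (m : ℤ) ∣ (j : ℤ) - l := ⟨round a, by lia⟩
  refine hjl (Fin.ext ?_)
  have hj' : ((j : ℕ) : ℤ) < m := by exact_mod_cast j.isLt
  have hl' : ((l : ℕ) : ℤ) < m := by exact_mod_cast l.isLt
  have h6 := Int.eq_zero_of_abs_lt_dvd h5 (by rw [abs_lt]; constructor <;> linarith)
  exact_mod_cast sub_eq_zero.1 h6

/-- Each of the m arcs has length 1/m and gives up 2r at both ends. Enlarging the slabs by r then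
still leaves them disjoint. -/
lemma torusVolume_compl_slab {r : ℝ} (hr : 0 < r) (hm : 0 < m) (hmr : 4 * m * r ≤ 1) :
    torusVolume d (⋃ j, slab i m (1 / (2 * m) - 2 * r) j)ᶜ = ENNReal.ofReal (4 * m * r) := by
  have hm' : (1 : ℝ) ≤ m := by exact_mod_cast hm
  have hw : 2 * (1 / (2 * (m : ℝ)) - 2 * r) * m = 1 - 4 * m * r := by field_simp; ring
  have h0 : 0 ≤ 1 / (2 * (m : ℝ)) - 2 * r := by
    by_contra! h
    nlinarith
  have h1 : 2 * (1 / (2 * (m : ℝ)) - 2 * r) ≤ 1 := by nlinarith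
  have hpos : 0 < 4 * m * r := by positivity
  rw [prob_compl_eq_one_sub (MeasurableSet.iUnion fun j => measurableSet_slab i _ j),
    measure_iUnion (disjoint_slab i (by linarith)) (fun j => measurableSet_slab i _ j), tsum_fintype]
  simp only [torusVolume_slab i h1]
  rw [Finset.sum_const, Finset.card_univ, Fintype.card_fin, nsmul_eq_mul, ← ENNReal.ofReal_natCast,
    ← ENNReal.ofReal_mul (by positivity), mul_comm, hw, ← ENNReal.ofReal_one,
    ← ENNReal.ofReal_sub _ (by linarith)]
  congr 1; ring

end Slab

/-! ### The approximation error with slabs as blocks -/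

section SlabBound

variable {d : ℕ} {lam : FlatTorus d → ℝ} {lamMinus lamPlus : ℝ}
  {n k : ℕ} {b : ℝ} {Ω : Type*} [MeasurableSpace Ω] {P : Measure Ω} [IsProbabilityMeasure P]
  {η : Ω → FiniteConfig (FlatTorus d)}
  {Ω' : Type*} [MeasurableSpace Ω'] {P' : Measure Ω'} [IsProbabilityMeasure P']
  {ζ : Ω' → FiniteConfig (FlatTorus d × ℝ)}

/-- The error of the Poisson approximation, in terms of the quantities which control it: the expected
number `A` of exceedances, the volume `κ` of the corridors, the bound `B` on the volumes of the
blocks, the expected number `Q` of exceedances near a given one, the error `e` of the intensity,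
and the expected number `q` of points whose neighbourhood is sparse. -/
def slabError (b : ℝ) (A κ B Q e q : ℝ≥0∞) : ℝ≥0∞ :=
  (A * κ + q) + (2 * (A ^ 2 * B + A * Q) + 2 * (ENNReal.ofReal (Real.exp (-b)) ^ 2 * B) +
    2 * (e + q)) + ENNReal.ofReal (Real.exp (-b)) * κ

/-- The error is homogeneous of degree one in all arguments except A, so a common rate x can be
pulled out once A is bounded. -/
lemma slabError_le {b : ℝ} {A κ B Q e q : ℝ≥0∞} {κ' B' Q' e' q' x : ℝ≥0∞} (h1 : κ ≤ κ' * x)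
    (h2 : B ≤ B' * x) (h3 : Q ≤ Q' * x) (h4 : e ≤ e' * x) (h5 : q ≤ q' * x) :
    slabError b A κ B Q e q ≤ slabError b A κ' B' Q' e' q' * x := by
  calc _ ≤ slabError b A (κ' * x) (B' * x) (Q' * x) (e' * x) (q' * x) := by
        unfold slabError; gcongr
    _ = _ := by unfold slabError; ring

lemma slabError_ne_top {b : ℝ} {A κ B Q e q : ℝ≥0∞} (h0 : A ≠ ∞) (h1 : κ ≠ ∞) (h2 : B ≠ ∞)
    (h3 : Q ≠ ∞) (h4 : e ≠ ∞) (h5 : q ≠ ∞) : slabError b A κ B Q e q ≠ ∞ := by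
  unfold slabError; finiteness

/-- Poisson approximation of the exceedances, using slabs as blocks. -/
theorem abs_expect_blockConfig_sub_le_slabError (hm : 0 < lamMinus)
    (hlam : ∀ x, lamMinus ≤ lam x ∧ lam x ≤ lamPlus) [IsProbabilityMeasure (torusMeasure lam)]
    (hη : Measurable η)
    (h : IsPoissonProcess (fun ω => (η ω).1) ((n : ℝ≥0∞) • torusMeasure lam) P)
    (hζ : Measurable ζ)
    (h' : IsPoissonProcess (fun ω => (ζ ω).1) ((torusMeasure lam).prod (levelLaw b)) P')
    (hd : 0 < d) (hn : 2 ≤ n) (hk : 1 ≤ k)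
    (hv : 0 < knnCentring n k + b) (hvn : knnCentring n k + b < n) {r : ℝ} (hr : 0 < r)
    (hr8 : 8 * r ≤ 1)
    (hball : ∀ x, massRadius (torusMeasure lam) x ((knnCentring n k + b) / n) ≤ r) {pr A : ℝ≥0∞}
    (hpr : ∀ x, ENNReal.ofReal
      (poissonTail k (n * (torusMeasure lam).real (Metric.closedBall x r))) ≤ pr)
    (hA : n * ENNReal.ofReal (poissonTail k (knnCentring n k + b)) ≤ A)
    {m : ℕ} (hm0 : 0 < m) (hmr : 4 * m * r ≤ 1)
    {g : FiniteConfig (FlatTorus d × ℝ) → ℝ} (hg : TVLip g) :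
    ENNReal.ofReal |(∫ ω, g (blockConfig (torusMeasure lam) n k b .univ .univ (η ω)) ∂P) -
        ∫ ω, g (ζ ω) ∂P'| ≤
      slabError b A (ENNReal.ofReal lamPlus * ENNReal.ofReal (4 * m * r))
        (ENNReal.ofReal lamPlus * ENNReal.ofReal (1 / m))
        (n * 2 ^ k * (ENNReal.ofReal lamPlus * ENNReal.ofReal (2 /
          (lamMinus * (knnCentring n k + b) / (8 * r * lamPlus))) ^ d * expLayerConst d))
        (erlangError n k b) (n * pr) := by
  set K := torusMeasure lam
  set i : Fin d := ⟨0, hd⟩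
  set w := 1 / (2 * (m : ℝ)) - 2 * r with hw
  set Q := n * 2 ^ k * (ENNReal.ofReal lamPlus * ENNReal.ofReal (2 /
          (lamMinus * (knnCentring n k + b) / (8 * r * lamPlus))) ^ d * expLayerConst d)
  have hm' : (1 : ℝ) ≤ m := by exact_mod_cast hm0
  have hwm : 2 * w * m = 1 - 4 * m * r := by rw [hw]; field_simp; ring
  have hmr' : 0 < m * r := by positivity
  have hI : ∀ j, MeasurableSet (slab i m w j) := measurableSet_slab i w
  have key := abs_expect_blockConfig_univ_sub_le hη h hζ h' (torusMeasure_sphere hd) hn hk hv hvn hr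
    (fun x => Metric.closedBall_subset_closedBall (hball x)) hpr hI (measurableSet_slab i (w + r))
    (fun j x hx => closedBall_subset_slab i hx) (disjoint_slab i (by linarith)) hg
  have hcorr : K (⋃ j, slab i m w j)ᶜ ≤ ENNReal.ofReal lamPlus * ENNReal.ofReal (4 * m * r) := by
    rw [← torusVolume_compl_slab i hr hm0 hmr]
    exact torusMeasure_le (fun x => (hlam x).2) _
  have hw1 : 2 * w ≤ 1 / m := by rw [hw]; field_simp; linarith
  have hKI : ∀ j, K (slab i m w j) ≤ ENNReal.ofReal lamPlus * ENNReal.ofReal (1 / m) := fun j => by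
    refine (torusMeasure_le (fun x => (hlam x).2) _).trans ?_
    rw [torusVolume_slab i (hw1.trans (by rw [div_le_one (by positivity)]; exact hm'))]
    gcongr
  have hsum : ∑ j, K (slab i m w j) ≤ 1 := by
    have e := measure_iUnion (μ := K) (disjoint_slab i (by linarith)) hI
    rw [tsum_fintype] at e
    rw [← e]
    exact prob_le_one
  -- Every term carries one factor K(I), which sums to at most 1 over the slabs. The second factor
  -- in the squares is bounded by the maximal mass of a slab.
  have hblock : ∀ j, blockError K n k b pr (slab i m w j) ≤
      (2 * (A ^ 2 * (ENNReal.ofReal lamPlus * ENNReal.ofReal (1 / m)) + A * Q) +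
        2 * (ENNReal.ofReal (Real.exp (-b)) ^ 2 * (ENNReal.ofReal lamPlus * ENNReal.ofReal (1 / m))) +
        2 * (erlangError n k b + n * pr)) * K (slab i m w j) := fun j => by
    unfold blockError
    calc _ ≤ 2 * ((A * K (slab i m w j)) ^ 2 + (A * K (slab i m w j)) * Q) +
          2 * (ENNReal.ofReal (Real.exp (-b)) * K (slab i m w j)) ^ 2 +
          2 * ((erlangError n k b + n * pr) * K (slab i m w j)) := by
          gcongr
          refine (pairBound_le hm hlam hd hv hvn hr hr8 hball _).trans ?_
          gcongr
      _ = (2 * (A ^ 2 * K (slab i m w j) + A * Q) +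
          2 * (ENNReal.ofReal (Real.exp (-b)) ^ 2 * K (slab i m w j)) +
          2 * (erlangError n k b + n * pr)) * K (slab i m w j) := by ring
      _ ≤ _ := by gcongr <;> exact hKI j
  refine key.trans ?_
  unfold slabError
  gcongr
  refine (Finset.sum_le_sum fun j _ => hblock j).trans ?_
  rw [← Finset.mul_sum]
  exact (mul_le_mul_right hsum _).trans_eq (mul_one _)

end SlabBound

/-! ### Asymptotics -/

section Asymptotics

/-- The expected number of exceedances is bounded. -/
lemma mul_poissonTail_le {n k : ℕ} (hn : 2 ≤ n) (hk : 1 ≤ k) {b : ℝ}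
    (hL : 1 ≤ Real.log n) (hv : 0 ≤ knnCentring n k + b)
    (hv2 : knnCentring n k + b ≤ 2 * Real.log n) :
    n * poissonTail k (knnCentring n k + b) ≤
      Real.exp (-b) * (k - 1).factorial * (k * 2 ^ (k - 1)) := by
  have hn0 : (0 : ℝ) < n := by positivity
  have h1 : ∑ j ∈ Finset.range k, (knnCentring n k + b) ^ j / (j.factorial : ℝ) ≤
      k * (2 * Real.log n) ^ (k - 1) := by
    refine (Finset.sum_le_card_nsmul _ _ ((2 * Real.log n) ^ (k - 1)) fun j hj => ?_).trans_eq (by simp)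
    have hj' : j ≤ k - 1 := by have := Finset.mem_range.1 hj; lia
    calc _ ≤ (knnCentring n k + b) ^ j := div_le_self (by positivity)
          (by exact_mod_cast j.factorial_pos)
      _ ≤ (2 * Real.log n) ^ j := by gcongr
      _ ≤ _ := pow_le_pow_right₀ (by linarith) hj'
  rw [poissonTail, neg_add, Real.exp_add, exp_neg_knnCentring hn hk]
  calc _ ≤ n * (((k - 1).factorial : ℝ) / (n * Real.log n ^ (k - 1)) * Real.exp (-b) *
        (k * (2 * Real.log n) ^ (k - 1))) := by gcongr
    _ = _ := by
      have : 0 < Real.log n := by linarith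
      rw [mul_pow]
      field_simp

/-- The constant in the bound for the error of the intensity. -/
def erlangConst (k : ℕ) (b : ℝ) : ℝ≥0∞ :=
  ENNReal.ofReal (8 * 2 ^ k) + ∫⁻ t in Set.Ioi b, ENNReal.ofReal
    (k * ((k + Real.log (k - 1).factorial + 1 + |t|) ^ k * Real.exp (-t)))

/-- A power is dominated by e^{t/2}, so the integrand decays at least like e^{-t/2}. -/
lemma integrableOn_add_abs_pow_mul_exp_neg (a b : ℝ) (k : ℕ) :
    IntegrableOn (fun t => (a + |t|) ^ k * Real.exp (-t)) (Set.Ioi b) := by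
  refine integrable_of_isBigO_exp_neg (b := 1 / 2) (by norm_num) (by fun_prop) ?_
  refine Asymptotics.IsBigO.of_bound (k.factorial * 2 ^ k * Real.exp (|a| / 2)) ?_
  filter_upwards [eventually_ge_atTop 0] with t ht
  have h1 := Real.pow_div_factorial_le_exp (x := (|a| + t) / 2) (by positivity) k
  have h2 : |a + t| ≤ |a| + t := (abs_add_le _ _).trans (by rw [abs_of_nonneg ht])
  rw [div_le_iff₀ (by positivity), div_pow, div_le_iff₀ (by positivity)] at h1
  rw [Real.norm_eq_abs, Real.norm_eq_abs, abs_mul, Real.abs_exp, Real.abs_exp, abs_pow, abs_of_nonneg ht]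
  calc |a + t| ^ k * Real.exp (-t) ≤ (|a| + t) ^ k * Real.exp (-t) := by gcongr
    _ ≤ (Real.exp ((|a| + t) / 2) * k.factorial * 2 ^ k) * Real.exp (-t) := by gcongr
    _ = k.factorial * 2 ^ k * (Real.exp ((|a| + t) / 2) * Real.exp (-t)) := by ring
    _ = k.factorial * 2 ^ k * (Real.exp (|a| / 2) * Real.exp (-(1 / 2) * t)) := by
        rw [← Real.exp_add, ← Real.exp_add]; ring_nf
    _ = _ := by ring

lemma erlangConst_ne_top (k : ℕ) (b : ℝ) : erlangConst k b ≠ ∞ := by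
  unfold erlangConst
  have h := (integrableOn_add_abs_pow_mul_exp_neg (k + Real.log (k - 1).factorial + 1) b k).const_mul k
  have := h.lintegral_lt_top
  finiteness

/-- This is the source of the rate: (a_n + t)/log n - 1 = ((k - 1) log log n - log (k - 1)! + t)/log
n. The assumption log log n ≥ 1 absorbs the terms without log log n, and a mean value bound handles
the power k - 1. -/
lemma abs_knnRatio_sub_one_le {n k : ℕ} (hk : 1 ≤ k) (hl : 1 ≤ Real.log (Real.log n)) (t : ℝ) :
    |knnRatio n k t - 1| ≤ k * (k + Real.log (k - 1).factorial + 1 + |t|) ^ k *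
      (Real.log (Real.log n) / Real.log n) := by
  have hL : 0 < Real.log n := by
    refine lt_of_le_of_ne (Real.log_natCast_nonneg n) fun h => ?_
    rw [← h, Real.log_zero] at hl
    linarith
  set L := Real.log n
  set l := Real.log L
  have hlL : l ≤ L := (Real.log_le_sub_one_of_pos hL).trans (by linarith)
  set a : ℝ := k + Real.log (k - 1).factorial + |t| with ha
  have hf : 0 ≤ Real.log ((k - 1).factorial : ℝ) :=
    Real.log_nonneg (by exact_mod_cast (k - 1).factorial_pos)
  have hk' : (1 : ℝ) ≤ k := by exact_mod_cast hk
  set u := (knnCentring n k + t) / L - 1 with hu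
  have hu1 : |u| ≤ a * (l / L) := by
    have e : u = ((k - 1) * l - Real.log (k - 1).factorial + t) / L := by
      rw [hu, knnCentring]; field_simp; ring
    rw [e, abs_div, abs_of_pos hL, mul_div_assoc']
    gcongr
    have h1 : |((k : ℝ) - 1) * l - Real.log (k - 1).factorial + t| ≤
        (k - 1) * l + Real.log (k - 1).factorial + |t| := by
      refine (abs_add_le _ _).trans (add_le_add_left ((abs_sub _ _).trans ?_) _)
      rw [abs_of_nonneg (mul_nonneg (by linarith) (by linarith)), abs_of_nonneg hf]
    refine h1.trans ?_
    rw [ha]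
    nlinarith [abs_nonneg t]
  have ha0 : 0 ≤ a := by positivity
  have hlL' : l / L ≤ 1 := (div_le_one hL).2 hlL
  have hlL0 : 0 ≤ l / L := by positivity
  have hua : |u| ≤ a := hu1.trans (mul_le_of_le_one_right ha0 hlL')
  have hmax : max |u + 1| |(1 : ℝ)| ≤ a + 1 :=
    max_le ((abs_add_le _ _).trans (by rw [abs_one]; linarith)) (by rw [abs_one]; linarith)
  have e1 : knnRatio n k t = (u + 1) ^ (k - 1) := by rw [knnRatio, hu, sub_add_cancel]
  have e2 : (k : ℝ) + Real.log (k - 1).factorial + 1 + |t| = a + 1 := by rw [ha]; ring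
  rw [e1, e2]
  have h1 := abs_pow_sub_pow_le (u + 1) 1 (k - 1)
  rw [one_pow, add_sub_cancel_right] at h1
  refine h1.trans ?_
  calc |u| * ((k - 1 : ℕ) : ℝ) * max |u + 1| |1| ^ (k - 1 - 1)
      ≤ ((a + 1) * (l / L)) * k * (a + 1) ^ (k - 1) := by
        have h2 : max |u + 1| |(1 : ℝ)| ^ (k - 1 - 1) ≤ (a + 1) ^ (k - 1) :=
          (pow_le_pow_left₀ (by positivity) hmax _).trans
            (pow_le_pow_right₀ (by linarith) (by lia))
        have h3 : ((k - 1 : ℕ) : ℝ) ≤ k := by exact_mod_cast Nat.sub_le k 1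
        have h4 : |u| ≤ (a + 1) * (l / L) := hu1.trans (by gcongr; linarith)
        gcongr
    _ = k * ((a + 1) * (a + 1) ^ (k - 1)) * (l / L) := by ring
    _ = _ := by rw [← pow_succ', Nat.sub_add_cancel hk]

lemma erlangError_le {n k : ℕ} (hk : 1 ≤ k) (hl : 1 ≤ Real.log (Real.log n)) (hL : 0 < Real.log n)
    (b : ℝ) : erlangError n k b ≤
      erlangConst k b * ENNReal.ofReal (Real.log (Real.log n) / Real.log n) := by
  have hn : (0 : ℝ) < n := by
    rcases Nat.eq_zero_or_pos n with rfl | h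
    · simp at hL
    · exact_mod_cast h
  have hLn : Real.log n ≤ n := (Real.log_le_sub_one_of_pos hn).trans (by linarith)
  unfold erlangError erlangConst
  rw [add_mul]
  refine add_le_add ?_ ?_
  · rw [← ENNReal.ofReal_natCast, ← ENNReal.ofReal_mul hn.le, ← ENNReal.ofReal_mul (by positivity)]
    refine ENNReal.ofReal_le_ofReal ?_
    -- The quadratic Taylor term n²/8 ≤ e^{n/2} gives n² e^{-n/2} ≤ 8, hence the constant 8.
    have h1 := Real.pow_div_factorial_le_exp (x := (n : ℝ) / 2) (by positivity) 2
    have h2 : Real.exp (-((n : ℝ) / 2)) * Real.exp ((n : ℝ) / 2) = 1 := by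
      rw [← Real.exp_add]; simp
    have h3 : (n : ℝ) * (n * Real.exp (-((n : ℝ) / 2))) ≤ 8 := by
      have h4 : (n : ℝ) ^ 2 / 8 ≤ Real.exp ((n : ℝ) / 2) := by
        refine le_trans (le_of_eq ?_) h1
        norm_num [Nat.factorial]; ring
      nlinarith [Real.exp_pos (-((n : ℝ) / 2))]
    calc n * poissonTail k n ≤ n * (2 ^ k * Real.exp (-((n : ℝ) / 2))) := by
          gcongr
          exact poissonTail_le k hn.le
      _ = 2 ^ k * (n * Real.exp (-((n : ℝ) / 2))) := by ring
      _ ≤ 2 ^ k * (8 / n) := by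
          gcongr
          rwa [le_div_iff₀' hn]
      _ = 8 * 2 ^ k * (1 / n) := by ring
      _ ≤ _ := by gcongr
  · rw [← lintegral_mul_const _ (by fun_prop)]
    refine lintegral_mono fun t => ?_
    have h0 : 0 ≤ Real.log (Real.log n) / Real.log n := div_nonneg (by linarith) hL.le
    rw [← ENNReal.ofReal_mul']
    · refine ENNReal.ofReal_le_ofReal ?_
      calc _ ≤ Real.exp (-t) * (k * (k + Real.log (k - 1).factorial + 1 + |t|) ^ k *
            (Real.log (Real.log n) / Real.log n)) := by
            gcongr
            exact abs_knnRatio_sub_one_le hk hl t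
        _ = _ := by ring
    · exact h0

end Asymptotics

/-! ### The bound for large intensities -/

/-- A radius which exceeds those of all relevant nearest neighbour balls. -/
def knnScale (d : ℕ) (lamMinus : ℝ) (n : ℕ) : ℝ :=
  d / 2 * (4 * Real.log n / (lamMinus * n)) ^ (d : ℝ)⁻¹

/-- The intensities for which the asymptotic regime is reached. -/
structure IsLargeIntensity (d k : ℕ) (lamMinus b : ℝ) (n : ℕ) : Prop where
  loglog : 1 ≤ Real.log (Real.log n)
  le_level : Real.log n / 2 ≤ knnCentring n k + b
  level_le : knnCentring n k + b ≤ 2 * Real.log n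
  scale : 16 * Real.log n ^ 2 * knnScale d lamMinus n ≤ 1
  log_lt : 2 * Real.log n < n

lemma tendsto_log_natCast : Tendsto (fun n : ℕ => Real.log n) atTop atTop :=
  Real.tendsto_log_atTop.comp tendsto_natCast_atTop_atTop

section Scale

variable {d n : ℕ} {lamMinus : ℝ}

/-- The cube of side 2r/d inside the ball of radius r has volume 4 log n / (λ₋ n), so the ball has
intensity at least 4 log n: twice what the largest level requires. -/
lemma knnScale_pow (hd : d ≠ 0) (hm : 0 < lamMinus) (n : ℕ) :
    knnScale d lamMinus n ^ d = (d / 2) ^ d * (4 * Real.log n / (lamMinus * n)) := by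
  have : 0 ≤ Real.log n := Real.log_natCast_nonneg n
  rw [knnScale, mul_pow, Real.rpow_inv_natCast_pow (by positivity) hd]

lemma knnScale_nonneg (hm : 0 < lamMinus) (n : ℕ) : 0 ≤ knnScale d lamMinus n := by
  have : 0 ≤ Real.log n := Real.log_natCast_nonneg n
  unfold knnScale
  positivity

end Scale

/-- Two comparisons are involved: log log n is negligible against log n, and powers of log n are
negligible against n. -/
lemma eventually_isLargeIntensity {d : ℕ} (hd : d ≠ 0) {lamMinus : ℝ} (hm : 0 < lamMinus) (k : ℕ)
    (b : ℝ) : ∀ᶠ n : ℕ in atTop, IsLargeIntensity d k lamMinus b n := by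
  have hcast := tendsto_natCast_atTop_atTop (R := ℝ)
  have hlog := tendsto_log_natCast
  set c₀ := b - Real.log ((k - 1).factorial : ℝ) with hc₀
  have h1 := (Real.tendsto_log_atTop.comp hlog).eventually_ge_atTop 1
  have h2 : ∀ᶠ n : ℕ in atTop, |((k : ℝ) - 1)| * Real.log (Real.log n) ≤ Real.log n / 4 := by
    have := (Real.isLittleO_log_id_atTop.const_mul_left |((k : ℝ) - 1)|).bound
      (show (0 : ℝ) < 1 / 4 by norm_num)
    filter_upwards [hlog.eventually this, hlog.eventually_ge_atTop 0] with n hn hn0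
    refine (le_abs_self _).trans (hn.trans_eq ?_)
    rw [id, Real.norm_eq_abs, abs_of_nonneg hn0]; ring
  have h3 := hlog.eventually_ge_atTop (4 * |c₀|)
  have h4 : ∀ᶠ n : ℕ in atTop, 2 * Real.log n < n := by
    have := (Real.isLittleO_log_id_atTop.const_mul_left 2).bound (show (0 : ℝ) < 1 / 2 by norm_num)
    filter_upwards [hcast.eventually this, eventually_gt_atTop 0] with n hn hn0
    have h0 : (0 : ℝ) < n := by exact_mod_cast hn0
    rw [id, Real.norm_eq_abs, Real.norm_eq_abs, abs_of_pos h0] at hn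
    linarith [le_abs_self (2 * Real.log n)]
  have h5 : ∀ᶠ n : ℕ in atTop,
      16 ^ d * (d / 2) ^ d * (4 / lamMinus) * Real.log n ^ (2 * d + 1) ≤ n := by
    have := ((Real.isLittleO_pow_log_id_atTop (n := 2 * d + 1)).const_mul_left
      (16 ^ d * (d / 2) ^ d * (4 / lamMinus))).bound one_pos
    filter_upwards [hcast.eventually this] with n hn
    refine (le_abs_self _).trans (hn.trans_eq ?_)
    rw [id, Real.norm_eq_abs, abs_of_nonneg (Nat.cast_nonneg n), one_mul]
  filter_upwards [h1, h2, h3, h4, h5, eventually_gt_atTop 0] with n g1 g2 g3 g4 g5 g6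
  have hn : (0 : ℝ) < n := by exact_mod_cast g6
  have hL : 0 ≤ Real.log n := Real.log_natCast_nonneg n
  have g1' : (0 : ℝ) ≤ Real.log (Real.log n) := zero_le_one.trans g1
  have e : knnCentring n k + b = Real.log n + ((k - 1) * Real.log (Real.log n) + c₀) := by
    rw [knnCentring, hc₀]; ring
  have g7 : |((k : ℝ) - 1) * Real.log (Real.log n) + c₀| ≤ Real.log n / 2 := by
    refine (abs_add_le _ _).trans ?_
    rw [abs_mul, abs_of_nonneg g1']
    linarith
  obtain ⟨g8, g9⟩ := abs_le.1 g7
  refine ⟨g1, by linarith, by linarith, ?_, g4⟩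
  have h0 := knnScale_nonneg (d := d) hm n
  -- The d-th power removes the root in the scale; what remains is a power of log n against n.
  rw [← pow_le_one_iff_of_nonneg (by positivity) hd, mul_pow, mul_pow, knnScale_pow hd hm]
  calc _ = 16 ^ d * (d / 2) ^ d * (4 / lamMinus) * Real.log n ^ (2 * d + 1) / n := by
        field_simp
        ring
    _ ≤ 1 := (div_le_one hn).2 g5

/-- The constant in the bound for large intensities. -/
def largeConst (d k : ℕ) (lamMinus lamPlus b : ℝ) : ℝ≥0∞ :=
  slabError b (ENNReal.ofReal (Real.exp (-b) * (k - 1).factorial * (k * 2 ^ (k - 1))))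
    (ENNReal.ofReal lamPlus) (ENNReal.ofReal lamPlus)
    (2 ^ k * (ENNReal.ofReal lamPlus * expLayerConst d) *
      ENNReal.ofReal ((32 * lamPlus / lamMinus) ^ d * ((d / 2) ^ d * (4 / lamMinus))))
    (erlangConst k b) (ENNReal.ofReal (2 ^ k))

lemma largeConst_ne_top (d k : ℕ) (lamMinus lamPlus b : ℝ) :
    largeConst d k lamMinus lamPlus b ≠ ∞ := by
  have := expLayerConst_ne_top d
  have := erlangConst_ne_top k b
  exact slabError_ne_top (by finiteness) (by finiteness) (by finiteness) (by finiteness)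
    (by finiteness) (by finiteness)

/-- The slab bound is used with radius `knnScale` and about log n slabs. The intensity error is of
order log log n / log n; each other error is at most a constant over log n, which is smaller because
log log n ≥ 1. -/
theorem abs_expect_blockConfig_sub_le_of_large {d n k : ℕ} {lam : FlatTorus d → ℝ}
    {lamMinus lamPlus b : ℝ} {Ω : Type*} [MeasurableSpace Ω] {P : Measure Ω} [IsProbabilityMeasure P]
    {η : Ω → FiniteConfig (FlatTorus d)}
    {Ω' : Type*} [MeasurableSpace Ω'] {P' : Measure Ω'} [IsProbabilityMeasure P']
    {ζ : Ω' → FiniteConfig (FlatTorus d × ℝ)} (hm : 0 < lamMinus)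
    (hlam : ∀ x, lamMinus ≤ lam x ∧ lam x ≤ lamPlus) [IsProbabilityMeasure (torusMeasure lam)]
    (hη : Measurable η)
    (h : IsPoissonProcess (fun ω => (η ω).1) ((n : ℝ≥0∞) • torusMeasure lam) P)
    (hζ : Measurable ζ)
    (h' : IsPoissonProcess (fun ω => (ζ ω).1) ((torusMeasure lam).prod (levelLaw b)) P')
    (hd : 2 ≤ d) (hk : 1 ≤ k) (hn : IsLargeIntensity d k lamMinus b n)
    {g : FiniteConfig (FlatTorus d × ℝ) → ℝ} (hg : TVLip g) :
    ENNReal.ofReal |(∫ ω, g (blockConfig (torusMeasure lam) n k b .univ .univ (η ω)) ∂P) -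
        ∫ ω, g (ζ ω) ∂P'| ≤
      largeConst d k lamMinus lamPlus b * ENNReal.ofReal (Real.log (Real.log n) / Real.log n) := by
  obtain ⟨hl, hv1, hv2, hsc, hLn⟩ := hn
  have hp : 0 < lamPlus := hm.trans_le ((hlam 0).1.trans (hlam 0).2)
  have hd0 : d ≠ 0 := by lia
  have hdR : (2 : ℝ) ≤ d := by exact_mod_cast hd
  have hL0 : 0 < Real.log n := by
    refine lt_of_le_of_ne (Real.log_natCast_nonneg n) fun h => ?_
    rw [← h, Real.log_zero] at hl
    linarith
  set r := knnScale d lamMinus n with hr_def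
  set L := Real.log n with hL_def
  set l := Real.log L
  have hL1 : 1 ≤ L := by
    have : l ≤ L - 1 := Real.log_le_sub_one_of_pos hL0
    linarith
  have hnR : (0 : ℝ) < n := by linarith
  have hn2 : 2 ≤ n := by
    have : (2 : ℝ) < n := by linarith
    exact_mod_cast this.le
  have hr : 0 < r := by
    rw [hr_def, knnScale]; positivity
  have hr8 : 8 * r ≤ 1 := by nlinarith
  have hLr : 8 * L * r ≤ 1 / (2 * L) := by
    rw [le_div_iff₀ (by positivity)]; nlinarith
  set v := knnCentring n k + b
  have hv : 0 < v := by linarith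
  have hvn : v < n := by linarith
  have hrd : r ^ d = (d / 2) ^ d * (4 * L / (lamMinus * n)) := knnScale_pow hd0 hm n
  have hx : ENNReal.ofReal (1 / L) ≤ ENNReal.ofReal (l / L) := by gcongr
  have hmass : ∀ x, 4 * L ≤ n * (torusMeasure lam).real (Metric.closedBall x r) := fun x => by
    have h1 : 2 * (r / d) ≤ 1 := by
      rw [← mul_div_assoc, div_le_one (by positivity)]; linarith
    have h2 := (mul_le_mul_right (le_torusVolume_closedBall x hr.le (by lia) h1)
      (ENNReal.ofReal lamMinus)).trans (le_torusMeasure (fun x => (hlam x).1) _)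
    rw [← ENNReal.ofReal_pow (by positivity), ← ENNReal.ofReal_mul hm.le,
      ENNReal.ofReal_le_iff_le_toReal (by finiteness)] at h2
    have h3 : lamMinus * (2 * (r / d)) ^ d = 4 * L / n := by
      rw [show 2 * (r / d) = r / (d / 2) by field_simp, div_pow, hrd]
      field_simp
    rw [h3, div_le_iff₀' hnR] at h2
    exact h2
  have hK := torusMeasure_sphere (lam := lam) (by lia : 0 < d)
  -- A ball of mass v/n with v ≤ 2L cannot contain the ball of radius r, whose mass is at least
  -- 4L/n.
  have hball : ∀ x, massRadius (torusMeasure lam) x (v / n) ≤ r := fun x => by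
    obtain ⟨-, h2, -⟩ := massRadius_spec (hK x) (div_pos hv hnR) ((div_lt_one hnR).2 hvn)
    by_contra! hlt
    have h4 := measureReal_mono (μ := torusMeasure lam) (Metric.closedBall_subset_closedBall (x := x) hlt.le)
    rw [h2, le_div_iff₀' hnR] at h4
    linarith [hmass x]
  -- About L slabs make each slab mass O(1/L), while the corridors, of volume 4mr, stay below 1/L
  -- because r is smaller than any power of 1/L.
  set m := ⌈L⌉₊ with hm_def
  have hm0 : 0 < m := Nat.ceil_pos.2 hL0
  have hm1 : L ≤ m := Nat.le_ceil L
  have hm2 : (m : ℝ) ≤ 2 * L := by linarith [Nat.ceil_lt_add_one hL0.le]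
  have hmr : 4 * m * r ≤ 1 / L := by
    calc 4 * m * r ≤ 4 * (2 * L) * r := by gcongr
      _ = 8 * L * r := by ring
      _ ≤ 1 / (2 * L) := hLr
      _ ≤ 1 / L := by gcongr; linarith
  refine (abs_expect_blockConfig_sub_le_slabError hm hlam hη h hζ h' (by lia) hn2 hk hv hvn hr hr8 hball
    (pr := ENNReal.ofReal (2 ^ k * Real.exp (-(2 * L))))
    (A := ENNReal.ofReal (Real.exp (-b) * (k - 1).factorial * (k * 2 ^ (k - 1))))
    (fun x => ENNReal.ofReal_le_ofReal ?_) ?_ hm0 (hmr.trans ((div_le_one hL0).2 hL1)) hg).trans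
    (slabError_le ?_ ?_ ?_ ?_ ?_)
  · refine (poissonTail_le k (by positivity)).trans ?_
    gcongr
    linarith [hmass x]
  · rw [← ENNReal.ofReal_natCast, ← ENNReal.ofReal_mul hnR.le]
    exact ENNReal.ofReal_le_ofReal (mul_poissonTail_le hn2 hk hL1 hv.le hv2)
  · gcongr
    exact hmr.trans (by gcongr)
  · gcongr
  · have e1 : (n : ℝ≥0∞) * ENNReal.ofReal (2 / (lamMinus * v / (8 * r * lamPlus))) ^ d ≤
        ENNReal.ofReal ((32 * lamPlus / lamMinus) ^ d * ((d / 2) ^ d * (4 / lamMinus))) *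
          ENNReal.ofReal (l / L) := by
      refine le_trans ?_ (mul_le_mul_right hx _)
      rw [← ENNReal.ofReal_natCast, ← ENNReal.ofReal_pow (by positivity),
        ← ENNReal.ofReal_mul hnR.le, ← ENNReal.ofReal_mul (by positivity)]
      refine ENNReal.ofReal_le_ofReal ?_
      have h2 : 2 / (lamMinus * v / (8 * r * lamPlus)) ≤ 32 * lamPlus / lamMinus * (r / L) := by
        rw [show 2 / (lamMinus * v / (8 * r * lamPlus)) = 16 * lamPlus / lamMinus * (r / v) by
          field_simp; ring, show 32 * lamPlus / lamMinus * (r / L) =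
          16 * lamPlus / lamMinus * (r / (L / 2)) by field_simp; ring]
        gcongr
      have h3 : L ^ 2 ≤ L ^ d := pow_le_pow_right₀ hL1 hd
      calc n * (2 / (lamMinus * v / (8 * r * lamPlus))) ^ d
          ≤ n * (32 * lamPlus / lamMinus * (r / L)) ^ d := by gcongr
        _ = (32 * lamPlus / lamMinus) ^ d * ((d / 2) ^ d * (4 / lamMinus)) * (L / L ^ d) := by
            rw [mul_pow, div_pow r, hrd]; field_simp
        _ ≤ (32 * lamPlus / lamMinus) ^ d * ((d / 2) ^ d * (4 / lamMinus)) * (L / L ^ 2) := by gcongr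
        _ = _ := by field_simp
    calc _ = 2 ^ k * (ENNReal.ofReal lamPlus * expLayerConst d) *
          ((n : ℝ≥0∞) * ENNReal.ofReal (2 / (lamMinus * v / (8 * r * lamPlus))) ^ d) := by ring
      _ ≤ _ := by
        rw [mul_assoc _ (ENNReal.ofReal _) (ENNReal.ofReal (l / L))]
        gcongr
  · exact erlangError_le hk hl hL0 b
  · refine le_trans ?_ (mul_le_mul_right hx _)
    rw [← ENNReal.ofReal_natCast, ← ENNReal.ofReal_mul hnR.le, ← ENNReal.ofReal_mul (by positivity)]
    refine ENNReal.ofReal_le_ofReal ?_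
    -- Intensity 4L in the ball of radius r makes it sparse with probability at most 2^k / n², so
    -- the expected number of sparse points is at most 2^k / n.
    have e1 : Real.exp (-(2 * L)) = 1 / (n * n) := by
      rw [Real.exp_neg, two_mul, Real.exp_add, hL_def, Real.exp_log hnR, one_div]
    rw [e1]
    calc _ = 2 ^ k * (1 / (n : ℝ)) := by field_simp
      _ ≤ _ := by gcongr; linarith

/-! ### The bound for the Kantorovich-Rubinstein distance -/

lemma limitIntensity_eq_prod {d : ℕ} {lam : FlatTorus d → ℝ} (hlam : Measurable lam)
    (h0 : ∀ x, 0 ≤ lam x) : limitIntensity lam =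
      (torusMeasure lam).prod (volume.withDensity fun t => ENNReal.ofReal (Real.exp (-t))) := by
  rw [torusMeasure, prod_withDensity (by fun_prop) (by fun_prop), limitIntensity]
  simp only [ENNReal.ofReal_mul (h0 _)]

lemma limitIntensity_restrict {d : ℕ} {lam : FlatTorus d → ℝ} (hlam : Measurable lam)
    (h0 : ∀ x, 0 ≤ lam x) (b : ℝ) :
    (limitIntensity lam).restrict (Set.univ ×ˢ Set.Ioi b) = (torusMeasure lam).prod (levelLaw b) := by
  have : SFinite (torusMeasure lam) := by unfold torusMeasure; infer_instance
  rw [limitIntensity_eq_prod hlam h0, ← Measure.prod_restrict, Measure.restrict_univ, levelLaw]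

lemma TVLip.abs_expect_sub_zero_le {Y : Type*} [MeasurableSpace Y] {g : FiniteConfig Y → ℝ}
    (hg : TVLip g) {Ω : Type*} [MeasurableSpace Ω] {P : Measure Ω} [IsProbabilityMeasure P]
    {ξ : Ω → FiniteConfig Y} (hξ : Measurable ξ) (h : ∫⁻ ω, (ξ ω).1 Set.univ ∂P ≠ ∞) :
    ENNReal.ofReal |(∫ ω, g (ξ ω) ∂P) - g 0| ≤ ∫⁻ ω, (ξ ω).1 Set.univ ∂P := by
  have := hg.abs_integral_sub_le (ξ' := fun _ => 0) (D := fun ω => (ξ ω).1 Set.univ) hξ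
    measurable_const h (by simp) (fun ω A hA => by simpa using measure_mono (Set.subset_univ A))
    (fun ω A _ => by simp)
  simpa using this

/-- Both expectations are compared with the value at the empty configuration. This crude bound
serves the small n. -/
lemma TVLip.abs_expect_sub_le_add {Y : Type*} [MeasurableSpace Y] {g : FiniteConfig Y → ℝ}
    (hg : TVLip g) {Ω Ω' : Type*} [MeasurableSpace Ω] [MeasurableSpace Ω'] {P : Measure Ω}
    [IsProbabilityMeasure P] {P' : Measure Ω'} [IsProbabilityMeasure P'] {ξ : Ω → FiniteConfig Y}
    {ζ : Ω' → FiniteConfig Y} (hξ : Measurable ξ) (hζ : Measurable ζ)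
    (h : ∫⁻ ω, (ξ ω).1 Set.univ ∂P ≠ ∞) (h' : ∫⁻ ω, (ζ ω).1 Set.univ ∂P' ≠ ∞) :
    ENNReal.ofReal |(∫ ω, g (ξ ω) ∂P) - ∫ ω, g (ζ ω) ∂P'| ≤
      ∫⁻ ω, (ξ ω).1 Set.univ ∂P + ∫⁻ ω, (ζ ω).1 Set.univ ∂P' := by
  refine le_trans ?_ (add_le_add (hg.abs_expect_sub_zero_le hξ h) (hg.abs_expect_sub_zero_le hζ h'))
  rw [← ENNReal.ofReal_add (abs_nonneg _) (abs_nonneg _)]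
  refine ENNReal.ofReal_le_ofReal ?_
  have h3 := _root_.abs_sub_le (∫ ω, g (ξ ω) ∂P) (g 0) (∫ ω, g (ζ ω) ∂P')
  rwa [abs_sub_comm (g 0)] at h3

lemma coe_blockConfig_univ {d : ℕ} (K : Measure (FlatTorus d)) [IsProbabilityMeasure K] (n k : ℕ)
    (b : ℝ) (ω : FiniteConfig (FlatTorus d)) :
    (blockConfig K n k b .univ .univ ω).1 =
      (knnProcess K n k ω.1).restrict (Set.univ ×ˢ Set.Ioi b) := by
  rw [blockConfig, FiniteConfig.coe_restrict, coe_knnConfig, FiniteConfig.coe_restrict,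
    Measure.restrict_univ]

lemma one_lt_log_three : 1 < Real.log 3 := by
  rw [Real.lt_log_iff_exp_lt (by norm_num)]
  exact Real.exp_one_lt_d9.trans (by norm_num)

/-- Beyond a threshold depending only on d, k, b and λ₋ the asymptotic bound applies. Below it the
expected numbers of points are bounded, and log log n / log n is bounded away from zero since log 3
> 1. -/
lemma exists_krDist_le.{u, v} {d k : ℕ} (hd : 2 ≤ d) (hk : 1 ≤ k) (b : ℝ) {lamMinus lamPlus : ℝ}
    (hm : 0 < lamMinus) : ∃ C : ℝ, 0 < C ∧
      ∀ lam : FlatTorus d → ℝ, Measurable lam →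
        (∀ x, lamMinus ≤ lam x ∧ lam x ≤ lamPlus) →
        IsProbabilityMeasure (torusMeasure lam) →
      ∀ (Ω : Type u) (Ω' : Type v) [MeasurableSpace Ω] [MeasurableSpace Ω']
        (P : Measure Ω) [IsProbabilityMeasure P] (P' : Measure Ω') [IsProbabilityMeasure P']
        (n : ℕ) (η : Ω → Measure (FlatTorus d)) (ζ : Ω' → Measure (FlatTorus d × ℝ)),
        3 ≤ n →
        IsPoissonProcess η ((n : ℝ≥0∞) • torusMeasure lam) P →
        IsPoissonProcess ζ (limitIntensity lam) P' →
        krDist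
            P (fun ω => (knnProcess (torusMeasure lam) n k (η ω)).restrict (Set.univ ×ˢ Set.Ioi b))
            P' (fun ω => (ζ ω).restrict (Set.univ ×ˢ Set.Ioi b))
          ≤ ENNReal.ofReal (C * (Real.log (Real.log n) / Real.log n)) := by
  obtain ⟨n₀, hn₀⟩ := eventually_atTop.1 (eventually_isLargeIntensity (by lia : d ≠ 0) hm k b)
  set N := max n₀ 3 with hN
  have hNR : (3 : ℝ) ≤ N := by exact_mod_cast le_max_right _ _
  have hlog3 := one_lt_log_three
  have hll3 : 0 < Real.log (Real.log 3) := Real.log_pos hlog3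
  have hlogN : 0 < Real.log N := Real.log_pos (by linarith)
  -- This is the trivial bound N + e^{-b} divided by a lower bound for log log n / log n on 3 ≤ n ≤
  -- N.
  set C₂ := (N + Real.exp (-b)) * (Real.log N / Real.log (Real.log 3)) with hC₂
  have hC₂0 : 0 < C₂ := by positivity
  refine ⟨(largeConst d k lamMinus lamPlus b).toReal + C₂, by positivity, ?_⟩
  intro lam hlamm hlam hprob Ω Ω' _ _ P _ P' _ n η ζ hn hη hζ
  have hnR : (3 : ℝ) ≤ n := by exact_mod_cast hn
  have hlogn : Real.log 3 ≤ Real.log n := Real.log_le_log (by norm_num) hnR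
  have hlln : Real.log (Real.log 3) ≤ Real.log (Real.log n) := Real.log_le_log (by linarith) hlogn
  have hx0 : 0 < Real.log (Real.log n) / Real.log n := div_pos (by linarith) (by linarith)
  -- Both processes are replaced by almost surely equal versions whose values are everywhere finite
  -- counting measures.
  obtain ⟨η', hη'm, hηη', hη'⟩ := hη.exists_finiteConfig
  have hζr := hζ.restrict (MeasurableSet.univ.prod (measurableSet_Ioi (a := b)))
  rw [limitIntensity_restrict hlamm fun x => hm.le.trans (hlam x).1] at hζr
  obtain ⟨ζ', hζ'm, hζζ', hζ'⟩ := hζr.exists_finiteConfig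
  set K := torusMeasure lam
  set ξ' : Ω → FiniteConfig (FlatTorus d × ℝ) := fun ω => blockConfig K n k b .univ .univ (η' ω)
  have hξ'm : Measurable ξ' := (measurable_blockConfig _ _).comp hη'm
  have hξξ' : ∀ᵐ ω ∂P, (knnProcess K n k (η ω)).restrict (Set.univ ×ˢ Set.Ioi b) = (ξ' ω).1 := by
    filter_upwards [hηη'] with ω hω
    rw [hω, coe_blockConfig_univ]
  have hξfin : ∫⁻ ω, (ξ' ω).1 Set.univ ∂P ≠ ∞ :=
    lintegral_blockConfig_univ_ne_top .univ .univ le_rfl hη'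
  have hζeq : ∫⁻ ω, (ζ' ω).1 Set.univ ∂P' = ENNReal.ofReal (Real.exp (-b)) := by
    rw [hζ'.lintegral_apply MeasurableSet.univ, ← Set.univ_prod_univ, Measure.prod_prod, levelLaw_univ,
      measure_univ, one_mul]
  have hζfin : ∫⁻ ω, (ζ' ω).1 Set.univ ∂P' ≠ ∞ := by rw [hζeq]; finiteness
  refine iSup₂_le fun g hg => ?_
  have hgL := hg.tvLip
  have e1 : (fun ω => g ((knnProcess K n k (η ω)).restrict (Set.univ ×ˢ Set.Ioi b))) =ᵐ[P]
      fun ω => g (ξ' ω).1 := by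
    filter_upwards [hξξ'] with ω hω
    rw [hω]
  have e2 : (fun ω => g ((ζ ω).restrict (Set.univ ×ˢ Set.Ioi b))) =ᵐ[P'] fun ω => g (ζ' ω).1 := by
    filter_upwards [hζζ'] with ω hω
    rw [hω]
  -- Both expectations exist, so the value ∞ in the definition of the distance does not occur.
  rw [if_pos ⟨(hgL.integrable hξ'm hξfin).congr e1.symm, (hgL.integrable hζ'm hζfin).congr e2.symm⟩,
    integral_congr_ae e1, integral_congr_ae e2]
  rcases le_or_gt n₀ n with hlarge | hsmall
  · refine (abs_expect_blockConfig_sub_le_of_large hm hlam hη'm hη' hζ'm hζ' hd hk (hn₀ n hlarge)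
      hgL).trans ?_
    rw [← ENNReal.ofReal_toReal (largeConst_ne_top d k lamMinus lamPlus b),
      ← ENNReal.ofReal_mul ENNReal.toReal_nonneg]
    refine ENNReal.ofReal_le_ofReal (mul_le_mul_of_nonneg_right ?_ hx0.le)
    rw [ENNReal.toReal_ofReal ENNReal.toReal_nonneg]
    linarith
  · have hnN : (n : ℝ) ≤ N := by exact_mod_cast hsmall.le.trans (le_max_left _ _)
    refine (hgL.abs_expect_sub_le_add hξ'm hζ'm hξfin hζfin).trans ?_
    have h1 : ∫⁻ ω, (ξ' ω).1 Set.univ ∂P ≤ ENNReal.ofReal n := by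
      refine (lintegral_mono fun ω => blockConfig_univ_le .univ .univ le_rfl (η' ω)).trans_eq ?_
      rw [hη'.lintegral_apply MeasurableSet.univ, Measure.smul_apply, measure_univ, smul_eq_mul,
        mul_one, ENNReal.ofReal_natCast]
    rw [hζeq]
    refine (add_le_add_left h1 _).trans ?_
    rw [← ENNReal.ofReal_add (by positivity) (by positivity)]
    refine ENNReal.ofReal_le_ofReal ?_
    have h2 : Real.log (Real.log 3) / Real.log N ≤ Real.log (Real.log n) / Real.log n := by
      have : Real.log n ≤ Real.log N := Real.log_le_log (by linarith) hnN
      have : 0 < Real.log n := by linarith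
      have : 0 < Real.log (Real.log n) := by linarith
      gcongr
    calc (n : ℝ) + Real.exp (-b) ≤ N + Real.exp (-b) := by gcongr
      _ = C₂ * (Real.log (Real.log 3) / Real.log N) := by rw [hC₂]; field_simp
      _ ≤ C₂ * (Real.log (Real.log n) / Real.log n) := by gcongr
      _ ≤ _ := by
        gcongr
        linarith [ENNReal.toReal_nonneg (a := largeConst d k lamMinus lamPlus b)]

/-! ### Configurations on a countable set -/

namespace FiniteConfig

variable {X : Type*} [MeasurableSpace X] [MeasurableSingletonClass X] {t : Set X}

/-- The finite counting measures which are carried by `t`. -/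
def carriedBy (t : Set X) : Set (FiniteConfig X) := {ω | ω.1 tᶜ = 0}

lemma eq_of_apply_singleton (ht : t.Countable) {ω₁ ω₂ : FiniteConfig X} (h₁ : ω₁ ∈ carriedBy t)
    (h₂ : ω₂ ∈ carriedBy t) (h : ∀ y ∈ t, ω₁.1 {y} = ω₂.1 {y}) : ω₁ = ω₂ := by
  refine ext_of_apply fun B _ => ?_
  have key : ∀ ω ∈ carriedBy t, ω.1 B = ∑' p : ↥(B ∩ t), ω.1 {p.1} := fun ω hω => by
    rw [← measure_inter_conull (s := B) hω, ← measure_biUnion (ht.mono Set.inter_subset_right)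
      (fun x _ y _ hxy => Set.disjoint_singleton.2 hxy) fun y _ => measurableSet_singleton y,
      Set.biUnion_of_singleton]
  rw [key _ h₁, key _ h₂]
  exact tsum_congr fun p => h _ p.2.2

/-- Such a configuration is a finitely supported function from a countable set to ℕ. -/
lemma countable_carriedBy (ht : t.Countable) : (carriedBy t).Countable := by
  classical
  have := ht.to_subtype
  have hfin : ∀ ω : FiniteConfig X, {y : t | 1 ≤ ω.1 {y.1}}.Finite := fun ω =>
    Measure.finite_const_le_meas_of_disjoint_iUnion ω.1 one_pos
      (fun y => measurableSet_singleton y.1)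
      (fun x y hxy => Set.disjoint_singleton.2 fun h => hxy (Subtype.ext h)) (measure_ne_top _ _)
  have hmem : ∀ (ω : FiniteConfig X) (y : t), (ω.1 {y.1}).toNNReal.toReal ≠ 0 → y ∈ (hfin ω).toFinset := by
    intro ω y hy
    obtain ⟨j, hj⟩ := ω.exists_nat (measurableSet_singleton y.1)
    rw [Set.Finite.mem_toFinset, Set.mem_ofPred_eq, hj]
    have : j ≠ 0 := by rintro rfl; simp [hj] at hy
    exact_mod_cast Nat.one_le_iff_ne_zero.2 this
  set N : FiniteConfig X → t → ℕ := fun ω y => (ω.exists_nat (measurableSet_singleton y.1)).choose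
  have hN : ∀ ω y, ω.1 {y.1} = N ω y := fun ω y =>
    (ω.exists_nat (measurableSet_singleton y.1)).choose_spec
  refine Set.countable_coe_iff.1 (Function.Injective.countable (β := t →₀ ℕ)
    (f := fun ω => Finsupp.onFinset (hfin ω.1).toFinset (N ω.1) fun y hy => ?_) fun ω₁ ω₂ h => ?_)
  · refine hmem _ _ ?_
    rw [hN]
    simpa using hy
  · refine Subtype.ext (eq_of_apply_singleton ht ω₁.2 ω₂.2 fun y hy => ?_)
    have := DFunLike.congr_fun h ⟨y, hy⟩
    simp only [Finsupp.onFinset_apply] at this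
    rw [hN _ ⟨y, hy⟩, hN _ ⟨y, hy⟩, this]

/-- Every function of a random finite counting measure on a countable set is measurable. -/
lemma measurable_comp_of_carriedBy {α β : Type*} [MeasurableSpace α] [MeasurableSpace β]
    (ht : t.Countable) {Φ : α → FiniteConfig X} (hΦ : Measurable Φ) (h : ∀ a, Φ a ∈ carriedBy t)
    (G : FiniteConfig X → β) : Measurable fun a => G (Φ a) := by
  intro B _
  have e : (fun a => G (Φ a)) ⁻¹' B = ⋃ σ ∈ carriedBy t ∩ G ⁻¹' B,
      ⋂ y ∈ t, {a | (Φ a).1 {y} = σ.1 {y}} := by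
    ext a
    simp only [Set.mem_preimage, Set.mem_iUnion, Set.mem_iInter, Set.mem_ofPred_eq, exists_prop]
    constructor
    · exact fun ha => ⟨Φ a, ⟨h a, ha⟩, fun _ _ => rfl⟩
    · rintro ⟨σ, ⟨hσ, hB⟩, hy⟩
      rwa [eq_of_apply_singleton ht (h a) hσ hy]
  rw [e]
  refine MeasurableSet.biUnion ((countable_carriedBy ht).mono Set.inter_subset_left) fun σ _ =>
    MeasurableSet.biInter ht fun y _ => ?_
  exact (measurable_coe (measurableSet_singleton y)).comp hΦ (measurableSet_singleton _)

end FiniteConfig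

/-! ### Vague convergence -/

section Vague

variable {Y : Type*} [MeasurableSpace Y]

/-- A finite counting measure, as a locally finite one. -/
def FiniteConfig.toLocallyFinite [TopologicalSpace Y] (ω : FiniteConfig Y) : LocallyFiniteConfig Y :=
  ⟨ω.1, ω.2.1, inferInstance⟩

lemma tendsto_of_vague [TopologicalSpace Y] {F : Measure Y → ℝ}
    (hF : Continuous fun ω : LocallyFiniteConfig Y => F ω.1) {ι : Type*} {l : Filter ι}
    {ω : ι → FiniteConfig Y} {ω₀ : LocallyFiniteConfig Y}
    (h : ∀ f : C_c(Y, ℝ), Tendsto (fun i => ∫ y, f y ∂(ω i).1) l (𝓝 (∫ y, f y ∂ω₀.1))) :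
    Tendsto (fun i => F (ω i).1) l (𝓝 (F ω₀.1)) := by
  have h1 : Tendsto (fun i => (ω i).toLocallyFinite) l (𝓝 ω₀) := by
    rw [nhds_induced, tendsto_comap_iff, tendsto_pi_nhds]
    exact h
  exact (hF.tendsto ω₀).comp h1

variable [PseudoMetricSpace Y] [SecondCountableTopology Y] [BorelSpace Y]

/-- Discretized configurations approximate the original one. -/
lemma tendsto_integral_map_approxOn {s : Set Y} {y₀ : Y} (h₀ : y₀ ∈ s) {ω : FiniteConfig Y}
    (hω : ω.1 (closure s)ᶜ = 0) (f : C_c(Y, ℝ)) :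
    Tendsto (fun m => ∫ y, f y ∂(ω.map (SimpleFunc.measurable
      (SimpleFunc.approxOn id measurable_id s y₀ h₀ m))).1) atTop (𝓝 (∫ y, f y ∂ω.1)) := by
  obtain ⟨c, hc⟩ := f.continuous.bounded_above_of_compact_support f.hasCompactSupport
  have e : ∀ m, ∫ y, f y ∂(ω.map (SimpleFunc.measurable
      (SimpleFunc.approxOn id measurable_id s y₀ h₀ m))).1 =
      ∫ y, f (SimpleFunc.approxOn id measurable_id s y₀ h₀ m y) ∂ω.1 := fun m =>
    integral_map (SimpleFunc.measurable _).aemeasurable f.continuous.aestronglyMeasurable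
  simp only [e]
  refine tendsto_integral_of_dominated_convergence (fun _ => c) (fun m => ?_) (integrable_const _)
    (fun m => .of_forall fun y => hc _) ?_
  · exact (f.continuous.measurable.comp (SimpleFunc.measurable _)).aestronglyMeasurable
  · filter_upwards [compl_mem_ae_iff.2 hω] with y hy
    rw [compl_compl] at hy
    exact (f.continuous.tendsto y).comp (SimpleFunc.tendsto_approxOn measurable_id h₀ hy)

variable [MeasurableSingletonClass Y]

/-- Vaguely continuous functionals are measurable on the finite counting measures. -/
lemma measurable_of_vaguelyContinuous {F : Measure Y → ℝ}
    (hF : Continuous fun ω : LocallyFiniteConfig Y => F ω.1) :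
    Measurable fun ω : FiniteConfig Y => F ω.1 := by
  rcases isEmpty_or_nonempty Y with hY | ⟨⟨y₀⟩⟩
  · have : Subsingleton (FiniteConfig Y) :=
      ⟨fun ω₁ ω₂ => Subtype.ext (by rw [Measure.eq_zero_of_isEmpty ω₁.1, Measure.eq_zero_of_isEmpty ω₂.1])⟩
    exact Subsingleton.measurable
  · have h₀ : y₀ ∈ (Set.univ : Set Y) := trivial
    -- Moving all points into a finite set leaves countably many possible configurations, so F of
    -- the discretized configuration is measurable without any assumption on F. Vague continuity
    -- then gives F as a pointwise limit.
    set φ := SimpleFunc.approxOn (id : Y → Y) measurable_id Set.univ y₀ h₀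
    refine measurable_of_tendsto_metrizable
      (f := fun m (ω : FiniteConfig Y) => F (ω.map (φ m).measurable).1) (fun m => ?_)
      (tendsto_pi_nhds.2 fun ω => ?_)
    · have hm : Measurable fun ω : FiniteConfig Y => ω.map (φ m).measurable :=
        FiniteConfig.measurable_map (g := fun ω : FiniteConfig Y => ω) measurable_id
          ((φ m).measurable.comp measurable_snd)
      refine FiniteConfig.measurable_comp_of_carriedBy (φ m).finite_range.countable hm (fun ω => ?_)
        fun ω => F ω.1
      change (ω.1.map (φ m)) (Set.range (φ m))ᶜ = 0
      rw [Measure.map_apply (φ m).measurable (φ m).finite_range.measurableSet.compl]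
      simp
    · exact tendsto_of_vague hF (ω₀ := ω.toLocallyFinite)
        fun f => tendsto_integral_map_approxOn h₀ (by simp) f

end Vague

/-! ### Vague convergence from convergence above each level -/

section Level

/-- The points above the level `b`. -/
def aboveLevel (T : Type*) (b : ℝ) : Set (T × ℝ) := Set.univ ×ˢ Set.Ioi b

lemma measurableSet_aboveLevel {T : Type*} [MeasurableSpace T] (b : ℝ) :
    MeasurableSet (aboveLevel T b) := MeasurableSet.univ.prod measurableSet_Ioi

variable {T : Type*} [MetricSpace T] [SecondCountableTopology T] [MeasurableSpace T]
  [BorelSpace T] [Nonempty T]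

/-- Simple functions that approximate the identity on the set of points that are not above `b`. -/
def belowApprox (T : Type*) [MetricSpace T] [SecondCountableTopology T] [MeasurableSpace T]
    [BorelSpace T] [Nonempty T] (b : ℝ) (m : ℕ) : SimpleFunc (T × ℝ) (T × ℝ) :=
  SimpleFunc.approxOn id measurable_id {y : T × ℝ | y.2 ≤ b} (Classical.arbitrary T, b)
    (le_refl b) m

/-- A countable dense set of points that are not above `b`. -/
def belowPoints (T : Type*) [MetricSpace T] [SecondCountableTopology T] [MeasurableSpace T]
    [BorelSpace T] [Nonempty T] (b : ℝ) : Set (T × ℝ) := ⋃ m, Set.range (belowApprox T b m)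

lemma countable_belowPoints (b : ℝ) : (belowPoints T b).Countable :=
  Set.countable_iUnion fun m => (belowApprox T b m).finite_range.countable

lemma le_of_mem_belowPoints {b : ℝ} {y : T × ℝ} (hy : y ∈ belowPoints T b) : y.2 ≤ b := by
  obtain ⟨m, x, rfl⟩ := Set.mem_iUnion.1 hy
  exact SimpleFunc.approxOn_mem (s := {y : T × ℝ | y.2 ≤ b}) measurable_id _ m x

/-- The largest value of `F` on the configurations which agree with `ω` above `b`. -/
def upperEnvelope (F : Measure (T × ℝ) → ℝ) (b : ℝ) (ω : FiniteConfig (T × ℝ)) : ℝ :=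
  ⨆ σ : FiniteConfig.carriedBy (belowPoints T b), F (ω + σ.1).1

variable {F : Measure (T × ℝ) → ℝ} {c : ℝ}

section Bounded

variable (hc : ∀ ω : FiniteConfig (T × ℝ), |F ω.1| ≤ c)

instance (b : ℝ) : Nonempty (FiniteConfig.carriedBy (belowPoints T b)) :=
  ⟨0, by simp [FiniteConfig.carriedBy]⟩

include hc

lemma bddAbove_upperEnvelope (b : ℝ) (ω : FiniteConfig (T × ℝ)) :
    BddAbove (Set.range fun σ : FiniteConfig.carriedBy (belowPoints T b) => F (ω + σ.1).1) :=
  ⟨c, by rintro _ ⟨σ, rfl⟩; exact (abs_le.1 (hc _)).2⟩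

lemma le_upperEnvelope_of_carriedBy {b : ℝ} (ω : FiniteConfig (T × ℝ)) {σ : FiniteConfig (T × ℝ)}
    (hσ : σ ∈ FiniteConfig.carriedBy (belowPoints T b)) : F (ω + σ).1 ≤ upperEnvelope F b ω :=
  le_ciSup (bddAbove_upperEnvelope hc b ω) ⟨σ, hσ⟩

lemma abs_upperEnvelope_le (b : ℝ) (ω : FiniteConfig (T × ℝ)) : |upperEnvelope F b ω| ≤ c := by
  refine abs_le.2 ⟨?_, ciSup_le fun σ => (abs_le.1 (hc _)).2⟩
  exact (abs_le.1 (hc (ω + 0))).1.trans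
    (le_upperEnvelope_of_carriedBy hc ω (by simp [FiniteConfig.carriedBy]))

end Bounded

variable (hF : Continuous fun ω : LocallyFiniteConfig (T × ℝ) => F ω.1)

include hF

/-- The supremum runs over configurations carried by a countable set, hence over countably many
measurable functions. -/
lemma measurable_upperEnvelope (b : ℝ) : Measurable (upperEnvelope F b) := by
  have := (FiniteConfig.countable_carriedBy (countable_belowPoints (T := T) b)).to_subtype
  refine Measurable.iSup fun σ => ?_
  have h1 : Measurable fun ω : FiniteConfig (T × ℝ) => ω + σ.1 := measurable_id.add measurable_const
  exact (measurable_of_vaguelyContinuous hF).comp h1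

/-- The points not above b need not lie in the countable set. They are approximated by points that
do; the envelope bounds F along the approximation, and vague continuity passes to the limit. -/
lemma le_upperEnvelope (hc : ∀ ω : FiniteConfig (T × ℝ), |F ω.1| ≤ c) (b : ℝ)
    (ω : FiniteConfig (T × ℝ)) :
    F ω.1 ≤ upperEnvelope F b (ω.restrict (measurableSet_aboveLevel b)) := by
  have hb := measurableSet_aboveLevel (T := T) b
  set ω₁ := ω.restrict hb
  set ω₂ := ω.restrict hb.compl
  have hsum : ω₁.1 + ω₂.1 = ω.1 := Measure.restrict_add_restrict_compl hb
  have hclosed : IsClosed {y : T × ℝ | y.2 ≤ b} := isClosed_le continuous_snd continuous_const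
  have h2 : ω₂.1 (closure {y : T × ℝ | y.2 ≤ b})ᶜ = 0 := by
    rw [hclosed.closure_eq]
    change ω.1.restrict _ _ = 0
    rw [Measure.restrict_apply hclosed.measurableSet.compl]
    convert measure_empty (μ := ω.1)
    ext y
    simp [aboveLevel]
  have hint : ∀ (ν : FiniteConfig (T × ℝ)) (f : C_c(T × ℝ, ℝ)), Integrable f ν.1 := fun ν f =>
    f.continuous.integrable_of_hasCompactSupport f.hasCompactSupport
  have key := tendsto_of_vague hF (l := atTop) (ω₀ := ω.toLocallyFinite)
    (ω := fun m => ω₁ + ω₂.map (belowApprox T b m).measurable) fun f => by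
      have h3 := (tendsto_integral_map_approxOn (s := {y : T × ℝ | y.2 ≤ b})
        (y₀ := (Classical.arbitrary T, b)) (le_refl b) h2 f).const_add (∫ y, f y ∂ω₁.1)
      rw [← integral_add_measure (hint _ _) (hint _ _), hsum] at h3
      refine h3.congr fun m => ?_
      exact (integral_add_measure (hint _ _) (hint _ _)).symm
  refine le_of_tendsto key (.of_forall fun m => le_upperEnvelope_of_carriedBy hc _ ?_)
  change (ω₂.1.map (belowApprox T b m)) (belowPoints T b)ᶜ = 0
  refine measure_mono_null (t := (Set.range (belowApprox T b m))ᶜ)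
    (Set.compl_subset_compl.2 (Set.subset_iUnion (fun m => Set.range (belowApprox T b m)) m)) ?_
  rw [Measure.map_apply (belowApprox T b m).measurable
    (belowApprox T b m).finite_range.measurableSet.compl]
  simp

/-- A test function has compact support, hence vanishes below some height. It eventually ignores
whatever is put at or below -j. -/
lemma tendsto_of_agree_above {ω : LocallyFiniteConfig (T × ℝ)} {ω' σ : ℕ → FiniteConfig (T × ℝ)}
    (h : ∀ j : ℕ, (ω' j).1 = ω.1.restrict (aboveLevel T (-j)))
    (hσ : ∀ j : ℕ, σ j ∈ FiniteConfig.carriedBy (belowPoints T (-j))) :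
    Tendsto (fun j => F (ω' j + σ j).1) atTop (𝓝 (F ω.1)) := by
  refine tendsto_of_vague hF fun f => ?_
  have hint : ∀ (ν : FiniteConfig (T × ℝ)), Integrable f ν.1 := fun ν =>
    f.continuous.integrable_of_hasCompactSupport f.hasCompactSupport
  obtain ⟨a, ha⟩ := (f.hasCompactSupport.isCompact.image continuous_snd).bddBelow
  have hf : ∀ y : T × ℝ, y.2 < a → f y = 0 := fun y hy => by
    by_contra h0
    exact absurd (ha ⟨y, subset_tsupport _ h0, rfl⟩) (not_le.2 hy)
  refine tendsto_const_nhds.congr' ?_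
  filter_upwards [tendsto_natCast_atTop_atTop.eventually (eventually_gt_atTop (-a))] with j hj
  rw [FiniteConfig.coe_add, integral_add_measure (hint _) (hint _), h j,
    setIntegral_eq_integral_of_forall_compl_eq_zero, integral_eq_zero_of_ae (μ := (σ j).1), add_zero]
  · filter_upwards [compl_mem_ae_iff.2 (hσ j)] with y hy
    rw [compl_compl] at hy
    exact hf y ((le_of_mem_belowPoints hy).trans_lt (by linarith))
  · intro y hy
    refine hf y (lt_of_le_of_lt (b := -(j : ℝ)) ?_ (by linarith))
    simpa [aboveLevel] using hy

/-- Configurations that attain the supremum up to 1/(j + 1) agree with ω above -j, so they converge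
vaguely to ω and F converges along them. -/
lemma tendsto_upperEnvelope (hc : ∀ ω : FiniteConfig (T × ℝ), |F ω.1| ≤ c)
    {ω : LocallyFiniteConfig (T × ℝ)} {ω' : ℕ → FiniteConfig (T × ℝ)}
    (h : ∀ j : ℕ, (ω' j).1 = ω.1.restrict (aboveLevel T (-j))) :
    Tendsto (fun j : ℕ => upperEnvelope F (-j) (ω' j)) atTop (𝓝 (F ω.1)) := by
  have hex : ∀ j : ℕ, ∃ σ : FiniteConfig.carriedBy (belowPoints T (-j)),
      upperEnvelope F (-j) (ω' j) - 1 / ((j : ℝ) + 1) < F (ω' j + σ.1).1 := fun j =>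
    exists_lt_of_lt_ciSup (sub_lt_self _ (by positivity))
  choose σ hσ using hex
  have h1 := tendsto_of_agree_above hF h fun j => (σ j).2
  have h2 := h1.add tendsto_one_div_add_atTop_nhds_zero_nat
  rw [add_zero] at h2
  refine tendsto_of_tendsto_of_tendsto_of_le_of_le h1 h2
    (fun j => le_upperEnvelope_of_carriedBy hc _ (σ j).2) fun j => ?_
  exact (sub_lt_iff_lt_add.1 (hσ j)).le

end Level

/-! ### From convergence above each level to convergence in distribution -/

section Limit

variable {T : Type*} [MetricSpace T] [SecondCountableTopology T] [MeasurableSpace T]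
  [BorelSpace T] [Nonempty T] {Ω : ℕ → Type*} {Ω' : Type*}
  [∀ n, MeasurableSpace (Ω n)] [MeasurableSpace Ω'] {P : ∀ n, Measure (Ω n)}
  [∀ n, IsProbabilityMeasure (P n)] {P' : Measure Ω'} [IsProbabilityMeasure P']
  {ξ : ∀ n, Ω n → FiniteConfig (T × ℝ)} {ζ : Ω' → Measure (T × ℝ)}
  {ζ' : ℕ → Ω' → FiniteConfig (T × ℝ)} {F : Measure (T × ℝ) → ℝ} {c : ℝ}

/-- F is at most its envelope at -j, which is a bounded functional of the points above -j and to
which `hG` applies. First j is chosen so that the mean envelope of the limit is within ε of that of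
F; then n is taken large. -/
lemma eventually_integral_le_of_above (hξ : ∀ n, Measurable (ξ n)) (hζ' : ∀ j, Measurable (ζ' j))
    (hζ : ∀ᵐ ω ∂P', IsCountingMeasure (ζ ω) ∧ IsLocallyFiniteMeasure (ζ ω))
    (hζζ' : ∀ j : ℕ, ∀ᵐ ω ∂P', (ζ' j ω).1 = (ζ ω).restrict (aboveLevel T (-j)))
    (hG : ∀ (j : ℕ) (G : FiniteConfig (T × ℝ) → ℝ), Measurable G → (∃ c, ∀ ω, |G ω| ≤ c) →
      Tendsto (fun n => ∫ ω, G ((ξ n ω).restrict (measurableSet_aboveLevel (-j))) ∂(P n)) atTop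
        (𝓝 (∫ ω, G (ζ' j ω) ∂P')))
    (hF : Continuous fun ω : LocallyFiniteConfig (T × ℝ) => F ω.1)
    (hc : ∀ ω : LocallyFiniteConfig (T × ℝ), |F ω.1| ≤ c) {ε : ℝ} (hε : 0 < ε) :
    ∀ᶠ n in atTop, ∫ ω, F (ξ n ω).1 ∂(P n) < ∫ ω, F (ζ ω) ∂P' + ε := by
  have hc' : ∀ ω : FiniteConfig (T × ℝ), |F ω.1| ≤ c := fun ω => hc ω.toLocallyFinite
  have h1 : Tendsto (fun j : ℕ => ∫ ω, upperEnvelope F (-j) (ζ' j ω) ∂P') atTop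
      (𝓝 (∫ ω, F (ζ ω) ∂P')) := by
    refine tendsto_integral_of_dominated_convergence (fun _ => c)
      (fun j => ((measurable_upperEnvelope hF _).comp (hζ' j)).aestronglyMeasurable)
      (integrable_const _) (fun j => .of_forall fun ω => abs_upperEnvelope_le hc' _ _) ?_
    filter_upwards [hζ, ae_all_iff.2 hζζ'] with ω h2 h3
    exact tendsto_upperEnvelope hF hc' (ω := ⟨ζ ω, h2⟩) h3
  obtain ⟨j, hj⟩ := (h1.eventually (gt_mem_nhds (lt_add_of_pos_right _ hε))).exists
  have h2 := hG j (upperEnvelope F (-j)) (measurable_upperEnvelope hF _)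
    ⟨c, abs_upperEnvelope_le hc' _⟩
  filter_upwards [h2.eventually (gt_mem_nhds hj)] with n hn
  refine lt_of_le_of_lt (integral_mono ?_ ?_ fun ω => le_upperEnvelope hF hc' (-j) (ξ n ω)) hn
  · exact (integrable_const c).mono' ((measurable_of_vaguelyContinuous hF).comp
      (hξ n)).aestronglyMeasurable (.of_forall fun ω => hc' _)
  · exact (integrable_const c).mono' ((measurable_upperEnvelope hF _).comp
      ((FiniteConfig.measurable_restrict (measurableSet_aboveLevel _)).comp (hξ n))).aestronglyMeasurable
        (.of_forall fun ω => abs_upperEnvelope_le hc' _ _)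

/-- Convergence in distribution follows from convergence in total variation above each level. -/
theorem tendsto_integral_of_above (hξ : ∀ n, Measurable (ξ n)) (hζ' : ∀ j, Measurable (ζ' j))
    (hζ : ∀ᵐ ω ∂P', IsCountingMeasure (ζ ω) ∧ IsLocallyFiniteMeasure (ζ ω))
    (hζζ' : ∀ j : ℕ, ∀ᵐ ω ∂P', (ζ' j ω).1 = (ζ ω).restrict (aboveLevel T (-j)))
    (hG : ∀ (j : ℕ) (G : FiniteConfig (T × ℝ) → ℝ), Measurable G → (∃ c, ∀ ω, |G ω| ≤ c) →
      Tendsto (fun n => ∫ ω, G ((ξ n ω).restrict (measurableSet_aboveLevel (-j))) ∂(P n)) atTop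
        (𝓝 (∫ ω, G (ζ' j ω) ∂P')))
    (hF : Continuous fun ω : LocallyFiniteConfig (T × ℝ) => F ω.1)
    (hc : ∀ ω : LocallyFiniteConfig (T × ℝ), |F ω.1| ≤ c) :
    Tendsto (fun n => ∫ ω, F (ξ n ω).1 ∂(P n)) atTop (𝓝 (∫ ω, F (ζ ω) ∂P')) := by
  refine Metric.tendsto_nhds.2 fun ε hε => ?_
  have h1 := eventually_integral_le_of_above hξ hζ' hζ hζζ' hG hF hc hε
  -- The lower bound is the upper bound for -F.
  have h2 := eventually_integral_le_of_above (F := fun ω => -F ω) hξ hζ' hζ hζζ' hG hF.neg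
    (fun ω => by rw [abs_neg]; exact hc ω) hε
  filter_upwards [h1, h2] with n g1 g2
  rw [integral_neg, integral_neg] at g2
  rw [Real.dist_eq, abs_lt]
  constructor <;> linarith

end Limit

/-! ### Bounded functionals and the Kantorovich-Rubinstein distance -/

section Bounded

variable {Y : Type*} [MeasurableSpace Y]

/-- Distinct finite counting measures differ on some set, and there by a nonzero integer. -/
lemma one_le_tvDist {ω₁ ω₂ : FiniteConfig Y} (h : ω₁ ≠ ω₂) : 1 ≤ tvDist ω₁.1 ω₂.1 := by
  obtain ⟨A, hA, hne⟩ : ∃ A, MeasurableSet A ∧ ω₁.1 A ≠ ω₂.1 A := by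
    by_contra! h'
    exact h (FiniteConfig.ext_of_apply h')
  obtain ⟨i, hi⟩ := ω₁.exists_nat hA
  obtain ⟨j, hj⟩ := ω₂.exists_nat hA
  refine le_trans ?_ (le_iSup₂_of_le A hA (le_iSup₂_of_le (measure_ne_top _ _) (measure_ne_top _ _) le_rfl))
  rw [hi, hj, ENNReal.one_le_ofReal]
  simp only [ENNReal.toReal_natCast]
  have hij : (i : ℤ) - j ≠ 0 := fun h0 => hne (by rw [hi, hj, show i = j by lia])
  exact_mod_cast Int.one_le_abs hij

open Classical in
/-- A functional of finite counting measures, extended to all measures. -/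
def FiniteConfig.extend (G : FiniteConfig Y → ℝ) (μ : Measure Y) : ℝ :=
  if h : IsCountingMeasure μ ∧ IsFiniteMeasure μ then G ⟨μ, h⟩ else 0

lemma FiniteConfig.extend_coe (G : FiniteConfig Y → ℝ) (ω : FiniteConfig Y) :
    FiniteConfig.extend G ω.1 = G ω := by
  rw [FiniteConfig.extend, dif_pos ω.2]

/-- Bounded functionals are Lipschitz, up to a constant. -/
lemma isLipFunctional_extend {G : FiniteConfig Y → ℝ} (hG : Measurable G) {c : ℝ}
    (hc : ∀ ω, |G ω| ≤ c) :
    IsLipFunctional (FiniteConfig.extend fun ω => G ω / (2 * c + 1)) := by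
  have hc0 : 0 ≤ c := (abs_nonneg _).trans (hc 0)
  refine ⟨by simpa only [FiniteConfig.extend_coe] using hG.div_const _, fun ω₁ ω₂ => ?_⟩
  rw [FiniteConfig.extend_coe, FiniteConfig.extend_coe]
  rcases eq_or_ne ω₁ ω₂ with rfl | h
  · simp
  · refine le_trans ?_ (one_le_tvDist h)
    -- The oscillation of G is at most 2c; the added 1 keeps the divisor positive when c = 0.
    rw [ENNReal.ofReal_le_one, ← sub_div, abs_div, abs_of_pos (by positivity : 0 < 2 * c + 1),
      div_le_one (by positivity)]
    have h1 := abs_sub (G ω₁) (G ω₂)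
    linarith [hc ω₁, hc ω₂]

/-- Convergence in the Kantorovich-Rubinstein distance implies convergence in total variation: G /
(2c + 1) is an admissible functional. -/
lemma abs_integral_sub_le_of_krDist_le {Ω Ω' : Type*} [MeasurableSpace Ω] [MeasurableSpace Ω']
    {P : Measure Ω} {P' : Measure Ω'} {ξ : Ω → Measure Y} {ζ : Ω' → Measure Y} {x : ℝ} (hx : 0 ≤ x)
    (h : krDist P ξ P' ζ ≤ ENNReal.ofReal x) {ξ' : Ω → FiniteConfig Y} {ζ' : Ω' → FiniteConfig Y}
    (hξ : ∀ᵐ ω ∂P, ξ ω = (ξ' ω).1) (hζ : ∀ᵐ ω ∂P', ζ ω = (ζ' ω).1) {G : FiniteConfig Y → ℝ}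
    (hG : Measurable G) {c : ℝ} (hc : ∀ ω, |G ω| ≤ c) :
    |(∫ ω, G (ξ' ω) ∂P) - ∫ ω, G (ζ' ω) ∂P'| ≤ (2 * c + 1) * x := by
  have hc0 : 0 ≤ c := (abs_nonneg _).trans (hc 0)
  set g := FiniteConfig.extend fun ω : FiniteConfig Y => G ω / (2 * c + 1)
  have h1 := (le_iSup₂_of_le (f := fun (g : Measure Y → ℝ) (_ : IsLipFunctional g) => _) g
    (isLipFunctional_extend hG hc) le_rfl).trans h
  split_ifs at h1 with h2
  · rw [ENNReal.ofReal_le_ofReal_iff hx] at h1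
    have e1 : ∫ ω, g (ξ ω) ∂P = (∫ ω, G (ξ' ω) ∂P) / (2 * c + 1) := by
      rw [← integral_div]
      refine integral_congr_ae ?_
      filter_upwards [hξ] with ω hω
      rw [hω]
      exact FiniteConfig.extend_coe _ _
    have e2 : ∫ ω, g (ζ ω) ∂P' = (∫ ω, G (ζ' ω) ∂P') / (2 * c + 1) := by
      rw [← integral_div]
      refine integral_congr_ae ?_
      filter_upwards [hζ] with ω hω
      rw [hω]
      exact FiniteConfig.extend_coe _ _
    rwa [e1, e2, ← sub_div, abs_div, abs_of_pos (by positivity : 0 < 2 * c + 1),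
      div_le_iff₀' (by positivity)] at h1
  · simp at h1

end Bounded

/-! ### Convergence in distribution -/

lemma tendsto_loglog_div_log :
    Tendsto (fun n : ℕ => Real.log (Real.log n) / Real.log n) atTop (𝓝 0) :=
  Real.isLittleO_log_id_atTop.tendsto_div_nhds_zero.comp tendsto_log_natCast

/-- The distance bound at each level b = -j tends to zero and yields the convergence of bounded
measurable functionals that `tendsto_integral_of_above` requires. -/
theorem convergesInDistribution_knnProcess.{u, v} {d k : ℕ} (hd : 2 ≤ d) (hk : 1 ≤ k)
    {lamMinus lamPlus : ℝ} (hm : 0 < lamMinus) {lam : FlatTorus d → ℝ} (hlamm : Measurable lam)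
    (hlam : ∀ x, lamMinus ≤ lam x ∧ lam x ≤ lamPlus) (hprob : IsProbabilityMeasure (torusMeasure lam))
    {Ω : ℕ → Type u} {Ω' : Type v} [∀ n, MeasurableSpace (Ω n)] [MeasurableSpace Ω']
    {P : ∀ n, Measure (Ω n)} [∀ n, IsProbabilityMeasure (P n)]
    {P' : Measure Ω'} [IsProbabilityMeasure P']
    {η : ∀ n, Ω n → Measure (FlatTorus d)} {ζ : Ω' → Measure (FlatTorus d × ℝ)}
    (hη : ∀ n, IsPoissonProcess (η n) ((n : ℝ≥0∞) • torusMeasure lam) (P n))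
    (hζ : IsPoissonProcess ζ (limitIntensity lam) P') :
    ConvergesInDistribution P (fun n ω => knnProcess (torusMeasure lam) n k (η n ω)) P' ζ := by
  set K := torusMeasure lam
  choose η' hη'm hηη' hη' using fun n => (hη n).exists_finiteConfig
  have hζr : ∀ j : ℕ, IsPoissonProcess (fun ω => (ζ ω).restrict (aboveLevel (FlatTorus d) (-j)))
      (K.prod (levelLaw (-j))) P' := fun j => by
    have := hζ.restrict (measurableSet_aboveLevel (-(j : ℝ)))
    rwa [aboveLevel, limitIntensity_restrict hlamm fun x => hm.le.trans (hlam x).1] at this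
  choose ζ' hζ'm hζζ' hζ' using fun j => (hζr j).exists_finiteConfig
  set ξ : ∀ n, Ω n → FiniteConfig (FlatTorus d × ℝ) := fun n ω => knnConfig K n k (η' n ω)
  have hξm : ∀ n, Measurable (ξ n) := fun n => (measurable_knnConfig K n k).comp (hη'm n)
  have hξ : ∀ n, ∀ᵐ ω ∂(P n), knnProcess K n k (η n ω) = (ξ n ω).1 := fun n => by
    filter_upwards [hηη' n] with ω hω
    rw [hω]
    rfl
  -- Almost surely all restrictions above the levels -j are finite, and these open sets exhaust the
  -- space.
  have hζconf : ∀ᵐ ω ∂P', IsCountingMeasure (ζ ω) ∧ IsLocallyFiniteMeasure (ζ ω) := by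
    filter_upwards [hζ.counting, ae_all_iff.2 hζζ'] with ω h1 h2
    refine ⟨h1, ⟨fun y => ?_⟩⟩
    obtain ⟨j, hj⟩ := exists_nat_gt (-y.2)
    refine ⟨aboveLevel (FlatTorus d) (-j), (isOpen_univ.prod isOpen_Ioi).mem_nhds
      ⟨trivial, by simp only [Set.mem_Ioi]; linarith⟩, ?_⟩
    rw [← Measure.restrict_apply_univ, h2 j]
    exact measure_lt_top _ _
  refine ⟨fun n => ?_, hζ.measurable.aemeasurable, fun n => ?_, hζconf, fun F hF ⟨c, hc⟩ => ?_⟩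
  · exact ⟨fun ω => (ξ n ω).1, measurable_subtype_coe.comp (hξm n), hξ n⟩
  · filter_upwards [hξ n] with ω hω
    rw [hω]
    exact (ξ n ω).toLocallyFinite.2
  · have e : ∀ n, ∫ ω, F (knnProcess K n k (η n ω)) ∂(P n) = ∫ ω, F (ξ n ω).1 ∂(P n) := fun n => by
      refine integral_congr_ae ?_
      filter_upwards [hξ n] with ω hω
      rw [hω]
    simp only [e]
    refine tendsto_integral_of_above (ζ' := ζ') hξm hζ'm hζconf (fun j => ?_) (fun j G hG ⟨c, hc⟩ => ?_) hF hc
    · filter_upwards [hζζ' j] with ω hω using hω.symm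
    · obtain ⟨C, hC0, hC⟩ := exists_krDist_le.{u, v} hd hk (-(j : ℝ)) (lamPlus := lamPlus) hm
      have hlim : Tendsto (fun n : ℕ => (2 * c + 1) * (C * (Real.log (Real.log n) / Real.log n)))
          atTop (𝓝 0) := by
        simpa using (tendsto_loglog_div_log.const_mul C).const_mul (2 * c + 1)
      rw [tendsto_iff_norm_sub_tendsto_zero]
      refine squeeze_zero' (.of_forall fun n => norm_nonneg _) ?_ hlim
      filter_upwards [eventually_ge_atTop 3] with n hn
      have hnR : (3 : ℝ) ≤ n := by exact_mod_cast hn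
      have hlogn : Real.log 3 ≤ Real.log n := Real.log_le_log (by norm_num) hnR
      have h1 : 1 < Real.log n := one_lt_log_three.trans_le hlogn
      have h2 : 0 ≤ Real.log (Real.log n) := Real.log_nonneg h1.le
      refine abs_integral_sub_le_of_krDist_le (by positivity)
        (hC lam hlamm hlam hprob (Ω n) Ω' (P n) P' n (η n) ζ hn (hη n) hζ)
        (ξ' := fun ω => (ξ n ω).restrict (measurableSet_aboveLevel _)) ?_ (hζζ' j) hG hc
      filter_upwards [hξ n] with ω hω
      rw [hω]
      rfl

end

theorem theorem6p4 (d k : ℕ) (hd : 2 ≤ d) (hk : 1 ≤ k) :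
    (∀ b₀ lamMinus lamPlus : ℝ, 0 < lamMinus →
      ∃ C : ℝ, 0 < C ∧
        ∀ lam : FlatTorus d → ℝ, Measurable lam →
          (∀ x, lamMinus ≤ lam x ∧ lam x ≤ lamPlus) →
          IsProbabilityMeasure (torusMeasure lam) →
        ∀ (Ω Ω' : Type*) [MeasurableSpace Ω] [MeasurableSpace Ω']
          (P : Measure Ω) [IsProbabilityMeasure P] (P' : Measure Ω') [IsProbabilityMeasure P']
          (n : ℕ) (η : Ω → Measure (FlatTorus d)) (ζ : Ω' → Measure (FlatTorus d × ℝ)),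
          3 ≤ n →
          IsPoissonProcess η ((n : ℝ≥0∞) • torusMeasure lam) P →
          IsPoissonProcess ζ (limitIntensity lam) P' →
          krDist
              P (fun ω => (knnProcess (torusMeasure lam) n k (η ω)).restrict
                (Set.univ ×ˢ Set.Ioi b₀))
              P' (fun ω => (ζ ω).restrict (Set.univ ×ˢ Set.Ioi b₀))
            ≤ ENNReal.ofReal (C * (Real.log (Real.log n) / Real.log n))) ∧
    (∀ lamMinus lamPlus : ℝ, 0 < lamMinus →
      ∀ lam : FlatTorus d → ℝ, Measurable lam →
        (∀ x, lamMinus ≤ lam x ∧ lam x ≤ lamPlus) →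
        IsProbabilityMeasure (torusMeasure lam) →
      ∀ (Ω : ℕ → Type*) (Ω' : Type*) [∀ n, MeasurableSpace (Ω n)] [MeasurableSpace Ω']
        (P : ∀ n, Measure (Ω n)) [∀ n, IsProbabilityMeasure (P n)]
        (P' : Measure Ω') [IsProbabilityMeasure P']
        (η : ∀ n, Ω n → Measure (FlatTorus d)) (ζ : Ω' → Measure (FlatTorus d × ℝ)),
        (∀ n, IsPoissonProcess (η n) ((n : ℝ≥0∞) • torusMeasure lam) (P n)) →
        IsPoissonProcess ζ (limitIntensity lam) P' →
        ConvergesInDistribution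
          P (fun n ω => knnProcess (torusMeasure lam) n k (η n ω)) P' ζ) := by
  refine ⟨fun b₀ lamMinus lamPlus hm => exists_krDist_le hd hk b₀ hm, ?_⟩
  intro lamMinus lamPlus hm lam hlamm hlam hprob Ω Ω' _ _ P _ P' _ η ζ hη hζ
  exact convergesInDistribution_knnProcess hd hk hm hlamm hlam hprob hη hζ
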